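/- For $f(x)=\sum_i\alpha_ix_i+\sum_{i>j}\beta_{i,j}x_ix_j+\sum_{i>j>k}\gamma_{i,j,k}x_ix_jx_k$ over $\mathbb F_2$ (an $n$-variable degree-3 polynomial, given by its coefficients) let $\mathrm{gap}(f)=\sum_{x\in\{0,1\}^n}(-1)^{f(x)}$. For constants $u,v,w$ and $a>0$, let $\mathrm{Hard}(u,v,w,a)$ be the following conjecture: for every classical probabilistic algorithm that runs in time $O^*(2^{an})$ (polynomial factors are ignored) and makes queries of length $O(2^{an})$ to an oracle in $\mathrm{NTIME}[n^2]$ there is an $n_0$ such that for every $n>n_0$ the algorithm does not compute $[\mathrm{gap}(f)]^2$ for at least a fraction $v$ of the $n$-variable degree-3 polynomials $f$ (uniformly distributed coefficients), within multiplicative error $u$ and with success probability at least $w$ on each such $f$. An $N$-qubit IQP circuit applies $H^{\otimes N}$ to $|0^N\rangle$, then gates $Z$, $CZ$, $CCZ$ (at most one on each single qubit, pair and triple of qubits; it is described by the table of these gates), then $H^{\otimes N}$, and all qubits are measured in the computational basis; $p_z(C)$ is the probability that the circuit $C$ outputs $z$. A classical probabilistic algorithm that gets the description of $C$ as its input and outputs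 $z$ with probability $q_z(C)$ samples the output distribution of $C$ within additive error $\varepsilon$ if $\sum_{z\in\{0,1\}^N}|p_z(C)-q_z(C)|\le\varepsilon$. It runs in time $O(2^{aN})$ if it halts within that time on all $N$-qubit IQP circuits and for all coin tosses. **Theorem.** Let $u>0$ and $0<v<1/3$. There is a constant $\varepsilon>0$, depending only on $u$ and $v$, such that for all $0<w<1$ and $a>0$: if $\mathrm{Hard}(u,v,w,a)$ is true, then the output distributions of $N$-qubit IQP circuits cannot be classically sampled in time $O(2^{aN})$ within additive error $\varepsilon$, in the following two senses. 1. For every classical probabilistic $O(2^{aN})$-time algorithm there is an $N_0$ such that for every $N>N_0$ there is an $N$-qubit IQP circuit whose output distribution the algorithm does not sample within additive error $\varepsilon$. 2. There is a single family $(C_N)_N$ of $N$-qubit IQP circuits such that every classical probabilistic $O(2^{aN})$-time algorithm fails, for infinitely many $N$, to sample the output distribution of $C_N$ within additive error $\varepsilon$. Time is the number of steps of a multi-tape (equivalently, multi-stack) Turing machine; oracle queries are written on a separate tape and answered in one step. -/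

import Mathlib

open Filter Asymptotics

/-! ### Machines

The machine model is Mathlib's multi-stack model `Turing.TM2` (two stacks are one two-way tape, so
up to constant factors in the time this is the multi-tape Turing machine), with finitely many
stacks of bits, finitely many labels and a finite internal memory.  As usual for probabilistic and
for nondeterministic machines, there are two transition functions `m false`, `m true`, and a bit
(a coin toss, or a nondeterministic choice) selects the one that is applied in a step. -/

/-- A probabilistic / nondeterministic multi-stack machine. -/
structure Machine where
  /-- the stacks -/
  K : Type
  [decK : DecidableEq K]
  [finK : Finite K]
  /-- the labels (control states) -/
  Λ : Type
  [finΛ : Finite Λ]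
  /-- the internal memory -/
  σ : Type
  [finσ : Finite σ]
  /-- the initial label -/
  main : Λ
  /-- the initial content of the internal memory -/
  init : σ
  /-- the input stack -/
  inp : K
  /-- the output stack -/
  out : K
  /-- the two programs -/
  m : Bool → Λ → Turing.TM2.Stmt (fun _ : K => Bool) Λ σ

attribute [instance] Machine.decK Machine.finK Machine.finΛ Machine.finσ

namespace Machine

/-- Configurations; a configuration has halted when its label is `none`. -/
abbrev Cfg (M : Machine) : Type := Turing.TM2.Cfg (fun _ : M.K => Bool) M.Λ M.σ

/-- The initial configuration on the input `x`, whose first bit is on the top of the stack. -/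
def start (M : Machine) (x : List Bool) : M.Cfg :=
  ⟨some M.main, M.init, Function.update (fun _ => []) M.inp x⟩

/-- One step with the bit `b`; halted configurations do not change. -/
def step (M : Machine) (c : M.Cfg) (b : Bool) : M.Cfg :=
  (Turing.TM2.step (M.m b) c).getD c

/-- The configuration after `r.length` steps on the input `x` with the bits `r`. -/
def run (M : Machine) (x r : List Bool) : M.Cfg := r.foldl M.step (M.start x)

end Machine

/-- A machine with an oracle: it has a separate query stack, and when it is at the label `ask`,
it moves in one step to the label `yes` or to the label `no`, according to whether the content of
the query stack belongs to the oracle. -/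
structure OracleMachine extends Machine where
  /-- the query stack -/
  query : K
  /-- the query label -/
  ask : Λ
  /-- the label that follows a positive answer -/
  yes : Λ
  /-- the label that follows a negative answer -/
  no : Λ

namespace OracleMachine

open Classical in
/-- One step with the oracle `O` and the bit `b`. -/
noncomputable def step (M : OracleMachine) (O : Set (List Bool)) (c : M.Cfg) (b : Bool) : M.Cfg :=
  if c.l = some M.ask then
    ⟨some (if c.stk M.query ∈ O then M.yes else M.no), c.var, c.stk⟩
  else M.toMachine.step c b

/-- The configuration after `r.length` steps on the input `x` with the oracle `O`, bits `r`. -/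
noncomputable def run (M : OracleMachine) (O : Set (List Bool)) (x r : List Bool) : M.Cfg :=
  r.foldl (M.step O) (M.start x)

end OracleMachine

/-- The fraction of the strings of `T` coin tosses that satisfy `P`. -/
noncomputable def coinProb (T : ℕ) (P : List Bool → Prop) : ℝ :=
  (Nat.card {r : Fin T → Bool // P (List.ofFn r)} : ℝ) / 2 ^ T

/-- The class `NTIME[n²]`: some nondeterministic machine has, exactly on the members `x` of `L`,
a computation of at most `c (|x|² + 1)` steps that accepts, i.e. halts with the bit `1` on the top
of its output stack.  (As `n²` is time-constructible, it makes no difference whether the other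
computations are required to halt.) -/
def InNTIMESq (L : Set (List Bool)) : Prop :=
  ∃ (M : Machine) (c : ℕ), ∀ x : List Bool,
    x ∈ L ↔ ∃ r : List Bool, r.length ≤ c * (x.length ^ 2 + 1) ∧
      (M.run x r).l = none ∧ ((M.run x r).stk M.out).head? = some true

/-- `T(n) = O(2^{a n})`. -/
def IsBigOTwoPow (a : ℝ) (T : ℕ → ℕ) : Prop :=
  (fun n : ℕ => (T n : ℝ)) =O[atTop] fun n : ℕ => (2 : ℝ) ^ (a * n)

/-- `T(n) = O*(2^{a n})`: polynomial factors are ignored. -/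
def IsBigOStarTwoPow (a : ℝ) (T : ℕ → ℕ) : Prop :=
  ∃ d : ℕ, (fun n : ℕ => (T n : ℝ)) =O[atTop] fun n : ℕ => (n : ℝ) ^ d * (2 : ℝ) ^ (a * n)

/-! ### Polynomials of degree 3 over `𝔽₂` -/

/-- The strings in `{0,1}ⁿ`. -/
abbrev Bits (n : ℕ) : Type := Fin n → ZMod 2

/-- A string as a list of Booleans. -/
def Bits.toList {n : ℕ} (x : Bits n) : List Bool := List.ofFn fun i => decide (x i = 1)

/-- The pairs `i > j`. -/
abbrev Pairs (n : ℕ) : Type := {p : Fin n × Fin n // p.2 < p.1}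

/-- The triples `i > j > k`. -/
abbrev Triples (n : ℕ) : Type :=
  {p : Fin n × Fin n × Fin n // p.2.1 < p.1 ∧ p.2.2 < p.2.1}

/-- All pairs, in a fixed order. -/
def pairList (n : ℕ) : List (Pairs n) :=
  (List.finRange n).flatMap fun i => (List.finRange n).filterMap fun j =>
    if h : j < i then some ⟨(i, j), h⟩ else none

/-- All triples, in a fixed order. -/
def tripleList (n : ℕ) : List (Triples n) :=
  (List.finRange n).flatMap fun i => (List.finRange n).flatMap fun j =>
    (List.finRange n).filterMap fun k =>
      if h : j < i ∧ k < j then some ⟨(i, j, k), h⟩ else none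

/-- The code of a family of bits indexed by the singles, pairs and triples of variables (or of
qubits): the number `n` in unary, a separator, and the table of the bits. -/
def encodeTable (n : ℕ) (s : Fin n → Bool) (p : Pairs n → Bool) (t : Triples n → Bool) :
    List Bool :=
  List.replicate n true ++ [false] ++ (List.finRange n).map s ++ (pairList n).map p ++
    (tripleList n).map t

/-- An `n`-variable polynomial of degree 3 over `𝔽₂` without constant term, given by its
coefficients `(α, β, γ)`. -/
abbrev Poly3 (n : ℕ) : Type := (Fin n → ZMod 2) × (Pairs n → ZMod 2) × (Triples n → ZMod 2)

namespace Poly3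

variable {n : ℕ}

/-- The value `∑ αᵢ xᵢ + ∑_{i>j} βᵢⱼ xᵢ xⱼ + ∑_{i>j>k} γᵢⱼₖ xᵢ xⱼ xₖ`. -/
def eval (f : Poly3 n) (x : Bits n) : ZMod 2 :=
  ∑ i, f.1 i * x i + ∑ p : Pairs n, f.2.1 p * x p.1.1 * x p.1.2 +
    ∑ t : Triples n, f.2.2 t * x t.1.1 * x t.1.2.1 * x t.1.2.2

/-- `gap(f) = ∑ₓ (-1)^{f(x)}`. -/
def gap (f : Poly3 n) : ℤ := ∑ x : Bits n, (-1) ^ (f.eval x).val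

/-- The input string that describes `f`. -/
def encode (f : Poly3 n) : List Bool :=
  encodeTable n (fun i => decide (f.1 i = 1)) (fun p => decide (f.2.1 p = 1))
    (fun t => decide (f.2.2 t = 1))

end Poly3

/-- The natural number that a list of bits represents in binary, least significant bit first. -/
def binaryValue (l : List Bool) : ℕ := Nat.ofDigits 2 (l.map Bool.toNat)

namespace OracleMachine

/-- With the oracle `O`, for every `n`, on every `n`-variable polynomial, and for all coin tosses,
`M` halts within `T n` steps. -/
def RunsIn (M : OracleMachine) (O : Set (List Bool)) (T : ℕ → ℕ) : Prop :=
  ∀ (n : ℕ) (f : Poly3 n) (r : List Bool), r.length = T n → (M.run O f.encode r).l = none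

/-- With the oracle `O`, for every `n`, on every `n`-variable polynomial, and for all coin tosses,
every query that `M` makes has length at most `B n`. -/
def QueriesWithin (M : OracleMachine) (O : Set (List Bool)) (B : ℕ → ℕ) : Prop :=
  ∀ (n : ℕ) (f : Poly3 n) (r : List Bool),
    (M.run O f.encode r).l = some M.ask → ((M.run O f.encode r).stk M.query).length ≤ B n

/-- The probability that on the input `f` (with time bound `T`) the output of `M` is the square of
`gap(f)` up to the multiplicative error `u`. -/
noncomputable def gapSuccessProb (M : OracleMachine) (O : Set (List Bool)) (T : ℕ) (u : ℝ) {n : ℕ}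
    (f : Poly3 n) : ℝ :=
  coinProb T fun r => (M.run O f.encode r).l = none ∧
    |(binaryValue ((M.run O f.encode r).stk M.out) : ℝ) - (f.gap : ℝ) ^ 2| ≤ u * (f.gap : ℝ) ^ 2

/-- `M` computes the squared gap of at least a fraction `v` of the `n`-variable polynomials within
the multiplicative error `u`, on each of them with success probability at least `w`. -/
def ComputesSqGap (M : OracleMachine) (O : Set (List Bool)) (T : ℕ) (u v w : ℝ) (n : ℕ) : Prop :=
  v * Nat.card (Poly3 n) ≤ Nat.card {f : Poly3 n // w ≤ M.gapSuccessProb O T u f}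

end OracleMachine

/-- The fine-grained average-case hardness hypothesis with constants `u, v, w` and exponent `a`: a
probabilistic `O*(2^{a n})`-time algorithm that makes queries of length `O(2^{a n})` to an
`NTIME[n²]` oracle fails, for all sufficiently large `n`, to compute the squared gaps of a fraction
`v` of the `n`-variable polynomials within a multiplicative error `u` with success
probability `w`. -/
def SqGapHardness (u v w a : ℝ) : Prop :=
  ∀ (M : OracleMachine) (O : Set (List Bool)) (T B : ℕ → ℕ), InNTIMESq O →
    IsBigOStarTwoPow a T → M.RunsIn O T → IsBigOTwoPow a B → M.QueriesWithin O B →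
      ∃ n₀ : ℕ, ∀ n > n₀, ¬ M.ComputesSqGap O (T n) u v w n

/-! ### IQP circuits -/

/-- An `N`-qubit IQP circuit with diagonal gates `Z`, `CZ`, `CCZ`: the qubits, pairs and triples
of qubits to which a gate is applied.  (The gates commute and are involutions.) -/
structure IQPCircuit (N : ℕ) where
  z : Fin N → Bool
  cz : Pairs N → Bool
  ccz : Triples N → Bool

/-- Matrices on the space of `N` qubits, in the computational basis. -/
abbrev QMatrix (N : ℕ) : Type := Matrix (Bits N) (Bits N) ℂ

/-- The Hadamard gate. -/
noncomputable def hadamard : Matrix (ZMod 2) (ZMod 2) ℂ :=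
  Matrix.of fun a b => (if a = 1 ∧ b = 1 then -1 else 1) / (Real.sqrt 2 : ℂ)

/-- `H^{⊗N}`. -/
noncomputable def hadamardAll (N : ℕ) : QMatrix N :=
  Matrix.of fun x y => ∏ i, hadamard (x i) (y i)

/-- The gate `Z` on the qubit `i`. -/
def gateZ {N : ℕ} (i : Fin N) : QMatrix N :=
  Matrix.diagonal fun x => if x i = 1 then -1 else 1

/-- The gate `CZ` on the qubits `i`, `j`. -/
def gateCZ {N : ℕ} (i j : Fin N) : QMatrix N :=
  Matrix.diagonal fun x => if x i = 1 ∧ x j = 1 then -1 else 1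

/-- The gate `CCZ` on the qubits `i`, `j`, `k`. -/
def gateCCZ {N : ℕ} (i j k : Fin N) : QMatrix N :=
  Matrix.diagonal fun x => if x i = 1 ∧ x j = 1 ∧ x k = 1 then -1 else 1

namespace IQPCircuit

variable {N : ℕ}

/-- The product of the diagonal gates of the circuit. -/
noncomputable def diagonalPart (C : IQPCircuit N) : QMatrix N :=
  ((List.finRange N).map fun i => if C.z i then gateZ i else 1).prod *
  ((pairList N).map fun p => if C.cz p then gateCZ p.1.1 p.1.2 else 1).prod *
  ((tripleList N).map fun t => if C.ccz t then gateCCZ t.1.1 t.1.2.1 t.1.2.2 else 1).prod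

/-- The unitary of the circuit. -/
noncomputable def unitary (C : IQPCircuit N) : QMatrix N :=
  hadamardAll N * C.diagonalPart * hadamardAll N

/-- The probability of the outcome `z` when the circuit is applied to `|0^N⟩` and all qubits are
measured in the computational basis. -/
noncomputable def outputProb (C : IQPCircuit N) (z : Bits N) : ℝ :=
  ‖(C.unitary.mulVec (Pi.single 0 1)) z‖ ^ 2

/-- The input string that describes `C`. -/
def encode (C : IQPCircuit N) : List Bool := encodeTable N C.z C.cz C.ccz

end IQPCircuit

namespace Machine

/-- For every `N`, on every `N`-qubit IQP circuit, and for all coin tosses, `M` halts within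
`T N` steps. -/
def RunsIn (M : Machine) (T : ℕ → ℕ) : Prop :=
  ∀ (N : ℕ) (C : IQPCircuit N) (r : List Bool), r.length = T N → (M.run C.encode r).l = none

/-- The probability that on the input `C` (with time bound `T`) the output of `M` is `z`. -/
noncomputable def outputProb (M : Machine) (T : ℕ) {N : ℕ} (C : IQPCircuit N) (z : Bits N) : ℝ :=
  coinProb T fun r => (M.run C.encode r).l = none ∧ (M.run C.encode r).stk M.out = z.toList

/-- `M` (with time bound `T`) samples the output distribution of `C` within the additive
error `ε`. -/
def Samples (M : Machine) (T : ℕ) {N : ℕ} (C : IQPCircuit N) (ε : ℝ) : Prop :=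
  ∑ z : Bits N, |C.outputProb z - M.outputProb T C z| ≤ ε

end Machine

/-! Suppose a sampler `M` handles all circuits on `n` qubits within `ε`. The amplitude of the
outcome `z` in the circuit of `f` is the gap of `f + ∑ zᵢ xᵢ` divided by `2 ^ n`
(`Poly3.outputProb_circuit`). Hence the outcome `z` in the circuit of `f + ∑ zᵢ xᵢ` has probability
`gap(f)² / 4 ^ n`, whatever `z` is. On average over `f`, the errors that the sampler makes at these
outcomes, summed over `z`, are at most `ε` (`Poly3.sum_shift_error_le`): a sampler cannot tell which
outcome matters, so a random shift sees only the average error.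

A probability `q` of order `2 ^ (-n)` is then magnified by hashing. A query carries a random affine
Toeplitz map from seeds of length `n - e` to coin strings, and a nondeterministic machine guesses a
seed on whose image `M` outputs `z`. With `μ = 2 ^ (n - e) q`, pairwise independence puts the
probability of a positive answer between `μ / (1 + μ)` and `μ` (`hitProb_bounds`). For `G = gap(f)²
/ 2 ^ n` this probability is about `2 ^ (-e) G`, and a constant `e` makes the quadratic error
negligible. The number of positive answers in `4 ^ e` rounds, times `2 ^ (n - e)`, then estimates
`gap(f)²` by Chebyshev's inequality (`le_tally`). Hashing costs seed length times coin length, which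
is quadratic in the query length: this is why the oracle lies in `NTIME[n²]`. The time bound of `M`
need not be computable; a sufficient number of coins is found by doubling, with oracle queries that
ask whether some run is still unfinished.

The estimate needs `G` bounded away from `0` and from infinity and a small sampling error. Since `G`
has mean `1` and second moment at most `3`, a Paley–Zygmund argument gives this for a fraction of
polynomials arbitrarily close to `1/3` (`Poly3.card_typical`).

The two machines, `estimator` and `verifier`, are written out. Their runs are analysed by trees
(`Unfolds`), which carry the time bound, the bound on the queries and the value (an expectation or
an acceptance condition) together.

For a single hard family, machines are countable up to renaming, and the `N`-th circuit is chosen to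
defeat the machine with number `N.unpair.1`, so that every machine is treated infinitely often
(`exists_family_not_samples`). -/

/-! ### Trees of runs -/

/-- All runs of the two-way branching system `step` from `c` halt within `t` steps and pass only
through configurations that satisfy `safe`; `x` is the value that is obtained from the values `g`
of the halting configurations by combining the values of the two successors with `op`. -/
inductive Unfolds {C X : Type*} (step : C → Bool → C) (fin safe : C → Prop) (g : C → X)
    (op : X → X → X) : ℕ → C → X → Prop
  | halt {t : ℕ} {c : C} {x : X} (hf : fin c) (hx : x = g c) : Unfolds step fin safe g op t c x
  | node {t : ℕ} {c : C} {x y z : X} (hs : safe c)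
      (h0 : Unfolds step fin safe g op t (step c false) x)
      (h1 : Unfolds step fin safe g op t (step c true) y) (hz : z = op x y) :
      Unfolds step fin safe g op (t + 1) c z

namespace Unfolds

variable {C X : Type*} {step : C → Bool → C} {fin safe : C → Prop} {g : C → X} {op : X → X → X}

theorem mono {t t' : ℕ} {c : C} {x : X} (h : Unfolds step fin safe g op t c x) (ht : t ≤ t') :
    Unfolds step fin safe g op t' c x := by
  induction h generalizing t' with
  | halt hf hx => exact .halt hf hx
  | node hs _ _ hz ih0 ih1 =>
    obtain ⟨t', rfl⟩ : ∃ k, t' = k + 1 := ⟨t' - 1, by omega⟩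
    exact .node hs (ih0 (by omega)) (ih1 (by omega)) hz

/-- A step that ignores the bit has two equal successors, so idempotence of `op` preserves the
value. Both `mean` and `Or` are idempotent. -/
theorem det {t : ℕ} {c c' : C} {x : X} (hop : op x x = x) (hs : safe c)
    (h0 : step c false = c') (h1 : step c true = c')
    (h : Unfolds step fin safe g op t c' x) : Unfolds step fin safe g op (t + 1) c x :=
  .node hs (h0 ▸ h) (h1 ▸ h) hop.symm

theorem foldl_of_fin (hfin : ∀ c b, fin c → step c b = c) {c : C} (hc : fin c) (r : List Bool) :
    r.foldl step c = c := by
  induction r with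
  | nil => rfl
  | cons b r ih => rw [List.foldl_cons, hfin c b hc, ih]

theorem fin_foldl (hfin : ∀ c b, fin c → step c b = c) {t : ℕ} {c : C} {x : X}
    (h : Unfolds step fin safe g op t c x) (r : List Bool) (hr : t ≤ r.length) :
    fin (r.foldl step c) := by
  induction h generalizing r with
  | halt hf _ => rwa [foldl_of_fin hfin hf]
  | node hs _ _ hz ih0 ih1 =>
    cases r with
    | nil => simp at hr
    | cons b r =>
      have hr' := Nat.le_of_succ_le_succ hr
      cases b
      · exact ih0 r hr'
      · exact ih1 r hr'

theorem safe_foldl (hfin : ∀ c b, fin c → step c b = c) (hsafe : ∀ c, fin c → safe c)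
    {t : ℕ} {c : C} {x : X}
    (h : Unfolds step fin safe g op t c x) (r : List Bool) : safe (r.foldl step c) := by
  induction h generalizing r with
  | halt hf _ => rw [foldl_of_fin hfin hf]; exact hsafe _ hf
  | node hs _ _ hz ih0 ih1 =>
    cases r with
    | nil => exact hs
    | cons b r =>
      cases b
      · exact ih0 r
      · exact ih1 r

end Unfolds

/-- With `Or` at the nodes, the value of the tree is the acceptance condition of a nondeterministic
machine. -/
theorem Unfolds.exists_foldl {C : Type*} {step : C → Bool → C} {fin safe : C → Prop} {g : C → Prop}
    (hfin : ∀ c b, fin c → step c b = c) {t : ℕ} {c : C} {P : Prop}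
    (h : Unfolds step fin safe g Or t c P) :
    (∃ r : List Bool, r.length ≤ t ∧ fin (r.foldl step c) ∧ g (r.foldl step c)) ↔ P := by
  induction h with
  | halt hf hx =>
    subst hx
    constructor
    · rintro ⟨r, -, -, h⟩
      rwa [foldl_of_fin hfin hf] at h
    · intro h
      exact ⟨[], by simp, hf, h⟩
  | @node t c x y z hs h0 h1 hz ih0 ih1 =>
    subst hz
    rw [← ih0, ← ih1]
    constructor
    · rintro ⟨r, hr, hf, hg⟩
      cases r with
      | nil =>
        -- A halting configuration is fixed by `step`, so the empty string also witnesses the first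
        -- branch.
        left
        refine ⟨[], by simp, ?_, ?_⟩ <;> simpa [hfin c false hf] using by assumption
      | cons b r =>
        have hr' := Nat.le_of_succ_le_succ hr
        cases b
        · exact .inl ⟨r, hr', hf, hg⟩
        · exact .inr ⟨r, hr', hf, hg⟩
    · rintro (⟨r, hr, hf, hg⟩ | ⟨r, hr, hf, hg⟩)
      · exact ⟨false :: r, by simpa using hr, hf, hg⟩
      · exact ⟨true :: r, by simpa using hr, hf, hg⟩

/-! ### Averages over bit strings -/

/-- The mean of two reals. -/
noncomputable def mean (x y : ℝ) : ℝ := (x + y) / 2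

theorem mean_self (x : ℝ) : mean x x = x := by unfold mean; ring

/-- The average of `F` over the bit strings of length `n`. -/
noncomputable def avg : ℕ → (List Bool → ℝ) → ℝ
  | 0, F => F []
  | n + 1, F => mean (avg n fun l => F (false :: l)) (avg n fun l => F (true :: l))

theorem avg_eq_sum (n : ℕ) (F : List Bool → ℝ) :
    avg n F = (∑ r : Fin n → Bool, F (List.ofFn r)) / 2 ^ n := by
  induction n generalizing F with
  | zero => simp [avg]
  | succ n ih =>
    have h : ∑ r : Fin (n + 1) → Bool, F (List.ofFn r) =
        ∑ p : Bool × (Fin n → Bool), F (p.1 :: List.ofFn p.2) := by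
      rw [← (Fin.consEquiv (fun _ => Bool)).sum_comp]
      refine Finset.sum_congr rfl fun p _ => ?_
      simp [Fin.consEquiv, List.ofFn_succ]
    rw [avg, ih, ih, mean, h, Fintype.sum_prod_type]
    simp only [Fintype.sum_bool]
    field_simp
    ring

/-- With `mean` at the nodes, the value is the expectation of `g` under uniform coins; coins left
over after a halt have no effect. -/
theorem Unfolds.avg_foldl {C : Type*} {step : C → Bool → C} {fin safe : C → Prop} {g : C → ℝ}
    (hfin : ∀ c b, fin c → step c b = c) {t : ℕ} {c : C} {x : ℝ}
    (h : Unfolds step fin safe g mean t c x) : avg t (fun r => g (r.foldl step c)) = x := by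
  induction h with
  | @halt t c x hf hx =>
    simp only [foldl_of_fin hfin hf]
    rw [avg_eq_sum]
    simp [hx]
  | node hs _ _ hz ih0 ih1 => simp only [avg, List.foldl_cons, ih0, ih1, hz]

theorem avg_congr {n : ℕ} {F G : List Bool → ℝ} (h : ∀ l, l.length = n → F l = G l) :
    avg n F = avg n G := by
  rw [avg_eq_sum, avg_eq_sum]
  simp [h]

theorem avg_mono {n : ℕ} {F G : List Bool → ℝ} (h : ∀ l, l.length = n → F l ≤ G l) :
    avg n F ≤ avg n G := by
  rw [avg_eq_sum, avg_eq_sum]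
  gcongr
  exact h _ (by simp)

theorem avg_const (n : ℕ) (x : ℝ) : avg n (fun _ => x) = x := by
  rw [avg_eq_sum]; simp

theorem avg_add (n : ℕ) (F G : List Bool → ℝ) :
    avg n (fun l => F l + G l) = avg n F + avg n G := by
  simp only [avg_eq_sum, Finset.sum_add_distrib, add_div]

theorem avg_sub (n : ℕ) (F G : List Bool → ℝ) :
    avg n (fun l => F l - G l) = avg n F - avg n G := by
  simp only [avg_eq_sum, Finset.sum_sub_distrib, sub_div]

theorem avg_const_mul (n : ℕ) (x : ℝ) (F : List Bool → ℝ) :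
    avg n (fun l => x * F l) = x * avg n F := by
  simp only [avg_eq_sum, ← Finset.mul_sum, mul_div_assoc]

theorem avg_mul_const (n : ℕ) (x : ℝ) (F : List Bool → ℝ) :
    avg n (fun l => F l * x) = avg n F * x := by
  simp only [mul_comm _ x, avg_const_mul]

theorem avg_comm (m n : ℕ) (F : List Bool → List Bool → ℝ) :
    avg m (fun a => avg n fun b => F a b) = avg n fun b => avg m fun a => F a b := by
  simp only [avg_eq_sum, Finset.sum_div]
  rw [Finset.sum_comm]
  exact Finset.sum_congr rfl fun _ _ => Finset.sum_congr rfl fun _ _ => by ring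

theorem avg_mean (n : ℕ) (F G : List Bool → ℝ) :
    avg n (fun l => mean (F l) (G l)) = mean (avg n F) (avg n G) := by
  simp only [mean, div_eq_mul_inv, avg_mul_const, avg_add]

theorem avg_append (m n : ℕ) (F : List Bool → ℝ) :
    avg (m + n) F = avg m fun a => avg n fun b => F (a ++ b) := by
  induction m generalizing F with
  | zero => simp [avg]
  | succ m ih => rw [Nat.succ_add, avg, ih, ih, avg]; rfl

/-- Averaging over pairs of strings, bit by bit. -/
theorem avg_avg_succ (n : ℕ) (F : List Bool → List Bool → ℝ) :
    (avg (n + 1) fun a => avg (n + 1) fun b => F a b) =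
      mean (mean (avg n fun a => avg n fun b => F (false :: a) (false :: b))
          (avg n fun a => avg n fun b => F (false :: a) (true :: b)))
        (mean (avg n fun a => avg n fun b => F (true :: a) (false :: b))
          (avg n fun a => avg n fun b => F (true :: a) (true :: b))) := by
  simp only [avg, avg_mean]

theorem coinProb_eq_avg (T : ℕ) (P : List Bool → Prop) [DecidablePred P] :
    coinProb T P = avg T fun r => if P r then 1 else 0 := by
  rw [coinProb, avg_eq_sum, Nat.card_eq_fintype_card, Fintype.card_subtype]
  simp

/-! ### Single steps of machines -/

namespace Machine

variable (M : Machine)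

theorem step_of_halted (c : M.Cfg) (b : Bool) (hc : c.l = none) : M.step c b = c := by
  obtain ⟨l, v, S⟩ := c
  obtain rfl : l = none := hc
  rfl

theorem step_some (l : M.Λ) (v : M.σ) (S : M.K → List Bool) (b : Bool) :
    M.step ⟨some l, v, S⟩ b = Turing.TM2.stepAux (M.m b l) v S := rfl

end Machine

namespace OracleMachine

variable (M : OracleMachine) (O : Set (List Bool))

theorem step_of_halted (c : M.Cfg) (b : Bool) (hc : c.l = none) : M.step O c b = c := by
  rw [step, if_neg (by simp [hc])]
  exact M.toMachine.step_of_halted c b hc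

theorem step_of_ne_ask (l : M.Λ) (hl : l ≠ M.ask) (v : M.σ) (S : M.K → List Bool) (b : Bool) :
    M.step O ⟨some l, v, S⟩ b = Turing.TM2.stepAux (M.m b l) v S := by
  rw [step, if_neg (by simpa using hl)]
  exact M.toMachine.step_some l v S b

open Classical in
theorem step_ask (v : M.σ) (S : M.K → List Bool) (b : Bool) :
    M.step O ⟨some M.ask, v, S⟩ b =
      ⟨some (if S M.query ∈ O then M.yes else M.no), v, S⟩ := by
  rw [step, if_pos rfl]

end OracleMachine

/-! ### Queries -/

/-- The stacks of the verifier on which the parts of a query are stored. -/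
inductive Tag
  | inp | z | s | r | a | fl
  deriving DecidableEq

/-- The three bits that denote a tag. -/
def Tag.code : Tag → Bool × Bool × Bool
  | .inp => (false, false, false)
  | .z => (false, false, true)
  | .s => (false, true, false)
  | .r => (false, true, true)
  | .a => (true, false, false)
  | .fl => (true, false, true)

/-- The code of the bit `x` with the tag `t`. -/
def Tag.item (t : Tag) (x : Bool) : List Bool := [t.code.1, t.code.2.1, t.code.2.2, x]

/-- The query that consists of the given tagged bits, the last one first. -/
def encodeItems (l : List (Tag × Bool)) : List Bool := l.flatMap fun p => p.1.item p.2

@[simp] theorem encodeItems_cons (t : Tag) (x : Bool) (l : List (Tag × Bool)) :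
    encodeItems ((t, x) :: l) = t.item x ++ encodeItems l := rfl

theorem length_encodeItems (l : List (Tag × Bool)) : (encodeItems l).length = 4 * l.length := by
  induction l with
  | nil => rfl
  | cons p l ih =>
    rw [encodeItems, List.flatMap_cons, List.length_append, ← encodeItems, ih]
    simp [Tag.item]
    omega

/-- The bits with the tag `t`, in the order in which they were written. -/
def tagged (t : Tag) : List (Tag × Bool) → List Bool
  | [] => []
  | p :: l => if p.1 = t then tagged t l ++ [p.2] else tagged t l

/-- The items written for the bits of `l`, all with the same tag. -/
def addAll (t : Tag) : List Bool → List (Tag × Bool) → List (Tag × Bool)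
  | [], its => its
  | x :: l, its => addAll t l ((t, x) :: its)

/-- The items written for the shifted linear coefficients and for the shift. -/
def addShifted : List Bool → List Bool → List (Tag × Bool) → List (Tag × Bool)
  | z :: zs, x :: xs, its => addShifted zs xs ((.z, z) :: (.inp, xor z x) :: its)
  | _, _, its => its

/-- The items written for pairs of random bits. -/
def addCoins : List Bool → List Bool → List (Tag × Bool) → List (Tag × Bool)
  | x :: r, y :: a, its => addCoins r a ((.a, y) :: (.r, x) :: its)
  | _, _, its => its

/-- The items written for the unary part of the input; after the first `e - d` bits, a seed bit
is provided for each bit. -/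
def addOnes (e : ℕ) : ℕ → List Bool → List (Tag × Bool) → List (Tag × Bool)
  | _, [], its => its
  | d, y :: a, its =>
    if d < e then addOnes e (d + 1) a ((.a, y) :: (.inp, true) :: its)
    else addOnes e d a ((.a, y) :: (.s, true) :: (.inp, true) :: its)

theorem tagged_addAll (t t' : Tag) (l : List Bool) (its : List (Tag × Bool)) :
    tagged t' (addAll t l its) = tagged t' its ++ if t = t' then l else [] := by
  induction l generalizing its with
  | nil => simp [addAll]
  | cons x l ih => rw [addAll, ih]; by_cases h : t = t' <;> simp [tagged, h]

theorem tagged_addShifted (t : Tag) (zs xs : List Bool) (h : zs.length = xs.length)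
    (its : List (Tag × Bool)) :
    tagged t (addShifted zs xs its) = tagged t its ++
      if t = .z then zs else if t = .inp then List.zipWith xor zs xs else [] := by
  induction zs generalizing xs its with
  | nil => simp [addShifted]
  | cons z zs ih =>
    obtain _ | ⟨x, xs⟩ := xs
    · simp at h
    rw [addShifted, ih _ (by simpa using h)]
    cases t <;> simp [tagged]

theorem tagged_addCoins (t : Tag) (r a : List Bool) (h : r.length = a.length)
    (its : List (Tag × Bool)) :
    tagged t (addCoins r a its) = tagged t its ++
      if t = .r then r else if t = .a then a else [] := by
  induction r generalizing a its with
  | nil => obtain rfl := List.length_eq_zero_iff.1 h.symm; simp [addCoins]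
  | cons z zs ih =>
    obtain _ | ⟨x, xs⟩ := a
    · simp at h
    rw [addCoins, ih _ (by simpa using h)]
    cases t <;> simp [tagged]

/-- The counter `d` stops at `e`, and only the unary bits read after that get a seed mark. Started
at `0` on `n` bits it leaves `n - e` marks, with truncated subtraction. -/
theorem tagged_addOnes (e : ℕ) (t : Tag) (d : ℕ) (hd : d ≤ e) (a : List Bool)
    (its : List (Tag × Bool)) :
    tagged t (addOnes e d a its) = tagged t its ++
      if t = .a then a else if t = .inp then List.replicate a.length true
      else if t = .s then List.replicate (d + a.length - e) true else [] := by
  induction a generalizing d its with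
  | nil => simp [addOnes, Nat.sub_eq_zero_of_le hd]
  | cons y a ih =>
    rw [addOnes]
    split_ifs with h h1 h2 h3 h1 h2 h3
    · rw [ih _ h]; subst h1; simp [tagged]
    · rw [ih _ h]; subst h2; simp [tagged, List.replicate_succ]
    · rw [ih _ h]; subst h3; simp [tagged]; congr 1; omega
    · rw [ih _ h]; simp [tagged, h1, h2, h3, Ne.symm h1, Ne.symm h2]
    · rw [ih _ hd]; subst h1; simp [tagged]
    · rw [ih _ hd]; subst h2; simp [tagged, List.replicate_succ]
    · obtain rfl : d = e := by omega
      rw [ih _ hd]; subst h3; simp [tagged, List.replicate_succ]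
    · rw [ih _ hd]; simp [tagged, h1, h2, h3, Ne.symm h1, Ne.symm h2, Ne.symm h3]

theorem length_addAll (t : Tag) (l : List Bool) (its : List (Tag × Bool)) :
    (addAll t l its).length = its.length + l.length := by
  induction l generalizing its with
  | nil => rfl
  | cons x l ih => rw [addAll, ih]; simp; omega

theorem length_addShifted_le (zs xs : List Bool) (its : List (Tag × Bool)) :
    (addShifted zs xs its).length ≤ its.length + 2 * zs.length := by
  induction zs generalizing xs its with
  | nil => simp [addShifted]
  | cons z zs ih =>
    obtain _ | ⟨x, xs⟩ := xs
    · simp [addShifted]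
    · rw [addShifted]; refine (ih _ _).trans ?_; simp; omega

theorem length_addCoins_le (r a : List Bool) (its : List (Tag × Bool)) :
    (addCoins r a its).length ≤ its.length + 2 * r.length := by
  induction r generalizing a its with
  | nil => simp [addCoins]
  | cons z zs ih =>
    obtain _ | ⟨x, xs⟩ := a
    · simp [addCoins]
    · rw [addCoins]; refine (ih _ _).trans ?_; simp; omega

theorem length_addOnes_le (e d : ℕ) (a : List Bool) (its : List (Tag × Bool)) :
    (addOnes e d a its).length ≤ its.length + 3 * a.length := by
  induction a generalizing d its with
  | nil => simp [addOnes]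
  | cons y a ih => rw [addOnes]; split_ifs <;> refine (ih _ _).trans ?_ <;> simp <;> omega

/-- Coins are written in successive doublings, each of which extends the query of the preceding
probe. -/
theorem addCoins_append (r r' a a' : List Bool) (h : r.length = a.length)
    (its : List (Tag × Bool)) :
    addCoins (r ++ r') (a ++ a') its = addCoins r' a' (addCoins r a its) := by
  induction r generalizing a its with
  | nil => obtain rfl := List.length_eq_zero_iff.1 h.symm; simp [addCoins]
  | cons z zs ih =>
    obtain _ | ⟨x, xs⟩ := a
    · simp at h
    simp only [List.cons_append, addCoins]
    exact ih _ (by simpa using h) _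

/-! ### The estimator -/

/-- The store of the estimator. -/
inductive EStack
  | inp | out | qry | sav | shf | len | len'
  deriving DecidableEq

instance : Fintype EStack :=
  .ofList [.inp, .out, .qry, .sav, .shf, .len, .len'] fun k => by cases k <;> simp

/-- The labels of the estimator. -/
inductive ELabel
  | ones | onesA | alpha | rest | restore | ask | yes | no | grow | growA | back | clear | clearL
  | fin
  deriving DecidableEq

instance : Fintype ELabel :=
  .ofList [.ones, .onesA, .alpha, .rest, .restore, .ask, .yes, .no, .grow, .growA, .back, .clear,
    .clearL, .fin] fun l => by cases l <;> simp

/-- The internal memory of the estimator: a counter up to `e`, the kind of the query, the numbers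
of rounds and of positive answers, and two registers. -/
@[ext] structure EMem (e : ℕ) where
  drop : Fin (e + 1)
  final : Bool
  round : Fin (2 ^ (2 * e) + 1)
  count : Fin (2 ^ (2 * e) + 1)
  reg : Option Bool
  reg' : Option Bool

instance (e : ℕ) : Finite (EMem e) :=
  Finite.of_injective (fun v : EMem e => (v.drop, v.final, v.round, v.count, v.reg, v.reg'))
    fun v w h => by simp only [Prod.mk.injEq] at h; ext1 <;> simp [h]

namespace Estimator

open Turing.TM2.Stmt

variable {e : ℕ}

/-- The statements of the estimator. -/
abbrev Code (e : ℕ) : Type := Turing.TM2.Stmt (fun _ : EStack => Bool) ELabel (EMem e)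

/-- The configurations of the estimator. -/
abbrev Conf (e : ℕ) : Type := Turing.TM2.Cfg (fun _ : EStack => Bool) ELabel (EMem e)

/-- Clear the registers and jump. -/
def jump (l : ELabel) : Code e :=
  load (fun v => { v with reg := none, reg' := none }) (goto fun _ => l)

/-- Write a tagged bit on the query stack. -/
def write (t : Tag) (f : EMem e → Bool) (q : Code e) : Code e :=
  push .qry f <| push .qry (fun _ => t.code.2.2) <| push .qry (fun _ => t.code.2.1) <|
    push .qry (fun _ => t.code.1) q

/-- Write the `k` lowest bits of the number of positive answers on the output stack. -/
def pushBits : ℕ → Code e → Code e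
  | 0, q => q
  | k + 1, q => push .out (fun v => v.count.val.testBit k) (pushBits k q)

/-- Add one modulo `n + 1`. -/
def inc {n : ℕ} (i : Fin (n + 1)) : Fin (n + 1) := ⟨(i.val + 1) % (n + 1), Nat.mod_lt _ (by simp)⟩

/-- The program of the estimator. -/
def prog (e : ℕ) (b : Bool) : ELabel → Code e
  -- The pass over the unary part tosses one shift bit per variable, kept on `.shf`, and in `.onesA`
  -- one Toeplitz bit. The first `e` ones are only counted, so `n - e` seed marks are written.
  | .ones => pop .inp (fun v x => { v with reg := x }) <|
      branch (fun v => v.reg.getD false)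
        (push .sav (fun _ => true) <| push .shf (fun _ => b) <| write .inp (fun _ => true) <|
          branch (fun v => decide (v.drop.val < e))
            (load (fun v => { v with drop := inc v.drop }) <| jump .onesA)
            (write .s (fun _ => true) <| jump .onesA))
        (push .sav (fun _ => false) <| write .inp (fun _ => false) <|
          load (fun v => { v with drop := 0 }) <| jump .alpha)
  | .onesA => write .a (fun _ => b) <| jump .ones
  -- The shift has as many bits as there are linear coefficients, so an empty `.shf` marks the end
  -- of the linear part.
  | .alpha => pop .shf (fun v x => { v with reg := x }) <|
      branch (fun v => v.reg.isSome)
        (pop .inp (fun v x => { v with reg' := x }) <|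
          push .sav (fun v => v.reg'.getD false) <|
          write .inp (fun v => xor (v.reg.getD false) (v.reg'.getD false)) <|
          write .z (fun v => v.reg.getD false) <| jump .alpha)
        (jump .rest)
  | .rest => pop .inp (fun v x => { v with reg := x }) <|
      branch (fun v => v.reg.isSome)
        (push .sav (fun v => v.reg.getD false) <| write .inp (fun v => v.reg.getD false) <|
          jump .rest)
        (jump .restore)
  | .restore => pop .sav (fun v x => { v with reg := x }) <|
      branch (fun v => v.reg.isSome)
        (push .inp (fun v => v.reg.getD false) <| jump .restore)
        (push .len (fun _ => true) <| load (fun v => { v with final := false }) <| jump .ask)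
  | .ask => halt
  -- A positive answer to a probe means that the coins are too few; a positive answer to a final
  -- query is counted.
  | .yes => branch (fun v => v.final)
      (load (fun v => { v with count := inc v.count }) <| jump .clear)
      (jump .grow)
  | .no => branch (fun v => v.final)
      (jump .clear)
      (write .fl (fun _ => true) <| load (fun v => { v with final := true }) <| jump .ask)
  | .grow => pop .len (fun v x => { v with reg := x }) <|
      branch (fun v => v.reg.isSome)
        (push .len' (fun _ => true) <| push .len' (fun _ => true) <| write .r (fun _ => b) <|
          jump .growA)
        (jump .back)
  | .growA => write .a (fun _ => b) <| jump .grow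
  | .back => pop .len' (fun v x => { v with reg := x }) <|
      branch (fun v => v.reg.isSome) (push .len (fun _ => true) <| jump .back) (jump .ask)
  | .clear => pop .qry (fun v x => { v with reg := x }) <|
      branch (fun v => v.reg.isSome) (jump .clear) (jump .clearL)
  | .clearL => pop .len (fun v x => { v with reg := x }) <|
      branch (fun v => v.reg.isSome) (jump .clearL) <|
        load (fun v => { v with round := inc v.round }) <|
          branch (fun v => decide (v.round.val < 2 ^ (2 * e))) (jump .ones)
            (pushBits (2 * e + 1) <| jump .fin)
  -- Output is least significant bit first, so the `n - e` zeros pushed here multiply the count by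
  -- `2 ^ (n - e)`.
  | .fin => pop .inp (fun v x => { v with reg := x }) <|
      branch (fun v => v.reg.getD false)
        (branch (fun v => decide (v.drop.val < e))
          (load (fun v => { v with drop := inc v.drop }) <| jump .fin)
          (push .out (fun _ => false) <| jump .fin))
        halt

end Estimator

open Estimator in
/-- The machine that estimates squared gaps from queries about a sampler. -/
def estimator (e : ℕ) : OracleMachine where
  K := EStack
  Λ := ELabel
  σ := EMem e
  main := .ones
  init := ⟨0, false, 0, 0, none, none⟩
  inp := .inp
  out := .out
  m := prog e
  query := .qry
  ask := .ask
  yes := .yes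
  no := .no

/-! ### Runs of the estimator through its loops -/

namespace Estimator

variable {e : ℕ}

/-- The memory with cleared registers. -/
def mem (e d : ℕ) (φ : Bool) (j y : ℕ) : EMem e :=
  ⟨⟨d % (e + 1), Nat.mod_lt _ (by simp)⟩, φ, ⟨j % (2 ^ (2 * e) + 1), Nat.mod_lt _ (by simp)⟩,
    ⟨y % (2 ^ (2 * e) + 1), Nat.mod_lt _ (by simp)⟩, none, none⟩

/-- The contents of the store. -/
def store (inp out qry sav shf len len' : List Bool) : EStack → List Bool
  | .inp => inp | .out => out | .qry => qry | .sav => sav | .shf => shf | .len => len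
  | .len' => len'

section update

variable (inp out qry sav shf len len' x : List Bool)

@[simp] theorem update_inp : Function.update (store inp out qry sav shf len len') .inp x =
    store x out qry sav shf len len' := by
  funext k; cases k <;> rfl
@[simp] theorem update_out : Function.update (store inp out qry sav shf len len') .out x =
    store inp x qry sav shf len len' := by
  funext k; cases k <;> rfl
@[simp] theorem update_qry : Function.update (store inp out qry sav shf len len') .qry x =
    store inp out x sav shf len len' := by
  funext k; cases k <;> rfl
@[simp] theorem update_sav : Function.update (store inp out qry sav shf len len') .sav x =
    store inp out qry x shf len len' := by
  funext k; cases k <;> rfl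
@[simp] theorem update_shf : Function.update (store inp out qry sav shf len len') .shf x =
    store inp out qry sav x len len' := by
  funext k; cases k <;> rfl
@[simp] theorem update_len : Function.update (store inp out qry sav shf len len') .len x =
    store inp out qry sav shf x len' := by
  funext k; cases k <;> rfl
@[simp] theorem update_len' : Function.update (store inp out qry sav shf len len') .len' x =
    store inp out qry sav shf len x := by
  funext k; cases k <;> rfl

@[simp] theorem store_inp : store inp out qry sav shf len len' .inp = inp := rfl
@[simp] theorem store_out : store inp out qry sav shf len len' .out = out := rfl
@[simp] theorem store_qry : store inp out qry sav shf len len' .qry = qry := rfl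
@[simp] theorem store_sav : store inp out qry sav shf len len' .sav = sav := rfl
@[simp] theorem store_shf : store inp out qry sav shf len len' .shf = shf := rfl
@[simp] theorem store_len : store inp out qry sav shf len len' .len = len := rfl
@[simp] theorem store_len' : store inp out qry sav shf len len' .len' = len' := rfl

@[simp] theorem stepAux_write (t : Tag) (f : EMem e → Bool) (q : Code e) (v : EMem e) :
    Turing.TM2.stepAux (write t f q) v (store inp out qry sav shf len len') =
      Turing.TM2.stepAux q v (store inp out (t.item (f v) ++ qry) sav shf len len') := by
  simp [write, Tag.item]

@[simp] theorem stepAux_pushBits (k : ℕ) (q : Code e) (v : EMem e) :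
    Turing.TM2.stepAux (pushBits k q) v (store inp out qry sav shf len len') =
      Turing.TM2.stepAux q v (store inp
        ((List.range k).map v.count.val.testBit ++ out) qry sav shf len len') := by
  induction k generalizing out with
  | zero => simp [pushBits]
  | succ k ih => simp [pushBits, ih, List.range_succ]

end update

@[simp] theorem stepAux_jump (l : ELabel) (v : EMem e) (S : EStack → List Bool) :
    Turing.TM2.stepAux (jump l) v S = ⟨some l, { v with reg := none, reg' := none }, S⟩ := rfl

variable (e) in
/-- The step function of the estimator. -/
noncomputable def step (O : Set (List Bool)) : Conf e → Bool → Conf e := (estimator e).step O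

/-- All queries have length at most `B`. -/
def Safe (B : ℕ) (c : Conf e) : Prop := c.l = some .ask → (c.stk .qry).length ≤ B

/-- The tree of runs of the estimator. -/
abbrev Tree (O : Set (List Bool)) (B : ℕ) (g : Conf e → ℝ) : ℕ → Conf e → ℝ → Prop :=
  Unfolds (step e O) (fun c => c.l = none) (Safe B) g mean

theorem step_of_ne_ask (O : Set (List Bool)) {l : ELabel} (hl : l ≠ .ask) (v : EMem e)
    (S : EStack → List Bool) (b : Bool) :
    step e O ⟨some l, v, S⟩ b = Turing.TM2.stepAux (prog e b l) v S :=
  (estimator e).step_of_ne_ask O l hl v S b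

section tree

variable {O : Set (List Bool)} {B : ℕ} {g : Conf e → ℝ} {t : ℕ}

/-- This and the following lemmas work backwards: a tree from the configuration after a step or a
loop is extended to one from the configuration before it, so the phases of the program compose from
the end. -/
theorem tree_det {l : ELabel} {v : EMem e} {S : EStack → List Bool} {c : Conf e} {x : ℝ}
    (hl : l ≠ .ask) (hc : ∀ b, Turing.TM2.stepAux (prog e b l) v S = c)
    (h : Tree O B g t c x) : Tree O B g (t + 1) ⟨some l, v, S⟩ x := by
  refine Unfolds.det (mean_self x) (fun h => absurd (Option.some.inj h) hl) ?_ ?_ h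
  · rw [step_of_ne_ask O hl, hc]
  · rw [step_of_ne_ask O hl, hc]

theorem tree_coin {l : ELabel} {v : EMem e} {S : EStack → List Bool} {c : Bool → Conf e}
    {x : Bool → ℝ} (hl : l ≠ .ask) (hc : ∀ b, Turing.TM2.stepAux (prog e b l) v S = c b)
    (h : ∀ b, Tree O B g t (c b) (x b)) :
    Tree O B g (t + 1) ⟨some l, v, S⟩ (mean (x false) (x true)) := by
  refine .node (fun h => absurd (Option.some.inj h) hl) (x := x false) (y := x true) ?_ ?_ rfl
  · rw [step_of_ne_ask O hl, hc]; exact h _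
  · rw [step_of_ne_ask O hl, hc]; exact h _

theorem tree_ask_yes {v : EMem e} {S : EStack → List Bool} {x : ℝ} (hB : (S .qry).length ≤ B)
    (hO : S .qry ∈ O) (h : Tree O B g t ⟨some .yes, v, S⟩ x) :
    Tree O B g (t + 1) ⟨some .ask, v, S⟩ x := by
  have : ∀ b, step e O ⟨some .ask, v, S⟩ b = ⟨some .yes, v, S⟩ := fun b => by
    refine ((estimator e).step_ask O v S b).trans ?_
    rw [if_pos]
    · rfl
    · exact hO
  exact Unfolds.det (mean_self x) (fun _ => hB) (this _) (this _) h

theorem tree_ask_no {v : EMem e} {S : EStack → List Bool} {x : ℝ} (hB : (S .qry).length ≤ B)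
    (hO : S .qry ∉ O) (h : Tree O B g t ⟨some .no, v, S⟩ x) :
    Tree O B g (t + 1) ⟨some .ask, v, S⟩ x := by
  have : ∀ b, step e O ⟨some .ask, v, S⟩ b = ⟨some .no, v, S⟩ := fun b => by
    refine ((estimator e).step_ask O v S b).trans ?_
    rw [if_neg]
    · rfl
    · exact hO
  exact Unfolds.det (mean_self x) (fun _ => hB) (this _) (this _) h

variable {φ : Bool} {d j y : ℕ} {out : List Bool}

theorem tree_alpha (zs xs : List Bool) (hl : zs.length = xs.length) {its : List (Tag × Bool)}
    {rest sav len len' : List Bool} {x : ℝ}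
    (h : Tree O B g t ⟨some .rest, mem e d φ j y,
      store rest out (encodeItems (addShifted zs xs its)) (xs.reverse ++ sav) [] len len'⟩ x) :
    Tree O B g (t + zs.length + 1) ⟨some .alpha, mem e d φ j y,
      store (xs ++ rest) out (encodeItems its) sav zs len len'⟩ x := by
  induction zs generalizing xs its sav with
  | nil =>
    obtain rfl := List.length_eq_zero_iff.1 hl.symm
    exact tree_det (by simp) (fun b => by simp [prog, mem]; rfl) h
  | cons z zs ih =>
    obtain _ | ⟨u, xs⟩ := xs
    · simp at hl
    refine tree_det (by simp) (fun b => ?_) (ih xs (by simpa using hl)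
      (sav := u :: sav) (its := (.z, z) :: (.inp, xor z u) :: its) ?_)
    · simp [prog, mem, encodeItems_cons]
    · simpa [addShifted] using h

theorem tree_rest (xs : List Bool) {its : List (Tag × Bool)} {sav len len' : List Bool} {x : ℝ}
    (h : Tree O B g t ⟨some .restore, mem e d φ j y,
      store [] out (encodeItems (addAll .inp xs its)) (xs.reverse ++ sav) [] len len'⟩ x) :
    Tree O B g (t + xs.length + 1) ⟨some .rest, mem e d φ j y,
      store xs out (encodeItems its) sav [] len len'⟩ x := by
  induction xs generalizing its sav with
  | nil => exact tree_det (by simp) (fun b => by simp [prog, mem]; rfl) h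
  | cons u xs ih =>
    refine tree_det (by simp) (fun b => ?_) (ih (sav := u :: sav) (its := (.inp, u) :: its) ?_)
    · simp [prog, mem, encodeItems_cons]
    · simpa [addAll] using h

theorem tree_restore (sav : List Bool) {inp qry len len' : List Bool} {x : ℝ}
    (h : Tree O B g t ⟨some .ask, mem e d false j y,
      store (sav.reverse ++ inp) out qry [] [] (true :: len) len'⟩ x) :
    Tree O B g (t + sav.length + 1) ⟨some .restore, mem e d φ j y,
      store inp out qry sav [] len len'⟩ x := by
  induction sav generalizing inp with
  | nil => exact tree_det (by simp) (fun b => by simp [prog, mem]) h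
  | cons u sav ih =>
    refine tree_det (by simp) (fun b => ?_) (ih (inp := u :: inp) ?_)
    · simp [prog, mem]
    · simpa using h

/-- Shift bits and Toeplitz bits are tossed alternately, and `avg_avg_succ` rearranges the nested
means into two separate averages. The shift bits end up on `.shf` in reverse order. -/
theorem tree_ones (n : ℕ) (hd : d ≤ e) {its : List (Tag × Bool)}
    {rest sav shf len len' : List Bool} {x : List Bool → List Bool → ℝ}
    (h : ∀ z a, z.length = n → a.length = n → Tree O B g t ⟨some .ones, mem e (min (d + n) e) φ j y,
      store rest out (encodeItems (addOnes e d a its)) (List.replicate n true ++ sav)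
        (z.reverse ++ shf) len len'⟩ (x z a)) :
    Tree O B g (t + 2 * n) ⟨some .ones, mem e d φ j y,
      store (List.replicate n true ++ rest) out (encodeItems its) sav shf len len'⟩
      (avg n fun z => avg n fun a => x z a) := by
  induction n generalizing d its sav shf x with
  | zero => simpa [avg, addOnes, Nat.min_eq_left hd] using h [] [] rfl rfl
  | succ n ih =>
    rw [avg_avg_succ]
    -- The configuration after the shift bit `b`, when the Toeplitz bit of this iteration is still
    -- to be tossed.
    have key : ∀ b, Tree O B g (t + 2 * n + 1) ⟨some .onesA, mem e (min (d + 1) e) φ j y,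
        store (List.replicate n true ++ rest) out
          (encodeItems (if d < e then (.inp, true) :: its else (.s, true) :: (.inp, true) :: its))
          (true :: sav) (b :: shf) len len'⟩
        (mean (avg n fun z => avg n fun a => x (b :: z) (false :: a))
          (avg n fun z => avg n fun a => x (b :: z) (true :: a))) := by
      intro b
      refine tree_coin (by simp)
        (x := fun c => avg n fun z => avg n fun a => x (b :: z) (c :: a))
        (c := fun c => ⟨some .ones, mem e (min (d + 1) e) φ j y,
          store (List.replicate n true ++ rest) out (encodeItems ((.a, c) ::
            if d < e then (.inp, true) :: its else (.s, true) :: (.inp, true) :: its))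
            (true :: sav) (b :: shf) len len'⟩)
        (fun c => by simp [prog, mem, ← encodeItems_cons]) (fun c => ih (by omega) ?_)
      intro z a hz ha
      have h := h (b :: z) (c :: a) (by simp [hz]) (by simp [ha])
      have h1 : min (min (d + 1) e + n) e = min (d + (n + 1)) e := by omega
      rw [h1]
      convert h using 3
      · rw [addOnes]
        split_ifs with h2
        · rw [Nat.min_eq_left h2]
        · rw [Nat.min_eq_right (by omega), show d = e by omega]
      · simp [List.replicate_succ']
      · simp
    refine tree_coin (by simp) (x := fun b => mean
      (avg n fun z => avg n fun a => x (b :: z) (false :: a))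
      (avg n fun z => avg n fun a => x (b :: z) (true :: a))) (fun b => ?_) key
    have hm : d % (e + 1) = d := Nat.mod_eq_of_lt (by omega)
    by_cases hde : d < e
    · rw [Nat.min_eq_left hde]
      simp [prog, List.replicate_succ, mem, hm, hde, inc, encodeItems_cons]
    · rw [Nat.min_eq_right (by omega), show d = e by omega]
      simp [prog, List.replicate_succ, mem, encodeItems_cons]

theorem tree_ones_end {its : List (Tag × Bool)} {rest sav shf len len' : List Bool} {x : ℝ}
    (h : Tree O B g t ⟨some .alpha, mem e 0 φ j y,
      store rest out (encodeItems ((.inp, false) :: its)) (false :: sav) shf len len'⟩ x) :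
    Tree O B g (t + 1) ⟨some .ones, mem e d φ j y,
      store (false :: rest) out (encodeItems its) sav shf len len'⟩ x :=
  tree_det (by simp) (fun b => by simp [prog, mem, encodeItems_cons]) h

theorem tree_back (l : ℕ) {its : List (Tag × Bool)} {inp len : List Bool} {x : ℝ}
    (h : Tree O B g t ⟨some .ask, mem e d φ j y,
      store inp out (encodeItems its) [] [] (List.replicate l true ++ len) []⟩ x) :
    Tree O B g (t + l + 1) ⟨some .back, mem e d φ j y,
      store inp out (encodeItems its) [] [] len (List.replicate l true)⟩ x := by
  induction l generalizing len with
  | zero => exact tree_det (by simp) (fun b => by simp [prog, mem]) h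
  | succ l ih =>
    refine tree_det (by simp) (fun b => ?_) (ih (len := true :: len) ?_)
    · simp [prog, mem, List.replicate_succ]
    · rw [List.replicate_succ'] at h
      simpa using h

/-- Each mark on `.len` pays for one coin and one Toeplitz bit and becomes two marks on `.len'`.
Thus the number of marks stays one more than the number of coins when both are doubled in this
sense. -/
theorem tree_grow (l : ℕ) {its : List (Tag × Bool)} {inp len' : List Bool}
    {x : List Bool → List Bool → ℝ}
    (h : ∀ r a, r.length = l → a.length = l → Tree O B g t ⟨some .back, mem e d φ j y,
      store inp out (encodeItems (addCoins r a its)) [] [] []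
        (List.replicate (2 * l) true ++ len')⟩ (x r a)) :
    Tree O B g (t + 2 * l + 1) ⟨some .grow, mem e d φ j y,
      store inp out (encodeItems its) [] [] (List.replicate l true) len'⟩
      (avg l fun r => avg l fun a => x r a) := by
  induction l generalizing its len' x with
  | zero =>
    exact tree_det (by simp) (fun b => by simp [prog, mem]; rfl) (h [] [] rfl rfl)
  | succ n ih =>
    rw [avg_avg_succ]
    have key : ∀ b, Tree O B g (t + 2 * n + 2) ⟨some .growA, mem e d φ j y,
        store inp out (encodeItems ((.r, b) :: its)) [] [] (List.replicate n true)
          (true :: true :: len')⟩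
        (mean (avg n fun z => avg n fun a => x (b :: z) (false :: a))
          (avg n fun z => avg n fun a => x (b :: z) (true :: a))) := by
      intro b
      refine tree_coin (by simp)
        (x := fun c => avg n fun z => avg n fun a => x (b :: z) (c :: a))
        (c := fun c => ⟨some .grow, mem e d φ j y,
          store inp out (encodeItems ((.a, c) :: (.r, b) :: its)) [] [] (List.replicate n true)
            (true :: true :: len')⟩)
        (fun c => by simp [prog, mem, ← encodeItems_cons]) (fun c => ih ?_)
      intro z a hz ha
      have h := h (b :: z) (c :: a) (by simp [hz]) (by simp [ha])
      rw [show 2 * (n + 1) = 2 * n + 1 + 1 by ring, List.replicate_succ', List.replicate_succ'] at h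
      simpa [addCoins] using h
    refine tree_coin (by simp) (x := fun b => mean
      (avg n fun z => avg n fun a => x (b :: z) (false :: a))
      (avg n fun z => avg n fun a => x (b :: z) (true :: a))) (fun b => ?_) key
    simp [prog, List.replicate_succ, mem, encodeItems_cons]

theorem tree_clear {inp qry len : List Bool} {x : ℝ}
    (h : Tree O B g t ⟨some .clearL, mem e d φ j y, store inp out [] [] [] len []⟩ x) :
    Tree O B g (t + qry.length + 1) ⟨some .clear, mem e d φ j y,
      store inp out qry [] [] len []⟩ x := by
  induction qry with
  | nil => exact tree_det (by simp) (fun b => by simp [prog, mem]) h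
  | cons u q ih => exact tree_det (by simp) (fun b => by simp [prog, mem]) ih

theorem tree_clearL {inp len : List Bool} {x : ℝ}
    (h : Tree O B g t ⟨some .clearL, mem e d φ j y, store inp out [] [] [] [] []⟩ x) :
    Tree O B g (t + len.length) ⟨some .clearL, mem e d φ j y,
      store inp out [] [] [] len []⟩ x := by
  induction len with
  | nil => exact h
  | cons u q ih => exact tree_det (by simp) (fun b => by simp [prog, mem]) ih

theorem tree_next {inp : List Bool} {x : ℝ} (hj : j + 1 < 2 ^ (2 * e))
    (h : Tree O B g t ⟨some .ones, mem e d φ (j + 1) y, store inp out [] [] [] [] []⟩ x) :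
    Tree O B g (t + 1) ⟨some .clearL, mem e d φ j y, store inp out [] [] [] [] []⟩ x := by
  have hm : (j + 1) % (2 ^ (2 * e) + 1) = j + 1 := Nat.mod_eq_of_lt (by omega)
  exact tree_det (by simp) (fun b => by simp [prog, mem, inc, hm, hj]) h

theorem tree_last {inp : List Bool} {x : ℝ} (hj : j + 1 = 2 ^ (2 * e)) (hy : y ≤ 2 ^ (2 * e))
    (h : Tree O B g t ⟨some .fin, mem e d φ (j + 1) y,
      store inp ((List.range (2 * e + 1)).map y.testBit ++ out) [] [] [] [] []⟩ x) :
    Tree O B g (t + 1) ⟨some .clearL, mem e d φ j y, store inp out [] [] [] [] []⟩ x := by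
  have hm : (j + 1) % (2 ^ (2 * e) + 1) = j + 1 := Nat.mod_eq_of_lt (by omega)
  have hy' : y % (2 ^ (2 * e) + 1) = y := Nat.mod_eq_of_lt (by omega)
  exact tree_det (by simp) (fun b => by simp [prog, mem, inc, hj, hy']) h

/-- The counter skips `e` ones exactly as in the first pass, so from `d = 0` the number of zeros
equals the length of the seed. -/
theorem tree_fin (n : ℕ) (hd : d ≤ e) {rest qry sav shf len len' : List Bool} {x : ℝ}
    (hg : ∀ v S, S .out = List.replicate (d + n - e) false ++ out → g ⟨none, v, S⟩ = x) :
    Tree O B g (n + 1) ⟨some .fin, mem e d φ j y,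
      store (List.replicate n true ++ false :: rest) out qry sav shf len len'⟩ x := by
  have hm : d % (e + 1) = d := Nat.mod_eq_of_lt (by omega)
  induction n generalizing d out with
  | zero =>
    refine tree_det (t := 0) (by simp) (fun b => by simp [prog, mem]; rfl) (.halt rfl ?_)
    refine (hg _ _ ?_).symm
    simp [Nat.sub_eq_zero_of_le hd]
  | succ n ih =>
    by_cases hde : d < e
    · refine tree_det (by simp) (fun b => ?_) (ih (d := d + 1) (out := out) hde ?_
        (Nat.mod_eq_of_lt (by omega)))
      · simp [prog, mem, List.replicate_succ, hm, hde, inc]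
      · rw [show d + 1 + n - e = d + (n + 1) - e by omega]
        exact hg
    · obtain rfl : d = e := by omega
      refine tree_det (by simp) (fun b => ?_) (ih (d := d) (out := false :: out) le_rfl ?_ hm)
      · simp [prog, mem, List.replicate_succ]
      · intro v S hS
        refine hg v S (hS.trans ?_)
        rw [show d + (n + 1) - d = n + 1 by omega, show d + n - d = n by omega,
          List.replicate_succ']
        simp

end tree

end Estimator

theorem avg_append_avg_append (p q : ℕ) (F : List Bool → List Bool → ℝ) :
    (avg (p + q) fun r => avg (p + q) fun a => F r a) =
      avg p fun r => avg p fun a => avg q fun r' => avg q fun a' => F (r ++ r') (a ++ a') := by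
  rw [avg_append]
  refine avg_congr fun r _ => ?_
  rw [avg_comm p q]
  refine avg_congr fun r' _ => ?_
  rw [avg_append]

/-- The expectation of `G` at `y` plus the number of successes in `k` independent trials with
success probability `p`. -/
noncomputable def tally (p : ℝ) (G : ℕ → ℝ) : ℕ → ℕ → ℝ
  | 0, y => G y
  | k + 1, y => p * tally p G k (y + 1) + (1 - p) * tally p G k y

/-! ### Rounds of the estimator -/

namespace Estimator

variable {e : ℕ} {O : Set (List Bool)} {B : ℕ} {g : Conf e → ℝ} {t : ℕ} {φ : Bool} {d j y : ℕ}

/-- The answer to the `i`-th probe, which carries `2 ^ i - 1` coins, depends on `i` alone. So the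
search stops at `i = k` on every branch, after work that is a geometric sum, and the coins collected
by then are uniform. -/
theorem tree_probe {inp out : List Bool} {its : List (Tag × Bool)} {k : ℕ}
    (hO : ∀ i ≤ k, ∀ r a : List Bool, r.length = 2 ^ i - 1 → a.length = 2 ^ i - 1 →
      (encodeItems (addCoins r a its) ∈ O ↔ i < k))
    (hB : 4 * (its.length + 2 * 2 ^ k) ≤ B) {x : List Bool → List Bool → ℝ}
    (h : ∀ r a : List Bool, r.length = 2 ^ k - 1 → a.length = 2 ^ k - 1 →
      Tree O B g t ⟨some .ask, mem e d true j y,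
        store inp out (encodeItems ((.fl, true) :: addCoins r a its)) [] []
          (List.replicate (2 ^ k) true) []⟩ (x r a))
    (m i : ℕ) (hi : i + m = k) (r a : List Bool) (hr : r.length = 2 ^ i - 1)
    (ha : a.length = 2 ^ i - 1) :
    Tree O B g (t + 8 * (2 ^ k - 2 ^ i) + 2) ⟨some .ask, mem e d false j y,
      store inp out (encodeItems (addCoins r a its)) [] [] (List.replicate (2 ^ i) true) []⟩
      (avg (2 ^ k - 2 ^ i) fun r' => avg (2 ^ k - 2 ^ i) fun a' => x (r ++ r') (a ++ a')) := by
  have hik : (2 : ℕ) ^ i ≤ 2 ^ k := Nat.pow_le_pow_right (by simp) (by omega)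
  have hlen : (encodeItems (addCoins r a its)).length ≤ B := by
    rw [length_encodeItems]
    have := length_addCoins_le r a its
    omega
  induction m generalizing i r a with
  | zero =>
    obtain rfl : i = k := by omega
    simp only [Nat.sub_self, avg, List.append_nil, mul_zero, add_zero]
    refine tree_ask_no hlen (by simp [hO i le_rfl r a hr ha]) ?_
    refine tree_det (by simp) (fun b => ?_) (h r a hr ha)
    simp [prog, mem, encodeItems_cons]
  | succ m ih =>
    have h2 : (2 : ℕ) ^ (i + 1) = 2 ^ i + 2 ^ i := by ring
    have hik' : (2 : ℕ) ^ (i + 1) ≤ 2 ^ k := Nat.pow_le_pow_right (by simp) (by omega)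
    have hpos : 1 ≤ 2 ^ i := Nat.one_le_two_pow
    have key := tree_grow (O := O) (B := B) (g := g) (φ := false) (d := d) (j := j) (y := y)
      (t := t + 8 * (2 ^ k - 2 ^ (i + 1)) + 2 + 2 * 2 ^ i + 1) (out := out)
      (2 ^ i) (its := addCoins r a its) (inp := inp) (len' := [])
      (x := fun r1 a1 => avg (2 ^ k - 2 ^ (i + 1)) fun r' => avg (2 ^ k - 2 ^ (i + 1)) fun a' =>
        x ((r ++ r1) ++ r') ((a ++ a1) ++ a')) (fun r1 a1 hr1 ha1 => ?_)
    -- The missing `2 ^ k - 2 ^ i` coins are split into the `2 ^ i` of this doubling and those of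
    -- the later ones.
    · have e1 : (avg (2 ^ k - 2 ^ i) fun r' => avg (2 ^ k - 2 ^ i) fun a' =>
          x (r ++ r') (a ++ a')) = avg (2 ^ i) fun r1 => avg (2 ^ i) fun a1 =>
          avg (2 ^ k - 2 ^ (i + 1)) fun r' => avg (2 ^ k - 2 ^ (i + 1)) fun a' =>
            x ((r ++ r1) ++ r') ((a ++ a1) ++ a') := by
        rw [show 2 ^ k - 2 ^ i = 2 ^ i + (2 ^ k - 2 ^ (i + 1)) by omega,
          avg_append_avg_append]
        simp only [List.append_assoc]
      rw [e1]
      refine Unfolds.mono (tree_ask_yes (t := _ + 1) hlen ((hO i (by omega) r a hr ha).2 (by omega))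
        (tree_det (by simp) (fun b => by simp [prog, mem]) key)) (by omega)
    · rw [List.append_nil]
      refine Unfolds.mono (tree_back (2 * 2 ^ i) (len := [])
        (t := t + 8 * (2 ^ k - 2 ^ (i + 1)) + 2) ?_) (by omega)
      rw [← addCoins_append r r1 a a1 (by omega)]
      have h3 := ih (i + 1) (by omega) (r ++ r1) (a ++ a1) (by simp; omega) (by simp; omega) hik'
        (by
          rw [length_encodeItems]
          have := length_addCoins_le (r ++ r1) (a ++ a1) its
          simp only [List.length_append] at this
          omega)
      simpa [pow_succ, mul_comm] using h3

/-- The items of a query about a circuit that is shifted by `z`, before coins are added. -/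
def baseItems (e : ℕ) (α rest z a : List Bool) : List (Tag × Bool) :=
  addAll .inp rest (addShifted z α ((.inp, false) :: addOnes e 0 a []))

theorem length_baseItems_le (e : ℕ) (α rest z a : List Bool) :
    (baseItems e α rest z a).length ≤ 1 + 3 * a.length + 2 * z.length + rest.length := by
  rw [baseItems, length_addAll]
  have h1 := length_addShifted_le z α ((.inp, false) :: addOnes e 0 a [])
  have h2 := length_addOnes_le e 0 a []
  simp only [List.length_cons, List.length_nil] at h1 h2
  omega

variable (O) in
open Classical in
/-- The probability of a positive answer in a round, where the coins have length `2 ^ k z - 1` if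
the shift is `z`. -/
noncomputable def answerProb (e n : ℕ) (α rest : List Bool) (k : List Bool → ℕ) : ℝ :=
  avg n fun z => avg n fun a => avg (2 ^ k z - 1) fun r => avg (2 ^ k z - 1) fun a' =>
    if encodeItems ((.fl, true) :: addCoins r a' (baseItems e α rest z a)) ∈ O then 1 else 0

/-- Reversal permutes the strings of a given length. This absorbs the reversed order in which the
shift is popped. -/
theorem avg_reverse (n : ℕ) (F : List Bool → ℝ) : avg n (fun l => F l.reverse) = avg n F := by
  rw [avg_eq_sum, avg_eq_sum, ← (Equiv.arrowCongr Fin.revPerm (Equiv.refl Bool)).sum_comp]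
  congr 1
  refine Finset.sum_congr rfl fun r _ => ?_
  congr 1
  refine List.ext_getElem (by simp) fun i h1 h2 => ?_
  simp only [List.length_ofFn] at h2
  simp only [List.getElem_reverse, List.getElem_ofFn, List.length_ofFn, Equiv.arrowCongr_apply,
    Function.comp, Fin.revPerm_symm, Fin.revPerm_apply, Equiv.refl_apply]
  congr 1
  ext
  simp
  omega

theorem tree_build {z α rest sav : List Bool} (hl : z.length = α.length)
    {its : List (Tag × Bool)} {x : ℝ}
    (h : Tree O B g t ⟨some .ask, mem e 0 false j y,
      store (sav.reverse ++ false :: (α ++ rest)) []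
        (encodeItems (addAll .inp rest (addShifted z α ((.inp, false) :: its)))) [] [] [true] []⟩
        x) :
    Tree O B g (t + (sav.length + 1 + α.length + rest.length) + 1 + rest.length + 1 + z.length + 1
      + 1) ⟨some .ones, mem e d φ j y,
      store (false :: (α ++ rest)) [] (encodeItems its) sav z [] []⟩ x := by
  refine tree_ones_end (tree_alpha z α hl (tree_rest rest ?_))
  have := tree_restore (φ := φ) (rest.reverse ++ (α.reverse ++ false :: sav)) (inp := [])
    (by simpa using h)
  refine this.mono ?_
  simp
  omega

/-- A round raises the count with probability `answerProb`, independently of the earlier rounds, and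
leaves the input restored and all other stacks empty. This is one unfolding of `tally`. -/
theorem tree_round {n : ℕ} {α rest : List Bool} (hα : α.length = n) {k : List Bool → ℕ} {K : ℕ}
    (hK : ∀ z, z.length = n → 2 ^ k z ≤ K)
    (hO : ∀ z a, z.length = n → a.length = n → ∀ i ≤ k z, ∀ r a' : List Bool,
      r.length = 2 ^ i - 1 → a'.length = 2 ^ i - 1 →
      (encodeItems (addCoins r a' (baseItems e α rest z a)) ∈ O ↔ i < k z))
    {E : ℕ} (hE : E = 2 * n + 1 + rest.length) (hB : B = 12 * E + 8 * K) {x : ℕ → ℝ}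
    (h : ∀ y', y' ≤ y + 1 → Tree O B g t ⟨some .clearL, mem e 0 true j y',
      store (List.replicate n true ++ false :: (α ++ rest)) [] [] [] [] [] []⟩ (x y')) :
    Tree O B g (t + 20 * (E + K)) ⟨some .ones, mem e 0 φ j y,
      store (List.replicate n true ++ false :: (α ++ rest)) [] [] [] [] [] []⟩
      (answerProb O e n α rest k * x (y + 1) + (1 - answerProb O e n α rest k) * x y) := by
  classical
  set enc := List.replicate n true ++ false :: (α ++ rest) with henc
  set ind : List Bool → List Bool → List Bool → List Bool → ℝ := fun z a r a' =>
    if encodeItems ((.fl, true) :: addCoins r a' (baseItems e α rest z a)) ∈ O then 1 else 0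
  -- The value of a branch is affine in the indicator of a positive answer, so averaging replaces
  -- the indicator by its probability.
  have hval : answerProb O e n α rest k * x (y + 1) + (1 - answerProb O e n α rest k) * x y =
      avg n fun z => avg n fun a => avg (2 ^ k z.reverse - 1) fun r =>
        avg (2 ^ k z.reverse - 1) fun a' => ind z.reverse a r a' * (x (y + 1) - x y) + x y := by
    rw [avg_reverse n (fun z => avg n fun a => avg (2 ^ k z - 1) fun r =>
        avg (2 ^ k z - 1) fun a' => ind z a r a' * (x (y + 1) - x y) + x y)]
    simp only [avg_add, avg_mul_const, avg_const]
    rw [show answerProb O e n α rest k = avg n fun z => avg n fun a => avg (2 ^ k z - 1) fun r =>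
      avg (2 ^ k z - 1) fun a' => ind z a r a' from rfl]
    ring
  rw [hval]
  refine Unfolds.mono (tree_ones n (Nat.zero_le _) (rest := false :: (α ++ rest)) (its := [])
    (sav := []) (shf := []) (t := t + 20 * (E + K) - 2 * n) fun z a hz ha => ?_) (by omega)
  obtain ⟨z, rfl⟩ : ∃ w, z = List.reverse w := ⟨z.reverse, by simp⟩
  rw [List.length_reverse] at hz
  rw [List.reverse_reverse, List.append_nil, List.append_nil]
  set K' := 2 ^ k z
  have hK' : K' ≤ K := hK z hz
  have hpos : 1 ≤ K' := Nat.one_le_two_pow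
  have hbase := length_baseItems_le e α rest z a
  set tc := t + K' + B + 3 with htc
  have hprobe := tree_probe (g := g) (d := 0) (j := j) (y := y) (inp := enc) (out := [])
    (its := baseItems e α rest z a) (hO z a hz ha) (B := B) (by omega)
    (t := tc)
    (x := fun r a' => ind z a r a' * (x (y + 1) - x y) + x y)
    (fun r a' hr ha' => ?_) (k z) 0 (by simp) [] [] (by simp) (by simp)
  · simp only [pow_zero, List.nil_append, List.replicate_one] at hprobe
    refine Unfolds.mono (tree_build (hz.trans hα.symm) ?_ (t := tc + 8 * (K' - 1) + 2)) ?_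
    · rw [List.reverse_replicate]
      exact hprobe
    · simp only [List.length_replicate, hα, hz]
      omega
  · have hlen : (encodeItems ((.fl, true) :: addCoins r a' (baseItems e α rest z a))).length
        ≤ B := by
      rw [length_encodeItems, List.length_cons]
      have := length_addCoins_le r a' (baseItems e α rest z a)
      omega
    have hcl : ∀ y', y' ≤ y + 1 → Tree O B g (t + K' + B + 1) ⟨some .clear, mem e 0 true j y',
        store enc [] (encodeItems ((.fl, true) :: addCoins r a' (baseItems e α rest z a))) [] []
          (List.replicate K' true) []⟩ (x y') := fun y' hy' =>
      Unfolds.mono (tree_clear (tree_clearL (h y' hy'))) (by rw [List.length_replicate]; omega)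
    by_cases hq : encodeItems ((.fl, true) :: addCoins r a' (baseItems e α rest z a)) ∈ O
    · simp only [ind, if_pos hq, one_mul, sub_add_cancel]
      exact tree_ask_yes hlen hq (tree_det (by simp)
        (fun b => by simp [prog, mem, inc]; rfl) (hcl (y + 1) le_rfl))
    · simp only [ind, if_neg hq, zero_mul, zero_add]
      exact tree_ask_no hlen hq (tree_det (by simp)
        (fun b => by simp [prog, mem]; rfl) (hcl y (by omega)))

/-- The round counter is tested after each round, so at least one round takes place and the
induction starts with the last one. -/
theorem tree_rounds {n : ℕ} {α rest : List Bool} (hα : α.length = n) {k : List Bool → ℕ} {K : ℕ}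
    (hK : ∀ z, z.length = n → 2 ^ k z ≤ K)
    (hO : ∀ z a, z.length = n → a.length = n → ∀ i ≤ k z, ∀ r a' : List Bool,
      r.length = 2 ^ i - 1 → a'.length = 2 ^ i - 1 →
      (encodeItems (addCoins r a' (baseItems e α rest z a)) ∈ O ↔ i < k z))
    {E : ℕ} (hE : E = 2 * n + 1 + rest.length) (hB : B = 12 * E + 8 * K) {G : ℕ → ℝ}
    (hG : ∀ y ≤ 2 ^ (2 * e), ∀ v S, S .out = List.replicate (n - e) false ++
      (List.range (2 * e + 1)).map y.testBit → g ⟨none, v, S⟩ = G y)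
    (m : ℕ) (hj : j + (m + 1) = 2 ^ (2 * e)) (hy : y ≤ j) :
    Tree O B g ((m + 1) * (20 * (E + K) + 1) + (n + 1)) ⟨some .ones, mem e 0 φ j y,
      store (List.replicate n true ++ false :: (α ++ rest)) [] [] [] [] [] []⟩
      (tally (answerProb O e n α rest k) G (m + 1) y) := by
  induction m generalizing j y φ with
  | zero =>
    refine Unfolds.mono (tree_round (t := n + 1 + 1) hα hK hO hE hB (x := G) fun y' hy' => ?_)
      (by omega)
    refine tree_last (by omega) (by omega) ?_
    refine tree_fin n (Nat.zero_le _) fun v S hS => hG y' (by omega) v S ?_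
    simpa using hS
  | succ m ih =>
    refine Unfolds.mono (tree_round (t := (m + 1) * (20 * (E + K) + 1) + (n + 1) + 1) hα hK hO hE
      hB (x := tally (answerProb O e n α rest k) G (m + 1)) fun y' hy' => ?_) ?_
    · exact tree_next (by omega) (ih (by omega) (by omega))
    · have : (m + 1 + 1) * (20 * (E + K) + 1) =
        (m + 1) * (20 * (E + K) + 1) + 20 * (E + K) + 1 := by ring
      omega

theorem ofDigits_map_testBit (k y : ℕ) :
    Nat.ofDigits 2 ((List.range k).map fun i => (y.testBit i).toNat) = y % 2 ^ k := by
  induction k with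
  | zero => simp [Nat.mod_one]
  | succ k ih =>
    rw [List.range_succ, List.map_append, Nat.ofDigits_append, ih, Nat.mod_pow_succ]
    simp [Nat.toNat_testBit]

theorem binaryValue_replicate_append (l k y : ℕ) (hy : y < 2 ^ k) :
    binaryValue (List.replicate l false ++ (List.range k).map y.testBit) = y * 2 ^ l := by
  have h0 : Nat.ofDigits 2 (List.replicate l 0) = 0 := by
    induction l with
    | zero => simp
    | succ l ih => simp [List.replicate_succ, Nat.ofDigits_cons, ih]
  rw [binaryValue, List.map_append, Nat.ofDigits_append]
  have := ofDigits_map_testBit k y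
  simp only [List.map_replicate, Bool.toNat_false, h0, List.map_map, List.length_replicate]
  rw [show (List.range k).map (Bool.toNat ∘ y.testBit) =
    (List.range k).map fun i => (y.testBit i).toNat from rfl, this, Nat.mod_eq_of_lt hy]
  ring

end Estimator

open Estimator in
open Classical in
/-- The runs of the estimator on the code of a polynomial, if the oracle answers the queries without
flag according to whether the coins are shorter than `2 ^ k z - 1`. -/
theorem estimator_run {e : ℕ} {O : Set (List Bool)} {n : ℕ} {α rest : List Bool}
    (hα : α.length = n) {k : List Bool → ℕ} {K : ℕ} (hK : ∀ z, z.length = n → 2 ^ k z ≤ K)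
    (hO : ∀ z a, z.length = n → a.length = n → ∀ i ≤ k z, ∀ r a' : List Bool,
      r.length = 2 ^ i - 1 → a'.length = 2 ^ i - 1 →
      (encodeItems (addCoins r a' (baseItems e α rest z a)) ∈ O ↔ i < k z))
    {E T B : ℕ} (hE : E = 2 * n + 1 + rest.length) (hB : B = 12 * E + 8 * K)
    (hT : T = 2 ^ (2 * e) * (20 * (E + K) + 1) + (n + 1)) {x : List Bool}
    (hx : x = List.replicate n true ++ false :: (α ++ rest)) :
    (∀ r, r.length = T → ((estimator e).run O x r).l = none) ∧
    (∀ r, ((estimator e).run O x r).l = some .ask →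
      (((estimator e).run O x r).stk .qry).length ≤ B) ∧
    ∀ P : ℕ → Prop, coinProb T (fun r => ((estimator e).run O x r).l = none ∧
        P (binaryValue (((estimator e).run O x r).stk (estimator e).out))) =
      tally (answerProb O e n α rest k) (fun y => if P (y * 2 ^ (n - e)) then 1 else 0)
        (2 ^ (2 * e)) 0 := by
  have hstart : (estimator e).start x = (⟨some .ones, mem e 0 false 0 0,
      store x [] [] [] [] [] []⟩ : Conf e) := by
    have : (estimator e).start x = (⟨some .ones, mem e 0 false 0 0,
      Function.update (store [] [] [] [] [] [] []) .inp x⟩ : Conf e) := by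
      have h : ∀ k, store [] [] [] [] [] [] [] k = [] := fun k => by cases k <;> rfl
      rw [show store [] [] [] [] [] [] [] = fun _ => [] from funext h]
      simp only [Machine.start, estimator, mem]
      congr 1
    rw [this, update_inp]
  have hfin : ∀ (c : Conf e) b, c.l = none → step e O c b = c :=
    fun c b hc => (estimator e).step_of_halted O c b hc
  have hpos : 0 < 2 ^ (2 * e) := by positivity
  -- One tree serves all three conclusions: its depth bounds the time, its safe nodes bound the
  -- queries, and its value is the probability of `P`.
  have htree : ∀ P : ℕ → Prop, Tree O B (fun c => if c.l = none ∧ P (binaryValue (c.stk .out))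
      then 1 else 0) T ⟨some .ones, mem e 0 false 0 0, store x [] [] [] [] [] []⟩
      (tally (answerProb O e n α rest k) (fun y => if P (y * 2 ^ (n - e)) then 1 else 0)
        (2 ^ (2 * e)) 0) := fun P => by
    obtain ⟨m, hm⟩ : ∃ m, 2 ^ (2 * e) = m + 1 := ⟨2 ^ (2 * e) - 1, by omega⟩
    rw [hT, hm, hx]
    refine tree_rounds hα hK hO hE hB (fun y hy v S hS => ?_) m (by omega) le_rfl
    have hb := binaryValue_replicate_append (n - e) (2 * e + 1) y
      (hy.trans_lt (Nat.pow_lt_pow_right (by simp) (by omega)))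
    rw [← hS] at hb
    simp [hb]
  refine ⟨fun r hr => ?_, fun r => ?_, fun P => ?_⟩
  · have := (htree fun _ => True).fin_foldl hfin r hr.ge
    rwa [← hstart] at this
  · have := (htree fun _ => True).safe_foldl hfin (fun c hc h => by simp [hc] at h) r
    rwa [← hstart] at this
  · rw [coinProb_eq_avg, ← (htree P).avg_foldl hfin, ← hstart]
    rfl

/-! ### The verifier -/

/-- The stacks of the verifier that are not stacks of the sampler. -/
inductive VStack
  | qry | z | s | r | a | fl | r' | a' | out
  deriving DecidableEq

instance : Fintype VStack :=
  .ofList [.qry, .z, .s, .r, .a, .fl, .r', .a', .out] fun k => by cases k <;> simp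

/-- The labels of the verifier that are not labels of the sampler. -/
inductive VLabel
  | parse | start | hash | xor | back | cmp | acc | rej
  deriving DecidableEq

instance : Fintype VLabel :=
  .ofList [.parse, .start, .hash, .xor, .back, .cmp, .acc, .rej] fun k => by cases k <;> simp

/-- The internal memory of the verifier: that of the sampler, the kind of the query, the current
bit of the seed, and registers. -/
@[ext] structure VMem (M : Machine) where
  v : M.σ
  probe : Bool
  bit : Bool
  r1 : Option Bool
  r2 : Option Bool
  r3 : Option Bool
  r4 : Option Bool

instance (M : Machine) : Finite (VMem M) :=
  Finite.of_injective (fun w : VMem M => (w.v, w.probe, w.bit, w.r1, w.r2, w.r3, w.r4))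
    fun v w h => by simp only [Prod.mk.injEq] at h; ext1 <;> simp [h]

namespace Verifier

open Turing.TM2.Stmt

variable (M : Machine)

/-- The statements of the verifier. -/
abbrev Code : Type :=
  Turing.TM2.Stmt (fun _ : VStack ⊕ M.K => Bool) (VLabel ⊕ M.Λ) (VMem M)

/-- The configurations of the verifier. -/
abbrev Conf : Type :=
  Turing.TM2.Cfg (fun _ : VStack ⊕ M.K => Bool) (VLabel ⊕ M.Λ) (VMem M)

variable {M}

/-- The statements of the sampler as statements of the verifier. -/
def embed : Turing.TM2.Stmt (fun _ : M.K => Bool) M.Λ M.σ → Code M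
  | push k f q => push (.inr k) (fun w => f w.v) (embed q)
  | peek k f q => peek (.inr k) (fun w x => { w with v := f w.v x }) (embed q)
  | pop k f q => pop (.inr k) (fun w x => { w with v := f w.v x }) (embed q)
  | load f q => load (fun w => { w with v := f w.v }) (embed q)
  | branch f q q' => branch (fun w => f w.v) (embed q) (embed q')
  | goto f => goto fun w => .inr (f w.v)
  -- When the sampler halts, the verifier must go on: a probe is rejected, and in a final query the
  -- output is compared with `z`.
  | halt => branch (fun w => w.probe) (goto fun _ => .inl .rej) (goto fun _ => .inl .cmp)

/-- Clear the registers. -/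
def clear (q : Code M) : Code M :=
  load (fun w => { w with r1 := none, r2 := none, r3 := none, r4 := none }) q

/-- Clear the registers and jump. -/
def jump (l : VLabel) : Code M := clear (goto fun _ => .inl l)

/-- Store the bit that has been read on the stack `k`. -/
def put (k : VStack ⊕ M.K) : Code M := push k (fun w => w.r4.getD false) (jump .parse)

variable (M) in
/-- The program of the verifier. -/
def prog (b : Bool) : VLabel ⊕ M.Λ → Code M
  | .inl .parse => pop (.inl .qry) (fun w x => { w with r1 := x }) <|
      pop (.inl .qry) (fun w x => { w with r2 := x }) <|
      pop (.inl .qry) (fun w x => { w with r3 := x }) <|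
      pop (.inl .qry) (fun w x => { w with r4 := x }) <|
      branch (fun w => w.r1.isSome)
        (branch (fun w => w.r1.getD false)
          (branch (fun w => w.r3.getD false) (put (.inl .fl)) (put (.inl .a)))
          (branch (fun w => w.r2.getD false)
            (branch (fun w => w.r3.getD false) (put (.inl .r)) (put (.inl .s)))
            (branch (fun w => w.r3.getD false) (put (.inl .z)) (put (.inr M.inp)))))
        (jump .start)
  | .inl .start => pop (.inl .fl) (fun w x => { w with r1 := x }) <|
      load (fun w => { w with probe := w.r1.isNone }) <| jump .hash
  | .inl .hash => pop (.inl .s) (fun w x => { w with r1 := x }) <|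
      branch (fun w => w.r1.isSome) (load (fun w => { w with bit := b }) <| jump .xor)
        (clear <| goto fun _ => .inr M.main)
  | .inl .xor => pop (.inl .r) (fun w x => { w with r1 := x }) <|
      branch (fun w => w.r1.isSome)
        (pop (.inl .a) (fun w x => { w with r2 := x }) <|
          push (.inl .r') (fun w => Bool.xor (w.r1.getD false) (w.bit && w.r2.getD false)) <|
          push (.inl .a') (fun w => w.r2.getD false) <| jump .xor)
        (jump .back)
  | .inl .back => pop (.inl .r') (fun w x => { w with r1 := x }) <|
      branch (fun w => w.r1.isSome)
        (pop (.inl .a') (fun w x => { w with r2 := x }) <|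
          push (.inl .r) (fun w => w.r1.getD false) <|
          push (.inl .a) (fun w => w.r2.getD false) <| jump .back)
        -- Dropping the first bit of `a` moves on to the next column of the Toeplitz matrix.
        (pop (.inl .a) (fun w _ => { w with bit := false }) <| jump .hash)
  | .inl .cmp => pop (.inl .z) (fun w x => { w with r1 := x }) <|
      pop (.inr M.out) (fun w x => { w with r2 := x }) <|
      branch (fun w => decide (w.r1 = w.r2))
        (branch (fun w => w.r1.isSome) (jump .cmp) (jump .acc))
        (jump .rej)
  | .inl .acc => push (.inl .out) (fun _ => true) halt
  | .inl .rej => halt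
  -- Each simulated step consumes a coin. In a probe this coin is only a clock and the sampler is
  -- driven by the guessed bit.
  | .inr l => pop (.inl .r) (fun w x => { w with r1 := x }) <|
      branch (fun w => w.r1.isSome)
        (branch (fun w => w.probe) (clear <| embed (M.m b l))
          (branch (fun w => w.r1.getD false) (clear <| embed (M.m true l))
            (clear <| embed (M.m false l))))
        (branch (fun w => w.probe) (jump .acc) (jump .rej))

end Verifier

open Verifier in
/-- The nondeterministic machine that answers the queries of the estimator about the sampler `M`. -/
def verifier (M : Machine) : Machine where
  K := VStack ⊕ M.K
  Λ := VLabel ⊕ M.Λ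
  σ := VMem M
  main := .inl .parse
  init := ⟨M.init, false, false, none, none, none, none⟩
  inp := .inl .qry
  out := .inl .out
  m := prog M

/-- The coins `r` plus the product of the Toeplitz matrix given by `a` with the seed. -/
def toeplitz : List Bool → List Bool → List Bool → List Bool
  | r, _, [] => r
  | r, a, g :: i => toeplitz (List.zipWith (fun x y => xor x (g && y)) r a) a.tail i

/-- `List.zipWith` truncates to the shorter list, and `a` loses a bit per seed bit; the hypothesis
keeps `a` long enough throughout. -/
theorem length_toeplitz (r a i : List Bool) (h : r.length + i.length ≤ a.length) :
    (toeplitz r a i).length = r.length := by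
  induction i generalizing r a with
  | nil => rfl
  | cons g i ih =>
    simp only [List.length_cons] at h
    rw [toeplitz, ih]
    · simp; omega
    · simp; omega

theorem length_tagged_le (t : Tag) (l : List (Tag × Bool)) : (tagged t l).length ≤ l.length := by
  induction l with
  | nil => simp [tagged]
  | cons p l ih => rw [tagged]; split_ifs <;> simp <;> omega

/-! ### Runs of the verifier -/

namespace Verifier

variable {M : Machine}

/-- The memory with cleared registers. -/
def mem (v : M.σ) (probe bit : Bool) : VMem M := ⟨v, probe, bit, none, none, none, none⟩

/-- The contents of the verifier's own stacks. -/
def store (qry z s r a fl r' a' out : List Bool) : VStack → List Bool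
  | .qry => qry | .z => z | .s => s | .r => r | .a => a | .fl => fl | .r' => r' | .a' => a'
  | .out => out

section update

variable (qry z s r a fl r' a' out x : List Bool) (S : M.K → List Bool)

@[simp] theorem update_qry : Function.update (store qry z s r a fl r' a' out) .qry x =
    store x z s r a fl r' a' out := by
  funext k; cases k <;> rfl
@[simp] theorem update_z : Function.update (store qry z s r a fl r' a' out) .z x =
    store qry x s r a fl r' a' out := by
  funext k; cases k <;> rfl
@[simp] theorem update_s : Function.update (store qry z s r a fl r' a' out) .s x =
    store qry z x r a fl r' a' out := by
  funext k; cases k <;> rfl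
@[simp] theorem update_r : Function.update (store qry z s r a fl r' a' out) .r x =
    store qry z s x a fl r' a' out := by
  funext k; cases k <;> rfl
@[simp] theorem update_a : Function.update (store qry z s r a fl r' a' out) .a x =
    store qry z s r x fl r' a' out := by
  funext k; cases k <;> rfl
@[simp] theorem update_fl : Function.update (store qry z s r a fl r' a' out) .fl x =
    store qry z s r a x r' a' out := by
  funext k; cases k <;> rfl
@[simp] theorem update_r' : Function.update (store qry z s r a fl r' a' out) .r' x =
    store qry z s r a fl x a' out := by
  funext k; cases k <;> rfl
@[simp] theorem update_a' : Function.update (store qry z s r a fl r' a' out) .a' x =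
    store qry z s r a fl r' x out := by
  funext k; cases k <;> rfl

@[simp] theorem store_qry : store qry z s r a fl r' a' out .qry = qry := rfl
@[simp] theorem store_z : store qry z s r a fl r' a' out .z = z := rfl
@[simp] theorem store_s : store qry z s r a fl r' a' out .s = s := rfl
@[simp] theorem store_r : store qry z s r a fl r' a' out .r = r := rfl
@[simp] theorem store_a : store qry z s r a fl r' a' out .a = a := rfl
@[simp] theorem store_fl : store qry z s r a fl r' a' out .fl = fl := rfl
@[simp] theorem store_r' : store qry z s r a fl r' a' out .r' = r' := rfl
@[simp] theorem store_a' : store qry z s r a fl r' a' out .a' = a' := rfl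
@[simp] theorem store_out : store qry z s r a fl r' a' out .out = out := rfl

end update

/-- The contents of all stacks of the verifier. -/
def both (S : VStack → List Bool) (S' : M.K → List Bool) : VStack ⊕ M.K → List Bool
  | .inl k => S k
  | .inr k => S' k

@[simp] theorem both_inl (S : VStack → List Bool) (S' : M.K → List Bool) (k : VStack) :
    both S S' (.inl k) = S k := rfl

@[simp] theorem both_inr (S : VStack → List Bool) (S' : M.K → List Bool) (k : M.K) :
    both S S' (.inr k) = S' k := rfl

@[simp] theorem update_both_inl (S : VStack → List Bool) (S' : M.K → List Bool) (k : VStack)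
    (x : List Bool) :
    Function.update (both S S') (.inl k) x = both (Function.update S k x) S' := by
  funext i
  rcases i with i | i
  · by_cases h : i = k
    · subst h; simp
    · simp [h]
  · simp

@[simp] theorem update_both_inr (S : VStack → List Bool) (S' : M.K → List Bool) (k : M.K)
    (x : List Bool) :
    Function.update (both S S') (.inr k) x = both S (Function.update S' k x) := by
  funext i
  rcases i with i | i
  · simp
  · by_cases h : i = k
    · subst h; simp
    · simp [h]

@[simp] theorem stepAux_clear (q : Code M) (w : VMem M) (S : VStack ⊕ M.K → List Bool) :
    Turing.TM2.stepAux (clear q) w S = Turing.TM2.stepAux q (mem w.v w.probe w.bit) S := rfl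

@[simp] theorem stepAux_jump (l : VLabel) (w : VMem M) (S : VStack ⊕ M.K → List Bool) :
    Turing.TM2.stepAux (jump l) w S = ⟨some (.inl l), mem w.v w.probe w.bit, S⟩ := rfl

@[simp] theorem stepAux_put (k : VStack ⊕ M.K) (w : VMem M) (S : VStack ⊕ M.K → List Bool) :
    Turing.TM2.stepAux (put k) w S = ⟨some (.inl .parse), mem w.v w.probe w.bit,
      Function.update S k (w.r4.getD false :: S k)⟩ := rfl

/-- The label of the verifier that corresponds to a label of the sampler. -/
def label (probe : Bool) : Option M.Λ → VLabel ⊕ M.Λ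
  | some l => .inr l
  | none => .inl (if probe then .rej else .cmp)

/-- The embedded statement touches only the stacks of the sampler and its component of the memory;
`label` accounts for the replacement of `halt` by a jump. -/
theorem stepAux_embed (q : Turing.TM2.Stmt (fun _ : M.K => Bool) M.Λ M.σ) (v : M.σ)
    (probe bit : Bool) (S : VStack → List Bool) (S' : M.K → List Bool) :
    Turing.TM2.stepAux (embed q) (mem v probe bit) (both S S') =
      ⟨some (label probe (Turing.TM2.stepAux q v S').l),
        mem (Turing.TM2.stepAux q v S').var probe bit,
        both S (Turing.TM2.stepAux q v S').stk⟩ := by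
  induction q generalizing v S' with
  | push k f q ih =>
    simp only [embed, Turing.TM2.stepAux]
    rw [← ih]
    rw [update_both_inr]
    rfl
  | peek k f q ih => exact ih _ _
  | pop k f q ih =>
    simp only [embed, Turing.TM2.stepAux]
    rw [← ih]
    rw [update_both_inr]
    rfl
  | load f q ih => exact ih _ _
  | branch f q q' ih ih' =>
    simp only [embed, Turing.TM2.stepAux]
    cases h : f v
    · simpa [mem, h] using ih' v S'
    · simpa [mem, h] using ih v S'
  | goto f => rfl
  | halt => cases probe <;> rfl

/-- The tree of runs of the verifier. -/
abbrev Tree : ℕ → Conf M → Prop → Prop :=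
  Unfolds (verifier M).step (fun c => c.l = none) (fun _ => True)
    (fun c => (c.stk (.inl .out)).head? = some true) Or

theorem step_eq (l : VLabel ⊕ M.Λ) (w : VMem M) (S : VStack ⊕ M.K → List Bool) (b : Bool) :
    (verifier M).step (⟨some l, w, S⟩ : Conf M) b = Turing.TM2.stepAux (prog M b l) w S := rfl

theorem tree_det {t : ℕ} {l : VLabel ⊕ M.Λ} {w : VMem M} {S : VStack ⊕ M.K → List Bool} {c : Conf M}
    {P : Prop} (hc : ∀ b, Turing.TM2.stepAux (prog M b l) w S = c) (h : Tree t c P) :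
    Tree (t + 1) ⟨some l, w, S⟩ P :=
  Unfolds.det (or_self P) trivial (hc _) (hc _) h

theorem tree_guess {t : ℕ} {l : VLabel ⊕ M.Λ} {w : VMem M} {S : VStack ⊕ M.K → List Bool}
    {c : Bool → Conf M} {P : Bool → Prop}
    (hc : ∀ b, Turing.TM2.stepAux (prog M b l) w S = c b) (h : ∀ b, Tree t (c b) (P b)) :
    Tree (t + 1) ⟨some l, w, S⟩ (P false ∨ P true) := by
  refine .node trivial (x := P false) (y := P true) ?_ ?_ rfl
  · rw [step_eq, hc]; exact h _
  · rw [step_eq, hc]; exact h _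

variable {t : ℕ} {v : M.σ} {probe bit : Bool}

/-- Items come off the query in reverse order of writing and are reversed again when pushed, so each
stack receives its bits in the order in which they were written. -/
theorem tree_parse (its : List (Tag × Bool)) {z s r a fl x : List Bool} {P : Prop}
    (h : Tree t ⟨some (.inl .start), mem v probe bit,
      both (store [] (tagged .z its ++ z) (tagged .s its ++ s) (tagged .r its ++ r)
        (tagged .a its ++ a) (tagged .fl its ++ fl) [] [] [])
        (Function.update (fun _ => []) M.inp (tagged .inp its ++ x))⟩ P) :
    Tree (t + its.length + 1) ⟨some (.inl .parse), mem v probe bit,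
      both (store (encodeItems its) z s r a fl [] [] [])
        (Function.update (fun _ => []) M.inp x)⟩ P := by
  induction its generalizing z s r a fl x with
  | nil => exact tree_det (fun b => by simp [prog, mem, encodeItems]; rfl) h
  | cons p its ih =>
    obtain ⟨u, y⟩ := p
    cases u
    · refine tree_det (fun b => ?_) (ih (x := y :: x) (by simpa [tagged] using h))
      simp [prog, mem, encodeItems_cons, Tag.item, Tag.code]
    · refine tree_det (fun b => ?_) (ih (z := y :: z) (by simpa [tagged] using h))
      simp [prog, mem, encodeItems_cons, Tag.item, Tag.code]
    · refine tree_det (fun b => ?_) (ih (s := y :: s) (by simpa [tagged] using h))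
      simp [prog, mem, encodeItems_cons, Tag.item, Tag.code]
    · refine tree_det (fun b => ?_) (ih (r := y :: r) (by simpa [tagged] using h))
      simp [prog, mem, encodeItems_cons, Tag.item, Tag.code]
    · refine tree_det (fun b => ?_) (ih (a := y :: a) (by simpa [tagged] using h))
      simp [prog, mem, encodeItems_cons, Tag.item, Tag.code]
    · refine tree_det (fun b => ?_) (ih (fl := y :: fl) (by simpa [tagged] using h))
      simp [prog, mem, encodeItems_cons, Tag.item, Tag.code]

/-- Popping reverses both lists; `tree_back` undoes this. -/
theorem tree_xor (r : List Bool) {z s a fl r' a' : List Bool} {S : M.K → List Bool} {P : Prop}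
    (hra : r.length ≤ a.length)
    (h : Tree t ⟨some (.inl .back), mem v probe bit, both (store [] z s [] (a.drop r.length) fl
      ((List.zipWith (fun x y => xor x (bit && y)) r a).reverse ++ r')
      ((a.take r.length).reverse ++ a') []) S⟩ P) :
    Tree (t + r.length + 1) ⟨some (.inl .xor), mem v probe bit,
      both (store [] z s r a fl r' a' []) S⟩ P := by
  induction r generalizing a r' a' with
  | nil =>
    exact tree_det (c := ⟨some (.inl .back), mem v probe bit,
      both (store [] z s [] a fl r' a' []) S⟩) (fun b => by simp [prog, mem])
      (by simpa using h)
  | cons x r ih =>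
    obtain _ | ⟨y, a⟩ := a
    · simp at hra
    refine tree_det (fun b => ?_) (ih (a := a) (r' := xor x (bit && y) :: r') (a' := y :: a')
      (by simpa using hra) (by simpa using h))
    simp [prog, mem]

theorem tree_back (r' : List Bool) {z s r a fl a' : List Bool} {S : M.K → List Bool} {P : Prop}
    (hra : r'.length = a'.length)
    (h : Tree t ⟨some (.inl .hash), mem v probe false, both (store [] z s (r'.reverse ++ r)
      (a'.reverse ++ a).tail fl [] [] []) S⟩ P) :
    Tree (t + r'.length + 1) ⟨some (.inl .back), mem v probe bit,
      both (store [] z s r a fl r' a' []) S⟩ P := by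
  induction r' generalizing a r a' with
  | nil =>
    obtain rfl := List.length_eq_zero_iff.1 hra.symm
    exact tree_det (c := ⟨some (.inl .hash), mem v probe false,
      both (store [] z s r a.tail fl [] [] []) S⟩) (fun b => by simp [prog, mem])
      (by simpa using h)
  | cons x r' ih =>
    obtain _ | ⟨y, a'⟩ := a'
    · simp at hra
    refine tree_det (fun b => ?_) (ih (a := y :: a) (r := x :: r) (a' := a')
      (by simpa using hra) (by simpa using h))
    simp [prog, mem]

theorem exists_length_succ {n : ℕ} (Q : List Bool → Prop) :
    (∃ i : List Bool, i.length = n + 1 ∧ Q i) ↔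
      (∃ i : List Bool, i.length = n ∧ Q (false :: i)) ∨
        ∃ i : List Bool, i.length = n ∧ Q (true :: i) := by
  constructor
  · rintro ⟨i, hi, hQ⟩
    obtain _ | ⟨b, i⟩ := i
    · simp at hi
    cases b
    · exact .inl ⟨i, by simpa using hi, hQ⟩
    · exact .inr ⟨i, by simpa using hi, hQ⟩
  · rintro (⟨i, hi, hQ⟩ | ⟨i, hi, hQ⟩)
    · exact ⟨_, by simp [hi], hQ⟩
    · exact ⟨_, by simp [hi], hQ⟩

/-- Guessing the seed bit by bit gives a disjunction over all seeds. Every seed bit costs two passes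
over the coins, whence the product of lengths in the time bound. -/
theorem tree_hash (s : List Bool) {z r a fl : List Bool} {S : M.K → List Bool}
    {Q : List Bool → Prop} (hra : r.length + s.length ≤ a.length)
    (h : ∀ i : List Bool, i.length = s.length → ∀ a', Tree t ⟨some (.inr M.main), mem v probe false,
      both (store [] z [] (toeplitz r a i) a' fl [] [] []) S⟩ (Q i)) :
    Tree (t + s.length * (2 * r.length + 3) + 1) ⟨some (.inl .hash), mem v probe false,
      both (store [] z s r a fl [] [] []) S⟩ (∃ i : List Bool, i.length = s.length ∧ Q i) := by
  induction s generalizing r a Q with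
  | nil =>
    have : (∃ i : List Bool, i.length = ([] : List Bool).length ∧ Q i) = Q [] := by
      simp
    rw [this]
    exact (tree_det (fun b => by simp [prog, mem]; rfl) (h [] rfl a)).mono (by simp)
  | cons x s ih =>
    simp only [List.length_cons] at hra h ⊢
    rw [exists_length_succ]
    refine tree_guess (P := fun g => ∃ i : List Bool, i.length = s.length ∧ Q (g :: i))
      (c := fun g => ⟨some (.inl .xor), mem v probe g, both (store [] z s r a fl [] [] []) S⟩)
      (fun b => by simp [prog, mem]) (fun g => ?_)
    have hz : (List.zipWith (fun x y => xor x (g && y)) r a).length = r.length := by simp; omega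
    have key := ih (r := List.zipWith (fun x y => xor x (g && y)) r a) (a := a.tail)
      (Q := fun i => Q (g :: i)) (by rw [hz]; simp; omega)
      (fun i hi a' => h (g :: i) (by simp [hi]) a')
    refine Unfolds.mono (tree_xor r (by omega) (tree_back _ ?_ (t := t + s.length *
      (2 * r.length + 3) + 1) ?_)) ?_
    · simp
    · rw [hz] at key
      simpa using key
    · simp only [List.append_nil, List.length_reverse, hz]
      linarith

theorem tree_acc {w : VMem M} {S : VStack ⊕ M.K → List Bool} :
    Tree (t + 1) ⟨some (.inl .acc), w, S⟩ True := by
  refine tree_det (c := ⟨none, w, Function.update S (.inl .out) (true :: S (.inl .out))⟩)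
    (fun b => rfl) (.halt rfl ?_)
  simp

theorem tree_rej {w : VMem M} {S : VStack → List Bool} {S' : M.K → List Bool} (hS : S .out = []) :
    Tree (t + 1) ⟨some (.inl .rej), w, both S S'⟩ False := by
  refine tree_det (c := ⟨none, w, both S S'⟩) (fun b => rfl) (.halt rfl ?_)
  simp [hS]

theorem tree_cmp (z : List Bool) {s r a fl : List Bool} {S : M.K → List Bool} :
    Tree (t + z.length + 2) ⟨some (.inl .cmp), mem v probe bit,
      both (store [] z s r a fl [] [] []) S⟩ (S M.out = z) := by
  induction z generalizing S with
  | nil =>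
    rcases hS : S M.out with _ | ⟨y, l⟩
    · have hu : Function.update S M.out [] = S := by rw [← hS, Function.update_eq_self]
      rw [eq_self_iff_true]
      refine tree_det (fun b => ?_) (tree_acc (w := mem v probe bit)
        (S := both (store [] [] s r a fl [] [] []) S))
      simp [prog, hS, mem, hu]
    · rw [show (y :: l = []) = False by simp]
      refine tree_det (fun b => ?_) (tree_rej (w := mem v probe bit)
        (S := store [] [] s r a fl [] [] []) (S' := Function.update S M.out l) rfl)
      simp [prog, hS, mem]
  | cons x z ih =>
    rcases hS : S M.out with _ | ⟨y, l⟩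
    · have hu : Function.update S M.out [] = S := by rw [← hS, Function.update_eq_self]
      rw [show ([] = x :: z) = False by simp]
      refine tree_det (fun b => ?_) (tree_rej (w := mem v probe bit)
        (S := store [] z s r a fl [] [] []) (S' := S) rfl)
      simp [prog, hS, mem, hu]
    · by_cases hxy : x = y
      · subst hxy
        have h := ih (S := Function.update S M.out l)
        rw [Function.update_self] at h
        rw [show (x :: l = x :: z) = (l = z) by simp]
        refine tree_det (fun b => ?_) h
        simp [prog, hS, mem]
      · rw [show (y :: l = x :: z) = False by simp [Ne.symm hxy]]
        refine tree_det (fun b => ?_) (tree_rej (w := mem v probe bit)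
          (S := store [] z s r a fl [] [] []) (S' := Function.update S M.out l) rfl)
        simp [prog, hS, mem, hxy]

theorem stepAux_sim (l : M.Λ) (b x : Bool) {z s r a fl : List Bool} {S : M.K → List Bool} :
    Turing.TM2.stepAux (prog M b (.inr l)) (mem v probe bit)
      (both (store [] z s (x :: r) a fl [] [] []) S) =
      ⟨some (label probe (M.step ⟨some l, v, S⟩ (if probe then b else x)).l),
        mem (M.step ⟨some l, v, S⟩ (if probe then b else x)).var probe bit,
        both (store [] z s r a fl [] [] [])
          (M.step ⟨some l, v, S⟩ (if probe then b else x)).stk⟩ := by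
  rw [M.step_some, ← stepAux_embed]
  cases probe <;> cases x <;> simp [prog, mem]

theorem foldl_of_halted (c : M.Cfg) (hc : c.l = none) (r : List Bool) : r.foldl M.step c = c :=
  Unfolds.foldl_of_fin (fun _ b => M.step_of_halted _ b) hc r

/-- If the coins run out at a label of the sampler, the run has not halted, so rejection is the
correct answer. -/
theorem tree_sim (r : List Bool) (l : M.Λ) {z s a fl : List Bool} {S : M.K → List Bool} :
    Tree (t + r.length + z.length + 3) ⟨some (.inr l), mem v false bit,
      both (store [] z s r a fl [] [] []) S⟩
      ((r.foldl M.step ⟨some l, v, S⟩).l = none ∧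
        (r.foldl M.step ⟨some l, v, S⟩).stk M.out = z) := by
  induction r generalizing l v S with
  | nil =>
    rw [show ((([] : List Bool).foldl M.step ⟨some l, v, S⟩).l = none ∧
      (([] : List Bool).foldl M.step ⟨some l, v, S⟩).stk M.out = z) = False by simp]
    refine tree_det (fun b => ?_) (tree_rej (w := mem v false bit)
      (S := store [] z s [] a fl [] [] []) (S' := S) rfl)
    simp [prog, mem]
  | cons x r ih =>
    rw [List.foldl_cons]
    have hstep := fun b => stepAux_sim (v := v) (probe := false) (bit := bit) l b x (z := z)
      (s := s) (r := r) (a := a) (fl := fl) (S := S)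
    simp only [Bool.false_eq_true, if_false] at hstep
    refine tree_det hstep ?_ (t := t + (r.length + 1) + z.length + 2)
    obtain ⟨l', v', S'⟩ := M.step ⟨some l, v, S⟩ x
    cases l' with
    | none =>
      rw [foldl_of_halted _ rfl, eq_self_iff_true, true_and]
      exact (tree_cmp z (t := t)).mono (by omega)
    | some l' => exact (ih l').mono (by omega)

/-- The entries of `r` are irrelevant. Since halted configurations stay halted, the clock can run
out at a label of the sampler only on a run that has not halted by then. -/
theorem tree_sim_probe (r : List Bool) (l : M.Λ) {z s a fl : List Bool} {S : M.K → List Bool} :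
    Tree (t + r.length + 2) ⟨some (.inr l), mem v true bit,
      both (store [] z s r a fl [] [] []) S⟩
      (∃ r' : List Bool, r'.length = r.length ∧ (r'.foldl M.step ⟨some l, v, S⟩).l ≠ none) := by
  induction r generalizing l v S with
  | nil =>
    rw [show (∃ r' : List Bool, r'.length = ([] : List Bool).length ∧
      (r'.foldl M.step ⟨some l, v, S⟩).l ≠ none) = True by simp]
    refine tree_det (fun b => ?_) (tree_acc (w := mem v true bit)
      (S := both (store [] z s [] a fl [] [] []) S))
    simp [prog, mem]
  | cons x r ih =>
    rw [List.length_cons, exists_length_succ]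
    refine tree_guess (P := fun b => ∃ r' : List Bool, r'.length = r.length ∧
      ((b :: r').foldl M.step ⟨some l, v, S⟩).l ≠ none)
      (fun b => stepAux_sim (probe := true) l b x) (fun b => ?_)
      (t := t + (r.length + 1) + 1)
    simp only [if_true, List.foldl_cons]
    obtain ⟨l', v', S'⟩ := M.step ⟨some l, v, S⟩ b
    cases l' with
    | none =>
      rw [show (∃ r' : List Bool, r'.length = r.length ∧
        (r'.foldl M.step ⟨none, v', S'⟩).l ≠ none) = False by
          simp [foldl_of_halted (⟨none, v', S'⟩ : M.Cfg) rfl]]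
      exact tree_rej rfl
    | some l' => exact (ih l').mono (by omega)

end Verifier

/-! ### The language of the verifier -/

/-- The language of the queries that the verifier accepts. -/
def verifierLanguage (M : Machine) : Set (List Bool) :=
  {x | ∃ r : List Bool, r.length ≤ 20 * (x.length ^ 2 + 1) ∧ ((verifier M).run x r).l = none ∧
    (((verifier M).run x r).stk (verifier M).out).head? = some true}

theorem inNTIMESq_verifierLanguage (M : Machine) : InNTIMESq (verifierLanguage M) :=
  ⟨verifier M, 20, fun _ => Iff.rfl⟩

namespace Verifier

variable {M : Machine}

theorem start_verifier (x : List Bool) : (verifier M).start x =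
    (⟨some (.inl .parse), mem M.init false false, both (store x [] [] [] [] [] [] [] [])
      (Function.update (fun _ => []) M.inp [])⟩ : Conf M) := by
  have h : ∀ k, both (store [] [] [] [] [] [] [] [] []) (fun _ : M.K => []) k = [] := by
    rintro (k | k)
    · cases k <;> rfl
    · rfl
  have h' : (verifier M).start x = (⟨some (.inl .parse), mem M.init false false,
      Function.update (both (store [] [] [] [] [] [] [] [] []) (fun _ : M.K => [])) (.inl .qry)
        x⟩ : Conf M) := by
    rw [show both (store [] [] [] [] [] [] [] [] []) (fun _ : M.K => []) = fun _ => [] from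
      funext h]
    rfl
  rw [h', update_both_inl, update_qry, Function.update_eq_self]

/-- The tree decides membership once its depth, parsing included, fits into the time allowed by
`verifierLanguage`. -/
theorem mem_verifierLanguage_iff {its : List (Tag × Bool)} {P : Prop} {t : ℕ}
    (h : Tree t ⟨some (.inl .start), mem M.init false false,
      both (store [] (tagged .z its) (tagged .s its) (tagged .r its)
        (tagged .a its) (tagged .fl its) [] [] [])
        (Function.update (fun _ => []) M.inp (tagged .inp its))⟩ P)
    (ht : t + its.length + 1 ≤ 20 * ((4 * its.length) ^ 2 + 1)) :
    encodeItems its ∈ verifierLanguage M ↔ P := by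
  have key : Tree (20 * ((encodeItems its).length ^ 2 + 1))
      ((verifier M).start (encodeItems its)) P := by
    rw [start_verifier, length_encodeItems]
    exact (tree_parse its (by simpa using h)).mono ht
  exact key.exists_foldl fun c b => (verifier M).step_of_halted c b

/-- The only quadratic term comes from hashing. Every item takes four bits of the query, so `L`
items form a query of length `4 * L` and every tagged part has at most `L` bits. -/
theorem time_le {L m r z : ℕ} (hm : m ≤ L) (hr : r ≤ L) (hz : z ≤ L) :
    (0 + r + z + 3 + m * (2 * r + 3) + 1 + 1) + L + 1 ≤ 20 * ((4 * L) ^ 2 + 1) := by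
  have : m * (2 * r + 3) ≤ L * (2 * L + 3) := Nat.mul_le_mul hm (by omega)
  nlinarith [Nat.zero_le L, Nat.zero_le (L * L)]

/-- A query without flag asks whether some run of the sampler is longer than the coins. -/
theorem probe_mem_iff {its : List (Tag × Bool)} (hfl : tagged .fl its = [])
    (ha : (tagged .r its).length + (tagged .s its).length ≤ (tagged .a its).length) :
    encodeItems its ∈ verifierLanguage M ↔ ∃ r : List Bool, r.length = (tagged .r its).length ∧
      (M.run (tagged .inp its) r).l ≠ none := by
  refine mem_verifierLanguage_iff (t := 0 + (tagged .r its).length + (tagged .z its).length + 3 +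
    (tagged .s its).length * (2 * (tagged .r its).length + 3) + 1 + 1) ?_
    (time_le (length_tagged_le _ _) (length_tagged_le _ _) (length_tagged_le _ _))
  refine tree_det (c := ⟨some (.inl .hash), mem M.init true false, _⟩)
    (fun b => by simp [prog, mem, hfl]; rfl) ?_
  have h := tree_hash (M := M) (t := 0 + (tagged .r its).length + (tagged .z its).length + 3)
    (v := M.init) (probe := true) (tagged .s its) (z := tagged .z its) (fl := [])
    (S := Function.update (fun _ => []) M.inp (tagged .inp its)) ha
    (Q := fun i => ∃ r : List Bool, r.length = (toeplitz (tagged .r its) (tagged .a its) i).length ∧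
      (M.run (tagged .inp its) r).l ≠ none)
    (fun i hi a' => (tree_sim_probe (t := 0) _ M.main).mono (by
      rw [length_toeplitz _ _ _ (by omega)]; omega))
  convert h using 1
  -- A probe depends on the hashed coins only through their number, so any seed of the right length
  -- will do; `tagged .s its` is one.
  refine ⟨fun ⟨r, hr, h⟩ => ⟨tagged .s its, rfl, r, ?_, h⟩, fun ⟨i, hi, r, hr, h⟩ =>
    ⟨r, ?_, h⟩⟩
  · rwa [length_toeplitz _ _ _ ha]
  · rwa [length_toeplitz _ _ _ (by omega)] at hr

/-- A query with flag asks whether the sampler produces the output on some coins obtained from a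
seed. -/
theorem final_mem_iff {its : List (Tag × Bool)} (hfl : tagged .fl its ≠ [])
    (ha : (tagged .r its).length + (tagged .s its).length ≤ (tagged .a its).length) :
    encodeItems its ∈ verifierLanguage M ↔ ∃ i : List Bool, i.length = (tagged .s its).length ∧
      (M.run (tagged .inp its) (toeplitz (tagged .r its) (tagged .a its) i)).l = none ∧
      (M.run (tagged .inp its) (toeplitz (tagged .r its) (tagged .a its) i)).stk M.out =
        tagged .z its := by
  refine mem_verifierLanguage_iff (t := 0 + (tagged .r its).length + (tagged .z its).length + 3 +
    (tagged .s its).length * (2 * (tagged .r its).length + 3) + 1 + 1) ?_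
    (time_le (length_tagged_le _ _) (length_tagged_le _ _) (length_tagged_le _ _))
  obtain ⟨x, fl, hx⟩ := List.exists_cons_of_ne_nil hfl
  refine tree_det (c := ⟨some (.inl .hash), mem M.init false false, _⟩)
    (fun b => by simp [prog, mem, hx]; rfl) ?_
  refine tree_hash (M := M) (t := 0 + (tagged .r its).length + (tagged .z its).length + 3)
    (v := M.init) (probe := false) (tagged .s its) (z := tagged .z its) (fl := fl)
    (S := Function.update (fun _ => []) M.inp (tagged .inp its)) ha
    (fun i hi a' => (tree_sim (t := 0) _ M.main).mono (by
      rw [length_toeplitz _ _ _ (by omega)]))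

end Verifier

/-! ### Pairwise independence of Toeplitz hashing -/

/-- The inner product of two bit strings, up to the length of the shorter one. -/
def dotBits : List Bool → List Bool → Bool
  | g :: i, x :: a => xor (g && x) (dotBits i a)
  | _, _ => false

/-- The inner products of `i` with the first `l` shifts of `a`. -/
def convBits : ℕ → List Bool → List Bool → List Bool
  | 0, _, _ => []
  | l + 1, i, a => dotBits i a :: convBits l i a.tail

theorem length_convBits (l : ℕ) (i a : List Bool) : (convBits l i a).length = l := by
  induction l generalizing a with
  | zero => rfl
  | succ l ih => simp [convBits, ih]

theorem convBits_nil_left (l : ℕ) (a : List Bool) : convBits l [] a = List.replicate l false := by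
  induction l generalizing a with
  | zero => rfl
  | succ l ih => simp [convBits, ih, dotBits, List.replicate_succ]

theorem zipWith_xor_convBits_cons (r a i : List Bool) (g : Bool) (h : r.length ≤ a.length) :
    List.zipWith xor (List.zipWith (fun x y => xor x (g && y)) r a)
      (convBits r.length i a.tail) = List.zipWith xor r (convBits r.length (g :: i) a) := by
  induction r generalizing a with
  | nil => rfl
  | cons x r ih =>
    obtain _ | ⟨y, a⟩ := a
    · simp at h
    simp only [List.length_cons, convBits, List.zipWith_cons_cons, List.tail_cons, dotBits]
    rw [ih a (by simpa using h), Bool.xor_assoc]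

theorem zipWith_xor_replicate_false (r : List Bool) :
    List.zipWith xor r (List.replicate r.length false) = r := by
  induction r with
  | nil => rfl
  | cons x r ih => simp [List.replicate_succ, ih]

/-- The verifier adds the matrix column by column; computed by rows, the same product consists of
inner products of the seed with shifts of `a`, which are visibly linear in the seed. -/
theorem toeplitz_eq (r a i : List Bool) (h : r.length + i.length ≤ a.length) :
    toeplitz r a i = List.zipWith xor r (convBits r.length i a) := by
  induction i generalizing r a with
  | nil => rw [toeplitz, convBits_nil_left, zipWith_xor_replicate_false]
  | cons g i ih =>
    simp only [List.length_cons] at h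
    have hz : (List.zipWith (fun x y => xor x (g && y)) r a).length = r.length := by simp; omega
    rw [toeplitz, ih _ _ (by rw [hz]; simp; omega), hz,
      zipWith_xor_convBits_cons _ _ _ _ (by omega)]

theorem dotBits_zipWith_xor (i i' a : List Bool) (h : i.length = i'.length) :
    dotBits (List.zipWith xor i i') a = xor (dotBits i a) (dotBits i' a) := by
  induction i generalizing i' a with
  | nil => obtain rfl := List.length_eq_zero_iff.1 h.symm; rfl
  | cons g i ih =>
    obtain _ | ⟨g', i'⟩ := i'
    · simp at h
    obtain _ | ⟨x, a⟩ := a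
    · rfl
    simp only [List.zipWith_cons_cons, dotBits, ih i' a (by simpa using h)]
    cases g <;> cases g' <;> cases x <;> simp

theorem convBits_zipWith_xor (l : ℕ) (i i' a : List Bool) (h : i.length = i'.length) :
    convBits l (List.zipWith xor i i') a =
      List.zipWith xor (convBits l i a) (convBits l i' a) := by
  induction l generalizing a with
  | zero => rfl
  | succ l ih => simp [convBits, ih, dotBits_zipWith_xor _ _ _ h]

theorem avg_zipWith_xor (n : ℕ) (c : List Bool) (hc : c.length = n) (F : List Bool → ℝ) :
    avg n (fun r => F (List.zipWith xor r c)) = avg n F := by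
  induction n generalizing c F with
  | zero => obtain rfl := List.length_eq_zero_iff.1 hc; rfl
  | succ n ih =>
    obtain _ | ⟨x, c⟩ := c
    · simp at hc
    have hc' : c.length = n := by simpa using hc
    simp only [avg, List.zipWith_cons_cons]
    rw [ih c hc' (fun l => F (xor false x :: l)), ih c hc' (fun l => F (xor true x :: l))]
    cases x
    · simp
    · simp [mean, add_comm]

theorem zipWith_xor_zipWith_xor (r c c' : List Bool) (h : r.length = c.length)
    (h' : r.length = c'.length) :
    List.zipWith xor (List.zipWith xor r c) (List.zipWith xor c c') = List.zipWith xor r c' := by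
  induction r generalizing c c' with
  | nil => simp
  | cons x r ih =>
    obtain _ | ⟨y, c⟩ := c
    · simp at h
    obtain _ | ⟨z, c'⟩ := c'
    · simp at h'
    simp only [List.zipWith_cons_cons, ih c c' (by simpa using h) (by simpa using h')]
    cases x <;> cases y <;> simp

theorem dotBits_replicate_false (m : ℕ) (a : List Bool) :
    dotBits (List.replicate m false) a = false := by
  induction m generalizing a with
  | zero => rfl
  | succ m ih => cases a <;> simp [List.replicate_succ, dotBits, ih]

theorem dotBits_append (u d w a : List Bool) (h : u.length = w.length) :
    dotBits (u ++ d) (w ++ a) = xor (dotBits u w) (dotBits d a) := by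
  induction u generalizing w with
  | nil => obtain rfl := List.length_eq_zero_iff.1 h.symm; simp [dotBits]
  | cons x u ih =>
    obtain _ | ⟨y, w⟩ := w
    · simp at h
    simp only [List.cons_append, dotBits, ih w (by simpa using h), Bool.xor_assoc]

/-- The last nonzero entry of the left factor meets a fresh bit of `a` in each successive inner
product. Given the bits read before, every inner product is therefore uniform. -/
theorem avg_convBits_window (l q m : ℕ) (u w : List Bool) (h : u.length = w.length)
    (F : List Bool → ℝ) :
    avg (l + q) (fun a => F (convBits l (u ++ true :: List.replicate m false) (w ++ a))) =
      avg l F := by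
  induction l generalizing w F with
  | zero => simp [convBits, avg, avg_const]
  | succ l ih =>
    have hdot : ∀ x a, dotBits (u ++ true :: List.replicate m false) (w ++ x :: a) =
        xor (dotBits u w) x := fun x a => by
      rw [dotBits_append _ _ _ _ h, dotBits, dotBits_replicate_false]; simp
    have htail : ∀ x a, (w ++ x :: a).tail = (w ++ [x]).tail ++ a := fun x a => by
      cases w <;> simp
    have hstep : ∀ x, (avg (l + q) fun a =>
        F (convBits (l + 1) (u ++ true :: List.replicate m false) (w ++ x :: a))) =
        avg (l + q) fun a => F (xor (dotBits u w) x ::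
          convBits l (u ++ true :: List.replicate m false) ((w ++ [x]).tail ++ a)) := fun x =>
      avg_congr fun a _ => by rw [convBits, hdot, htail]
    rw [Nat.succ_add, avg, avg, hstep, hstep]
    have hlen : ∀ x, u.length = (w ++ [x]).tail.length := fun x => by simp [h]
    rw [ih _ (hlen _) (fun c => F (xor (dotBits u w) false :: c)),
      ih _ (hlen _) (fun c => F (xor (dotBits u w) true :: c))]
    cases dotBits u w
    · simp
    · simp [mean, add_comm]

theorem exists_last_true {d : List Bool} (h : true ∈ d) :
    ∃ u m, d = u ++ true :: List.replicate m false := by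
  induction d with
  | nil => simp at h
  | cons x d ih =>
    by_cases hd : true ∈ d
    · obtain ⟨u, m, rfl⟩ := ih hd
      exact ⟨x :: u, m, rfl⟩
    · have hx : x = true := by simpa [hd] using h
      refine ⟨[], d.length, ?_⟩
      rw [hx, List.nil_append, List.cons.injEq, List.eq_replicate_iff]
      refine ⟨rfl, rfl, fun b hb => ?_⟩
      by_contra hb'
      rw [Bool.not_eq_false] at hb'
      exact hd (hb' ▸ hb)

/-- The bits of `a` that precede the partner of the last nonzero entry of `d` are fixed; the next
`l` bits then make the `l` inner products uniform and independent. -/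
theorem avg_convBits {l n : ℕ} {d : List Bool} (hd : true ∈ d) (hn : d.length ≤ n)
    (F : List Bool → ℝ) : avg (n + l) (fun a => F (convBits l d a)) = avg l F := by
  obtain ⟨u, m, rfl⟩ := exists_last_true hd
  have hu : u.length ≤ n := by simp at hn; omega
  rw [show n + l = u.length + (l + (n - u.length)) by omega, avg_append]
  rw [avg_congr (fun w hw => avg_convBits_window l (n - u.length) m u w hw.symm F), avg_const]

theorem true_mem_zipWith_xor {i i' : List Bool} (h : i.length = i'.length) (hne : i ≠ i') :
    true ∈ List.zipWith xor i i' := by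
  induction i generalizing i' with
  | nil => exact absurd (List.length_eq_zero_iff.1 h.symm).symm hne
  | cons x i ih =>
    obtain _ | ⟨y, i'⟩ := i'
    · simp at h
    by_cases hxy : x = y
    · subst hxy
      simp [ih (i' := i') (by simpa using h) (by simpa using hne)]
    · cases x <;> cases y <;> simp at hxy ⊢

/-- The translation `r` alone makes the hash value of a single seed uniform. -/
theorem avg_toeplitz {l n s : ℕ} (hs : s ≤ n) {i : List Bool} (hi : i.length = s)
    (F : List Bool → ℝ) :
    (avg l fun r => avg (n + l) fun a => F (toeplitz r a i)) = avg l F := by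
  rw [avg_comm, avg_congr (G := fun _ => avg l F), avg_const]
  intro a ha
  rw [avg_congr (G := fun r => F (List.zipWith xor r (convBits l i a))),
    avg_zipWith_xor _ _ (length_convBits _ _ _)]
  intro r hr
  rw [toeplitz_eq _ _ _ (by omega), hr]

/-- After translation of `r` by the image of `i`, the two hash values are `r` and `r` plus the image
of `i + i'`. As `i + i'` is nonzero, the second summand is uniform for each fixed `r`. -/
theorem avg_toeplitz_mul {l n s : ℕ} (hs : s ≤ n) {i i' : List Bool} (hi : i.length = s)
    (hi' : i'.length = s) (hne : i ≠ i') (F G : List Bool → ℝ) :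
    (avg l fun r => avg (n + l) fun a => F (toeplitz r a i) * G (toeplitz r a i')) =
      avg l F * avg l G := by
  have h1 : (avg l fun r => avg (n + l) fun a => F (toeplitz r a i) * G (toeplitz r a i')) =
      avg (n + l) fun a => avg l fun r =>
        F r * G (List.zipWith xor r (convBits l (List.zipWith xor i i') a)) := by
    rw [avg_comm]
    refine avg_congr fun a ha => ?_
    rw [← avg_zipWith_xor l (convBits l i a) (length_convBits _ _ _)
      (fun r => F r * G (List.zipWith xor r (convBits l (List.zipWith xor i i') a)))]
    refine avg_congr fun r hr => ?_
    rw [toeplitz_eq _ _ _ (by omega), toeplitz_eq _ _ _ (by omega), hr,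
      convBits_zipWith_xor _ _ _ _ (hi.trans hi'.symm), zipWith_xor_zipWith_xor]
    · rw [length_convBits, hr]
    · rw [length_convBits, hr]
  rw [h1, avg_comm, ← avg_mul_const]
  refine avg_congr fun r hr => ?_
  rw [avg_const_mul, avg_convBits (true_mem_zipWith_xor (hi.trans hi'.symm) hne)
    (by simp; omega) (fun c => G (List.zipWith xor r c))]
  congr 1
  rw [← avg_zipWith_xor l r hr G]
  refine avg_congr fun c _ => ?_
  congr 1
  exact List.zipWith_comm_of_comm Bool.xor_comm

/-! ### Second moment bounds for hashed seeds -/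

theorem avg_ite_eq (n : ℕ) (i : List Bool) (hi : i.length = n) :
    avg n (fun j => if i = j then 1 else 0) = ((2 : ℝ) ^ n)⁻¹ := by
  induction n generalizing i with
  | zero => obtain rfl := List.length_eq_zero_iff.1 hi; simp [avg]
  | succ n ih =>
    obtain _ | ⟨x, i⟩ := i
    · simp at hi
    have hi' : i.length = n := by simpa using hi
    have h0 : avg n (fun _ => (0 : ℝ)) = 0 := avg_const n 0
    cases x
    · simp only [avg, List.cons.injEq, true_and, reduceCtorEq, false_and, if_false, ih i hi', h0,
        mean]
      field_simp
      simp [pow_succ]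
    · simp only [avg, List.cons.injEq, true_and, reduceCtorEq, false_and, if_false, ih i hi', h0,
        mean]
      field_simp
      simp [pow_succ]

theorem le_two_pow_mul_avg {n : ℕ} {F : List Bool → ℝ} (hF : ∀ l, 0 ≤ F l) {i : List Bool}
    (hi : i.length = n) : F i ≤ 2 ^ n * avg n F := by
  subst hi
  rw [avg_eq_sum, mul_div_cancel₀ _ (by positivity)]
  have := Finset.single_le_sum (f := fun r : Fin i.length → Bool => F (List.ofFn r))
    (fun r _ => hF _) (Finset.mem_univ i.get)
  simpa [List.ofFn_get] using this

open Classical in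
/-- The probability that the hashed seeds of length `s` meet a set of strings of length `l`. -/
noncomputable def hitProb (S : List Bool → Prop) (s n l : ℕ) : ℝ :=
  avg l fun r => avg (n + l) fun a =>
    if ∃ i : List Bool, i.length = s ∧ S (toeplitz r a i) then 1 else 0

-- Let `Z` be the fraction of seeds that are hashed into the set. The upper bound is the union
-- bound. For the lower bound, the indicator of `Z > 0` is at least `2 λ Z - λ² Z²` for every `λ`,
-- and pairwise independence gives the second moment of `Z`.
open Classical in
theorem hitProb_bounds (S : List Bool → Prop) {s n : ℕ} (hs : s ≤ n) (l : ℕ) {μ : ℝ}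
    (hμ : μ = 2 ^ s * avg l fun r => if S r then 1 else 0) :
    hitProb S s n l ≤ μ ∧ μ / (1 + μ) ≤ hitProb S s n l := by
  set χ : List Bool → ℝ := fun r => if S r then 1 else 0 with hχ
  have hχ0 : ∀ r, 0 ≤ χ r := fun r => by simp only [hχ]; split_ifs <;> norm_num
  have hχχ : ∀ r, χ r * χ r = χ r := fun r => by simp only [hχ]; split_ifs <;> norm_num
  set q := avg l χ with hq
  have hq0 : 0 ≤ q := by
    rw [← avg_const l 0]; exact avg_mono fun r _ => hχ0 r
  set Z : List Bool → List Bool → ℝ := fun r a => avg s fun i => χ (toeplitz r a i) with hZ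
  set I : List Bool → List Bool → ℝ := fun r a =>
    if ∃ i : List Bool, i.length = s ∧ S (toeplitz r a i) then 1 else 0 with hI
  have hZ1 : (avg l fun r => avg (n + l) fun a => Z r a) = q := by
    simp only [hZ]
    have : (avg l fun r => avg (n + l) fun a => avg s fun i => χ (toeplitz r a i)) =
        avg s fun i => avg l fun r => avg (n + l) fun a => χ (toeplitz r a i) := by
      rw [avg_comm s l]
      exact avg_congr fun r _ => avg_comm _ _ _
    rw [this, avg_congr fun i hi => avg_toeplitz hs hi χ, avg_const]
  have hZ2 : (avg l fun r => avg (n + l) fun a => Z r a * Z r a) =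
      q * q + (2 ^ s)⁻¹ * (q - q * q) := by
    have h1 : ∀ r a, Z r a * Z r a =
        avg s fun i => avg s fun i' => χ (toeplitz r a i) * χ (toeplitz r a i') := fun r a => by
      simp only [hZ, avg_const_mul, avg_mul_const]
    have h2 : (avg l fun r => avg (n + l) fun a => Z r a * Z r a) =
        avg s fun i => avg s fun i' => avg l fun r => avg (n + l) fun a =>
          χ (toeplitz r a i) * χ (toeplitz r a i') := by
      simp only [h1]
      rw [avg_congr fun r _ => avg_comm (n + l) s _, avg_comm l s]
      refine avg_congr fun i _ => ?_
      rw [avg_congr fun r _ => avg_comm (n + l) s _, avg_comm l s]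
    rw [h2, avg_congr (G := fun _ => q * q + (2 ^ s)⁻¹ * (q - q * q)), avg_const]
    intro i hi
    -- Distinct seeds contribute `q * q`; the diagonal, of density `2 ^ (-s)`, contributes `q`.
    rw [avg_congr (G := fun i' => q * q + (if i = i' then 1 else 0) * (q - q * q)), avg_add,
      avg_const, avg_mul_const, avg_ite_eq s i hi]
    intro i' hi'
    by_cases h : i = i'
    · subst h
      simp only [hχχ, if_true]
      rw [avg_toeplitz hs hi χ]
      ring
    · rw [avg_toeplitz_mul hs hi hi' h χ χ, if_neg h]
      ring
  have hle : ∀ r a, I r a ≤ 2 ^ s * Z r a := fun r a => by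
    simp only [hI]
    split_ifs with h
    · obtain ⟨i, hi, hS⟩ := h
      have := le_two_pow_mul_avg (F := fun i => χ (toeplitz r a i)) (fun _ => hχ0 _) hi
      simpa only [hχ, if_pos hS] using this
    · have : 0 ≤ Z r a := by
        rw [← avg_const s 0]; exact avg_mono fun _ _ => hχ0 _
      positivity
  have hge : ∀ (lam : ℝ) r a, 2 * lam * Z r a - lam ^ 2 * (Z r a * Z r a) ≤ I r a :=
    fun lam r a => by
    simp only [hI]
    split_ifs with h
    · nlinarith [sq_nonneg (1 - lam * Z r a)]
    · have : Z r a = 0 := by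
        rw [← avg_const s 0]
        refine avg_congr fun i hi => ?_
        simp only [hχ]
        rw [if_neg fun hS => h ⟨i, hi, hS⟩]
      rw [this]; simp
  have hμ0 : 0 ≤ μ := by rw [hμ]; positivity
  constructor
  · calc hitProb S s n l ≤ avg l fun r => avg (n + l) fun a => 2 ^ s * Z r a :=
        avg_mono fun r _ => avg_mono fun a _ => hle r a
      _ = μ := by simp only [avg_const_mul, hZ1, hμ]
  -- The maximiser of `2 λ q - λ² (q² + 2 ^ (-s) q)` for `q > 0`; the maximum is `μ / (1 + μ)`.
  · set lam : ℝ := 2 ^ s / (1 + μ) with hlam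
    calc μ / (1 + μ) ≤ 2 * lam * q - lam ^ 2 * (q * q + (2 ^ s)⁻¹ * (q - q * q)) := by
          have h1 : lam ^ 2 * (q * q + (2 ^ s)⁻¹ * (q - q * q)) ≤
              lam ^ 2 * (q * q + (2 ^ s)⁻¹ * q) := by
            gcongr
            nlinarith
          have h2 : 2 * lam * q - lam ^ 2 * (q * q + (2 ^ s)⁻¹ * q) = μ / (1 + μ) := by
            rw [hlam, hμ]
            have : (1 : ℝ) + 2 ^ s * q ≠ 0 := by positivity
            field_simp
            ring
          linarith
      _ = avg l fun r => avg (n + l) fun a =>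
          2 * lam * Z r a - lam ^ 2 * (Z r a * Z r a) := by
        simp only [avg_sub, avg_const_mul, hZ1, hZ2]
      _ ≤ hitProb S s n l := avg_mono fun r _ => avg_mono fun a _ => hge lam r a

/-! ### Output probabilities and gaps -/

/-- The sign `(-1)^a`. -/
def sgn (a : ZMod 2) : ℝ := (-1) ^ a.val

theorem zmod_two_eq (a : ZMod 2) : a = 0 ∨ a = 1 := by revert a; decide

theorem sgn_zero : sgn 0 = 1 := by simp [sgn]

theorem sgn_one : sgn 1 = -1 := by simp [sgn, ZMod.val_one]

theorem sgn_add (a b : ZMod 2) : sgn (a + b) = sgn a * sgn b := by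
  have h : (1 + 1 : ZMod 2) = 0 := rfl
  rcases zmod_two_eq a with rfl | rfl <;> rcases zmod_two_eq b with rfl | rfl <;>
    simp [sgn_zero, sgn_one, h]

theorem abs_sgn (a : ZMod 2) : |sgn a| = 1 := by
  rcases zmod_two_eq a with rfl | rfl <;> simp [sgn_zero, sgn_one]

theorem sgn_sum {ι : Type*} (s : Finset ι) (f : ι → ZMod 2) :
    sgn (∑ i ∈ s, f i) = ∏ i ∈ s, sgn (f i) := by
  classical
  induction s using Finset.induction_on with
  | empty => simp [sgn_zero]
  | insert a s ha ih => rw [Finset.sum_insert ha, sgn_add, ih, Finset.prod_insert ha]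

theorem nodup_pairList (n : ℕ) : (pairList n).Nodup := by
  rw [pairList, List.nodup_flatMap]
  refine ⟨fun i _ => List.Nodup.filterMap ?_ (List.nodup_finRange n), ?_⟩
  · intro a a' b hb hb'
    simp only [Option.mem_def, Option.dite_none_right_eq_some, Option.some.injEq] at hb hb'
    obtain ⟨_, rfl⟩ := hb
    obtain ⟨_, h⟩ := hb'
    simpa using (congrArg (fun p : Pairs n => p.1.2) h).symm
  · refine (List.nodup_finRange n).imp fun {i i'} hne => ?_
    rw [Function.onFun, List.disjoint_left]
    intro p hp hp'
    simp only [List.mem_filterMap, Option.dite_none_right_eq_some, Option.some.injEq] at hp hp'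
    obtain ⟨j, _, _, rfl⟩ := hp
    obtain ⟨j', _, _, h⟩ := hp'
    exact hne (by simpa using (congrArg (fun p : Pairs n => p.1.1) h).symm)

theorem mem_pairList {n : ℕ} (p : Pairs n) : p ∈ pairList n := by
  obtain ⟨⟨i, j⟩, h⟩ := p
  simp only [pairList, List.mem_flatMap, List.mem_finRange, true_and, List.mem_filterMap]
  exact ⟨i, j, by simp at h; simp [h]⟩

theorem nodup_tripleList (n : ℕ) : (tripleList n).Nodup := by
  rw [tripleList, List.nodup_flatMap]
  refine ⟨fun i _ => ?_, ?_⟩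
  · rw [List.nodup_flatMap]
    refine ⟨fun j _ => List.Nodup.filterMap ?_ (List.nodup_finRange n), ?_⟩
    · intro a a' b hb hb'
      simp only [Option.mem_def, Option.dite_none_right_eq_some, Option.some.injEq] at hb hb'
      obtain ⟨_, rfl⟩ := hb
      obtain ⟨_, h⟩ := hb'
      simpa using (congrArg (fun p : Triples n => p.1.2.2) h).symm
    · refine (List.nodup_finRange n).imp fun {j j'} hne => ?_
      rw [Function.onFun, List.disjoint_left]
      intro p hp hp'
      simp only [List.mem_filterMap, Option.dite_none_right_eq_some, Option.some.injEq] at hp hp'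
      obtain ⟨k, _, _, rfl⟩ := hp
      obtain ⟨k', _, _, h⟩ := hp'
      exact hne (by simpa using (congrArg (fun p : Triples n => p.1.2.1) h).symm)
  · refine (List.nodup_finRange n).imp fun {i i'} hne => ?_
    rw [Function.onFun, List.disjoint_left]
    intro p hp hp'
    simp only [List.mem_flatMap, List.mem_filterMap, Option.dite_none_right_eq_some,
      Option.some.injEq] at hp hp'
    obtain ⟨j, _, k, _, _, rfl⟩ := hp
    obtain ⟨j', _, k', _, _, h⟩ := hp'
    exact hne (by simpa using (congrArg (fun p : Triples n => p.1.1) h).symm)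

theorem mem_tripleList {n : ℕ} (p : Triples n) : p ∈ tripleList n := by
  obtain ⟨⟨i, j, k⟩, h⟩ := p
  simp only [tripleList, List.mem_flatMap, List.mem_finRange, true_and, List.mem_filterMap]
  exact ⟨i, j, k, by simp at h; simp [h]⟩

theorem length_pairList_le (n : ℕ) : (pairList n).length ≤ n * n := by
  calc (pairList n).length ≤ Fintype.card (Pairs n) := (nodup_pairList n).length_le_card
    _ ≤ Fintype.card (Fin n × Fin n) := Fintype.card_subtype_le _
    _ = n * n := by simp

theorem length_tripleList_le (n : ℕ) : (tripleList n).length ≤ n * (n * n) := by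
  calc (tripleList n).length ≤ Fintype.card (Triples n) := (nodup_tripleList n).length_le_card
    _ ≤ Fintype.card (Fin n × Fin n × Fin n) := Fintype.card_subtype_le _
    _ = n * (n * n) := by simp

theorem prod_map_eq {ι R : Type*} [Fintype ι] [CommMonoid R] {l : List ι} (hl : l.Nodup)
    (hm : ∀ i, i ∈ l) (f : ι → R) : (l.map f).prod = ∏ i, f i := by
  classical
  rw [← List.prod_toFinset f hl]
  congr 1
  ext i
  simp [hm i]

theorem prod_map_diagonal {ι m : Type*} [Fintype m] [DecidableEq m] (l : List ι)
    (d : ι → m → ℂ) :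
    (l.map fun i => Matrix.diagonal (d i)).prod =
      Matrix.diagonal fun x => (l.map fun i => d i x).prod := by
  induction l with
  | nil => simp
  | cons i l ih => simp [ih]

namespace Poly3

variable {n : ℕ}

/-- The circuit with the gates given by the coefficients of `f`. -/
def circuit (f : Poly3 n) : IQPCircuit n :=
  ⟨fun i => decide (f.1 i = 1), fun p => decide (f.2.1 p = 1), fun t => decide (f.2.2 t = 1)⟩

/-- The polynomial `f` plus the linear form with the coefficients `z`. -/
def shift (f : Poly3 n) (z : Bits n) : Poly3 n := (f.1 + z, f.2)

theorem eval_shift (f : Poly3 n) (z x : Bits n) :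
    (f.shift z).eval x = f.eval x + ∑ i, z i * x i := by
  simp only [eval, shift, Pi.add_apply, add_mul, Finset.sum_add_distrib]
  ring

theorem shift_shift (f : Poly3 n) (z : Bits n) : (f.shift z).shift z = f := by
  have : z + z = 0 := by
    funext i
    exact CharTwo.add_self_eq_zero (z i)
  simp [shift, add_assoc, this]

theorem gap_eq (f : Poly3 n) : (f.gap : ℝ) = ∑ x, sgn (f.eval x) := by
  simp [gap, sgn]

theorem diagonalPart_circuit (f : Poly3 n) :
    f.circuit.diagonalPart = Matrix.diagonal fun x => ((sgn (f.eval x) : ℝ) : ℂ) := by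
  have h1 : ∀ i : Fin n, (if f.circuit.z i then gateZ i else 1 : QMatrix n) =
      Matrix.diagonal fun x => ((sgn (f.1 i * x i) : ℝ) : ℂ) := fun i => by
    rw [← Matrix.diagonal_one]
    simp only [circuit, gateZ, decide_eq_true_eq]
    rcases zmod_two_eq (f.1 i) with h | h
    · simp [h, sgn_zero]
    · simp only [h, if_true]
      congr 1
      funext x
      rcases zmod_two_eq (x i) with h | h <;> simp [h, sgn_zero, sgn_one]
  have h2 : ∀ p : Pairs n, (if f.circuit.cz p then gateCZ p.1.1 p.1.2 else 1 : QMatrix n) =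
      Matrix.diagonal fun x => ((sgn (f.2.1 p * x p.1.1 * x p.1.2) : ℝ) : ℂ) := fun p => by
    rw [← Matrix.diagonal_one]
    simp only [circuit, gateCZ, decide_eq_true_eq]
    rcases zmod_two_eq (f.2.1 p) with h | h
    · simp [h, sgn_zero]
    · simp only [h, if_true]
      congr 1
      funext x
      rcases zmod_two_eq (x p.1.1) with h | h <;> rcases zmod_two_eq (x p.1.2) with h' | h' <;>
        simp [h, h', sgn_zero, sgn_one]
  have h3 : ∀ t : Triples n,
      (if f.circuit.ccz t then gateCCZ t.1.1 t.1.2.1 t.1.2.2 else 1 : QMatrix n) =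
      Matrix.diagonal fun x => ((sgn (f.2.2 t * x t.1.1 * x t.1.2.1 * x t.1.2.2) : ℝ) : ℂ) :=
    fun t => by
    rw [← Matrix.diagonal_one]
    simp only [circuit, gateCCZ, decide_eq_true_eq]
    rcases zmod_two_eq (f.2.2 t) with h | h
    · simp [h, sgn_zero]
    · simp only [h, if_true]
      congr 1
      funext x
      rcases zmod_two_eq (x t.1.1) with h | h <;> rcases zmod_two_eq (x t.1.2.1) with h' | h' <;>
        rcases zmod_two_eq (x t.1.2.2) with h'' | h'' <;>
        simp [h, h', h'', sgn_zero, sgn_one]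
  rw [IQPCircuit.diagonalPart]
  simp only [h1, h2, h3, prod_map_diagonal, Matrix.diagonal_mul_diagonal]
  congr 1
  funext x
  rw [prod_map_eq (List.nodup_finRange n) List.mem_finRange,
    prod_map_eq (nodup_pairList n) mem_pairList, prod_map_eq (nodup_tripleList n) mem_tripleList,
    eval, sgn_add, sgn_add, sgn_sum, sgn_sum, sgn_sum]
  push_cast
  rfl

theorem hadamardAll_apply (z x : Bits n) :
    hadamardAll n z x = ((sgn (∑ i, z i * x i) / Real.sqrt 2 ^ n : ℝ) : ℂ) := by
  have h : ∀ a b : ZMod 2, hadamard a b = ((sgn (a * b) / Real.sqrt 2 : ℝ) : ℂ) := fun a b => by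
    rcases zmod_two_eq a with rfl | rfl <;> rcases zmod_two_eq b with rfl | rfl <;>
      simp [hadamard, sgn_zero, sgn_one]
  simp only [hadamardAll, Matrix.of_apply, h]
  rw [sgn_sum, ← Complex.ofReal_prod, Finset.prod_div_distrib]
  simp

/-- The first Hadamard layer makes a uniform superposition, and the second contributes the character
of `z`, which is absorbed as a linear form: the amplitude is a normalised gap. -/
theorem outputProb_circuit (f : Poly3 n) (z : Bits n) :
    f.circuit.outputProb z = ((f.shift z).gap : ℝ) ^ 2 / 4 ^ n := by
  have h : (f.circuit.unitary.mulVec (Pi.single 0 1)) z =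
      (((f.shift z).gap / 2 ^ n : ℝ) : ℂ) := by
    rw [Matrix.mulVec_single_one, Matrix.col_apply, IQPCircuit.unitary, diagonalPart_circuit,
      Matrix.mul_apply]
    simp only [Matrix.mul_diagonal, hadamardAll_apply]
    rw [gap_eq, Finset.sum_div]
    push_cast
    refine Finset.sum_congr rfl fun x _ => ?_
    have hs : ((Real.sqrt 2 : ℝ) : ℂ) ^ n * ((Real.sqrt 2 : ℝ) : ℂ) ^ n = 2 ^ n := by
      rw [← mul_pow, ← Complex.ofReal_mul, Real.mul_self_sqrt (by norm_num)]
      norm_num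
    rw [eval_shift, sgn_add]
    simp only [Pi.zero_apply, mul_zero, Finset.sum_const_zero, sgn_zero]
    push_cast
    rw [← hs]
    have h0 : ((Real.sqrt 2 : ℝ) : ℂ) ≠ 0 := by
      rw [Complex.ofReal_ne_zero]; positivity
    field_simp
  rw [IQPCircuit.outputProb, h, Complex.norm_real, Real.norm_eq_abs, sq_abs, div_pow, ← pow_mul,
    mul_comm n 2, pow_mul]
  norm_num

/-! ### Moments of the gap -/

theorem eval_add (f g : Poly3 n) (x : Bits n) : (f + g).eval x = f.eval x + g.eval x := by
  simp only [eval, Prod.fst_add, Prod.snd_add, Pi.add_apply, add_mul, Finset.sum_add_distrib]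
  ring

/-- The monomial `xᵢ`. -/
def linear (i : Fin n) : Poly3 n := (Pi.single i 1, 0, 0)

/-- The monomial `xᵢ xⱼ`. -/
def quadratic (p : Pairs n) : Poly3 n := (0, Pi.single p 1, 0)

theorem eval_linear (i : Fin n) (x : Bits n) : (linear i).eval x = x i := by
  simp [eval, linear, Pi.single_apply]

theorem eval_quadratic (p : Pairs n) (x : Bits n) :
    (quadratic p).eval x = x p.1.1 * x p.1.2 := by
  simp [eval, quadratic, Pi.single_apply]

/-- Translation by `d` reverses the sign of every term. -/
theorem sum_sgn_eq_zero {L : Poly3 n → ZMod 2} (hL : ∀ f g, L (f + g) = L f + L g) (d : Poly3 n)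
    (hd : L d = 1) : ∑ f, sgn (L f) = 0 := by
  have h : ∑ f, sgn (L f) = ∑ f, sgn (L (f + d)) :=
    (Equiv.sum_comp (Equiv.addRight d) fun f => sgn (L f)).symm
  simp only [hL, hd, sgn_add, sgn_one, mul_neg, mul_one, Finset.sum_neg_distrib] at h
  linarith

/-- In the expanded square, a pair `x ≠ y` cancels because of the random linear coefficient at a
coordinate where they differ. -/
theorem sum_gap_sq : ∑ f : Poly3 n, (f.gap : ℝ) ^ 2 = 2 ^ n * Fintype.card (Poly3 n) := by
  have h1 : ∀ f : Poly3 n, (f.gap : ℝ) ^ 2 = ∑ x, ∑ y, sgn (f.eval x + f.eval y) := fun f => by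
    rw [gap_eq, sq, Finset.sum_mul_sum]
    simp only [sgn_add]
  have h2 : ∀ x y : Bits n, ∑ f : Poly3 n, sgn (f.eval x + f.eval y) =
      if x = y then (Fintype.card (Poly3 n) : ℝ) else 0 := fun x y => by
    split_ifs with h
    · subst h
      simp [CharTwo.add_self_eq_zero, sgn_zero]
    · obtain ⟨i, hi⟩ := Function.ne_iff.1 h
      refine sum_sgn_eq_zero (L := fun f => f.eval x + f.eval y)
        (fun f g => by simp only [eval_add]; ring) (linear i) ?_
      simp only [eval_linear]
      rcases zmod_two_eq (x i) with h | h <;> rcases zmod_two_eq (y i) with h' | h' <;>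
        simp [h, h'] at hi ⊢
  simp only [h1]
  rw [Finset.sum_comm]
  simp_rw [Finset.sum_comm (s := (Finset.univ : Finset (Poly3 n))), h2]
  simp [ZMod.card]

/-- By the hypotheses, all `2 × 2` minors of the pair of vectors `x + y`, `x + z` vanish. Two
dependent vectors over `𝔽₂` include a zero vector or are equal, which gives the three pairings. -/
theorem paired_of_forall {x y z w : Bits n} (h1 : ∀ i, x i + y i + z i + w i = 0)
    (h2 : ∀ i j : Fin n, j < i → x i * x j + y i * y j + z i * z j + w i * w j = 0) :
    (x = y ∧ z = w) ∨ (x = z ∧ y = w) ∨ (x = w ∧ y = z) := by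
  -- Substituting `d = a + b + c` turns the quadratic condition into the vanishing of a minor.
  have key : ∀ a b c d a' b' c' d' : ZMod 2, a + b + c + d = 0 → a' + b' + c' + d' = 0 →
      a * a' + b * b' + c * c' + d * d' = 0 → (a + b) * (a' + c') = (a' + b') * (a + c) := by
    decide
  have h3 : ∀ i j, (x i + y i) * (x j + z j) = (x j + y j) * (x i + z i) := fun i j => by
    rcases lt_trichotomy i j with h | rfl | h
    · exact (key _ _ _ _ _ _ _ _ (h1 j) (h1 i) (h2 j i h)).symm
    · rfl
    · exact key _ _ _ _ _ _ _ _ (h1 i) (h1 j) (h2 i j h)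
  have e2 : ∀ a b : ZMod 2, a + b = 0 ↔ a = b := by decide
  have e3 : ∀ a b c d : ZMod 2, a + b + c + d = 0 → a = b → c = d := by decide
  have e4 : ∀ a b c d : ZMod 2, a + b + c + d = 0 → a = c → b = d := by decide
  have e5 : ∀ a b c d : ZMod 2, a + b + c + d = 0 → b = c → a = d := by decide
  by_cases hxy : x = y
  · subst hxy
    exact .inl ⟨rfl, funext fun i => e3 _ _ _ _ (h1 i) rfl⟩
  by_cases hxz : x = z
  · subst hxz
    exact .inr (.inl ⟨rfl, funext fun i => e4 _ _ _ _ (h1 i) rfl⟩)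
  have hyz : y = z := by
    obtain ⟨i, hi⟩ := Function.ne_iff.1 hxy
    obtain ⟨j, hj⟩ := Function.ne_iff.1 hxz
    have hone : ∀ a b : ZMod 2, a ≠ b → a + b = 1 := by decide
    have h := h3 i j
    rw [hone _ _ hi, hone _ _ hj] at h
    have hmul : ∀ a b : ZMod 2, 1 * 1 = a * b → b = 1 := by decide
    have hiz := hmul _ _ h
    funext k
    have hk := h3 i k
    rw [hone _ _ hi, hiz] at hk
    have hc : ∀ a b c : ZMod 2, 1 * (a + c) = (a + b) * 1 → b = c := by decide
    exact hc _ _ _ hk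
  subst hyz
  exact .inr (.inr ⟨funext fun i => e5 _ _ _ _ (h1 i) rfl, rfl⟩)

/-- A quadruple that does not pair off cancels through a linear or a quadratic coefficient, so cubic
ones are not needed. Each of the three pairings has `4 ^ n` quadruples. -/
theorem sum_gap_pow_four_le :
    ∑ f : Poly3 n, (f.gap : ℝ) ^ 4 ≤ 3 * 4 ^ n * Fintype.card (Poly3 n) := by
  have h1 : ∀ f : Poly3 n, (f.gap : ℝ) ^ 4 =
      ∑ x, ∑ y, ∑ z, ∑ w, sgn (f.eval x + f.eval y + f.eval z + f.eval w) := fun f => by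
    rw [gap_eq, show ∀ a : ℝ, a ^ 4 = a * (a * (a * a)) from fun a => by ring]
    simp only [Finset.mul_sum, Finset.sum_mul, sgn_add]
    refine Finset.sum_congr rfl fun x _ => Finset.sum_congr rfl fun y _ =>
      Finset.sum_congr rfl fun z _ => Finset.sum_congr rfl fun w _ => ?_
    ring
  have h2 : ∀ x y z w : Bits n, ∑ f : Poly3 n, sgn (f.eval x + f.eval y + f.eval z + f.eval w) ≤
      (Fintype.card (Poly3 n) : ℝ) * ((if x = y then if z = w then 1 else 0 else 0) +
        (if x = z then if y = w then 1 else 0 else 0) +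
        (if x = w then if y = z then 1 else 0 else 0)) := fun x y z w => by
    by_cases h : (x = y ∧ z = w) ∨ (x = z ∧ y = w) ∨ (x = w ∧ y = z)
    · have h3 : (1 : ℝ) ≤ (if x = y then if z = w then 1 else 0 else 0) +
        (if x = z then if y = w then 1 else 0 else 0) +
        (if x = w then if y = z then 1 else 0 else 0) := by
        have hnn : ∀ p q : Prop, [Decidable p] → [Decidable q] →
            (0 : ℝ) ≤ if p then if q then 1 else 0 else 0 := by
          intro p q _ _; split_ifs <;> norm_num
        have a1 := hnn (x = y) (z = w)
        have a2 := hnn (x = z) (y = w)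
        have a3 := hnn (x = w) (y = z)
        rcases h with ⟨h, h'⟩ | ⟨h, h'⟩ | ⟨h, h'⟩
        · rw [if_pos h, if_pos h']; linarith
        · rw [if_pos h, if_pos h'] at a2 ⊢; linarith
        · rw [if_pos h, if_pos h'] at a3 ⊢; linarith
      calc ∑ f : Poly3 n, sgn (f.eval x + f.eval y + f.eval z + f.eval w)
          ≤ ∑ f : Poly3 n, (1 : ℝ) :=
            Finset.sum_le_sum fun f _ => (le_abs_self _).trans (abs_sgn _).le
        _ = Fintype.card (Poly3 n) * 1 := by simp
        _ ≤ _ := by gcongr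
    · have h0 : ∑ f : Poly3 n, sgn (f.eval x + f.eval y + f.eval z + f.eval w) = 0 := by
        have hadd : ∀ f g : Poly3 n, (f + g).eval x + (f + g).eval y + (f + g).eval z +
            (f + g).eval w = (f.eval x + f.eval y + f.eval z + f.eval w) +
              (g.eval x + g.eval y + g.eval z + g.eval w) := fun f g => by
          simp only [eval_add]; ring
        have hone : ∀ a : ZMod 2, a ≠ 0 → a = 1 := by decide
        by_cases hl : ∀ i, x i + y i + z i + w i = 0
        · have : ¬ ∀ i j : Fin n, j < i → x i * x j + y i * y j + z i * z j + w i * w j = 0 :=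
            fun hq => h (paired_of_forall hl hq)
          push Not at this
          obtain ⟨i, j, hij, hne⟩ := this
          refine sum_sgn_eq_zero (L := fun f => f.eval x + f.eval y + f.eval z + f.eval w) hadd
            (quadratic ⟨(i, j), hij⟩) ?_
          simp only [eval_quadratic]
          exact hone _ hne
        · push Not at hl
          obtain ⟨i, hne⟩ := hl
          refine sum_sgn_eq_zero (L := fun f => f.eval x + f.eval y + f.eval z + f.eval w) hadd
            (linear i) ?_
          simp only [eval_linear]
          exact hone _ hne
      rw [h0]
      have hnn : ∀ p q : Prop, [Decidable p] → [Decidable q] →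
          (0 : ℝ) ≤ if p then if q then 1 else 0 else 0 := by
        intro p q _ _; split_ifs <;> norm_num
      have := hnn (x = y) (z = w)
      have := hnn (x = z) (y = w)
      have := hnn (x = w) (y = z)
      positivity
  calc ∑ f : Poly3 n, (f.gap : ℝ) ^ 4
      = ∑ x, ∑ y, ∑ z, ∑ w, ∑ f : Poly3 n,
          sgn (f.eval x + f.eval y + f.eval z + f.eval w) := by
        simp only [h1]
        simp_rw [Finset.sum_comm (s := (Finset.univ : Finset (Poly3 n)))]
    _ ≤ ∑ x : Bits n, ∑ y : Bits n, ∑ z : Bits n, ∑ w : Bits n,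
          (Fintype.card (Poly3 n) : ℝ) * ((if x = y then if z = w then 1 else 0 else 0) +
        (if x = z then if y = w then 1 else 0 else 0) +
        (if x = w then if y = z then 1 else 0 else 0)) := by
        gcongr with x _ y _ z _ w _
        exact h2 x y z w
    _ = 3 * 4 ^ n * Fintype.card (Poly3 n) := by
        simp only [← Finset.mul_sum, Finset.sum_add_distrib]
        simp [ZMod.card, Finset.sum_ite_irrel]
        rw [show (4 : ℝ) = 2 * 2 by norm_num, mul_pow]
        ring

end Poly3

/-! ### Concentration -/

theorem tally_mono {p : ℝ} (hp : 0 ≤ p) (hp' : p ≤ 1) {G H : ℕ → ℝ} (h : ∀ y, G y ≤ H y)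
    (k y : ℕ) : tally p G k y ≤ tally p H k y := by
  induction k generalizing y with
  | zero => exact h y
  | succ k ih =>
    have := ih y
    have := ih (y + 1)
    have : 0 ≤ 1 - p := by linarith
    simp only [tally]
    gcongr

/-- The second moment about `c` is squared bias plus variance. The form `A - b (y - c)²` is that of
the minorant of an indicator in Chebyshev's inequality. -/
theorem tally_quadratic (p A b c : ℝ) (k y : ℕ) :
    tally p (fun y => A - b * (y - c) ^ 2) k y =
      A - b * ((y + k * p - c) ^ 2 + k * (p * (1 - p))) := by
  induction k generalizing y with
  | zero => simp [tally]
  | succ k ih =>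
    simp only [tally, ih]
    push_cast
    ring

open Classical in
/-- Chebyshev's inequality for the number of successes in `m` independent trials. -/
theorem le_tally {p τ : ℝ} (hp : 0 ≤ p) (hp' : p ≤ 1) (hτ : 0 < τ) {m : ℕ} {P : ℕ → Prop}
    (hP : ∀ y : ℕ, ¬ P y → τ ≤ |y - m * p|) :
    1 - m * p / τ ^ 2 ≤ tally p (fun y => if P y then 1 else 0) m 0 := by
  calc 1 - m * p / τ ^ 2 ≤
      1 - (τ ^ 2)⁻¹ * ((((0 : ℕ) : ℝ) + m * p - m * p) ^ 2 + m * (p * (1 - p))) := by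
        have h1 : (τ ^ 2)⁻¹ * (m * (p * (1 - p))) ≤ (τ ^ 2)⁻¹ * (m * p) := by
          gcongr
          nlinarith
        rw [div_eq_inv_mul]
        simp only [Nat.cast_zero, zero_add, sub_self, ne_eq, OfNat.ofNat_ne_zero,
          not_false_eq_true, zero_pow]
        linarith
    _ = tally p (fun y => 1 - (τ ^ 2)⁻¹ * ((y : ℝ) - m * p) ^ 2) m 0 :=
        (tally_quadratic p 1 _ _ m 0).symm
    _ ≤ _ := by
        refine tally_mono hp hp' (fun y => ?_) m 0
        split_ifs with h
        · have : 0 ≤ (τ ^ 2)⁻¹ * ((y : ℝ) - m * p) ^ 2 := by positivity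
          linarith
        · have h1 : τ ^ 2 ≤ ((y : ℝ) - m * p) ^ 2 := by
            rw [← sq_abs ((y : ℝ) - m * p)]
            exact pow_le_pow_left₀ hτ.le (hP y h) 2
          have h2 : 1 ≤ (τ ^ 2)⁻¹ * ((y : ℝ) - m * p) ^ 2 := by
            rw [← inv_mul_cancel₀ (show τ ^ 2 ≠ 0 by positivity)]
            gcongr
          linarith

/-! ### The sampler and its clock -/

namespace Machine

variable {M : Machine}

theorem run_append (x r r' : List Bool) : M.run x (r ++ r') = r'.foldl M.step (M.run x r) := by
  simp [run]

theorem run_halted_mono {x : List Bool} {t t' : ℕ} (h : ∀ r, r.length = t → (M.run x r).l = none)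
    (ht : t ≤ t') (r : List Bool) (hr : r.length = t') : (M.run x r).l = none := by
  rw [← List.take_append_drop t r, run_append, Verifier.foldl_of_halted]
  · exact h _ (by simp; omega)
  · exact h _ (by simp; omega)

/-- Coins tossed after every run has halted have no influence, so output probabilities do not depend
on which valid time bound defines them. -/
theorem coinProb_congr {x : List Bool} {t t' : ℕ} (h : ∀ r, r.length = t → (M.run x r).l = none)
    (h' : ∀ r, r.length = t' → (M.run x r).l = none) (P : M.Cfg → Prop) :
    coinProb t (fun r => P (M.run x r)) = coinProb t' fun r => P (M.run x r) := by
  classical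
  wlog ht : t ≤ t' generalizing t t'
  · exact (this h' h (by omega)).symm
  obtain ⟨d, rfl⟩ := Nat.exists_eq_add_of_le ht
  rw [coinProb_eq_avg, coinProb_eq_avg, avg_append]
  refine avg_congr fun r hr => ?_
  simp only [run_append, Verifier.foldl_of_halted _ (h r hr), avg_const]

/-- `2 ^ M.clock x - 1` coins suffice for all runs on `x`. -/
noncomputable def clock (M : Machine) (x : List Bool) : ℕ :=
  sInf {k : ℕ | ∀ r, r.length = 2 ^ k - 1 → (M.run x r).l = none}

variable {x : List Bool} {t : ℕ}

theorem clock_spec (h : ∀ r, r.length = t → (M.run x r).l = none) (r : List Bool)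
    (hr : r.length = 2 ^ M.clock x - 1) : (M.run x r).l = none := by
  have : {k : ℕ | ∀ r, r.length = 2 ^ k - 1 → (M.run x r).l = none}.Nonempty :=
    ⟨t, run_halted_mono h (Nat.le_sub_one_of_lt Nat.lt_two_pow_self)⟩
  exact Nat.sInf_mem this r hr

theorem exists_not_halted_of_lt_clock {i : ℕ} (hi : i < M.clock x) :
    ∃ r, r.length = 2 ^ i - 1 ∧ (M.run x r).l ≠ none := by
  have := Nat.notMem_of_lt_sInf hi
  simp only [Set.mem_ofPred_eq] at this
  push Not at this
  exact this

/-- One exponent below the clock some run is unfinished, hence `2 ^ k - 1 < t`. Doubling therefore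
overshoots a valid time bound only by a constant factor. -/
theorem two_pow_clock_le (h : ∀ r, r.length = t → (M.run x r).l = none) :
    2 ^ M.clock x ≤ 2 * t + 1 := by
  rcases hk : M.clock x with _ | k
  · simp
  · obtain ⟨r, hr, hne⟩ := exists_not_halted_of_lt_clock (M := M) (x := x) (i := k) (by omega)
    by_contra hlt
    rw [pow_succ] at hlt
    exact hne (run_halted_mono h (by omega) r hr)

end Machine

/-! ### Codes -/

theorem avg_eq_sum_bits (n : ℕ) (F : List Bool → ℝ) :
    avg n F = (∑ z : Bits n, F z.toList) / 2 ^ n := by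
  let φ : Bool ≃ ZMod 2 :=
    { toFun := fun b => if b then 1 else 0
      invFun := fun a => decide (a = 1)
      left_inv := fun b => by cases b <;> simp
      right_inv := fun a => by rcases zmod_two_eq a with rfl | rfl <;> simp }
  rw [avg_eq_sum, ← (Equiv.arrowCongr (Equiv.refl (Fin n)) φ).sum_comp]
  congr 1
  refine Finset.sum_congr rfl fun r _ => ?_
  rw [Bits.toList]
  congr 2
  funext i
  exact (φ.left_inv (r i)).symm

theorem Bits.length_toList {n : ℕ} (z : Bits n) : z.toList.length = n := by simp [Bits.toList]

theorem Bits.exists_toList {n : ℕ} {z : List Bool} (hz : z.length = n) :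
    ∃ w : Bits n, w.toList = z := by
  subst hz
  refine ⟨fun i => if z.get i then 1 else 0, ?_⟩
  rw [Bits.toList]
  conv_rhs => rw [← List.ofFn_get z]
  congr 1
  funext i
  cases z.get i <;> simp

namespace Poly3

variable {n : ℕ}

/-- The linear part of the code of `f`. -/
def linearCode (f : Poly3 n) : List Bool := (List.finRange n).map fun i => decide (f.1 i = 1)

/-- The part of the code of `f` of degree at least two. -/
def restCode (f : Poly3 n) : List Bool :=
  ((pairList n).map fun p => decide (f.2.1 p = 1)) ++
    (tripleList n).map fun t => decide (f.2.2 t = 1)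

theorem encode_eq (f : Poly3 n) :
    f.encode = List.replicate n true ++ false :: (f.linearCode ++ f.restCode) := by
  simp [encode, encodeTable, linearCode, restCode]

theorem length_linearCode (f : Poly3 n) : f.linearCode.length = n := by simp [linearCode]

theorem linearCode_shift (f : Poly3 n) (z : Bits n) :
    (f.shift z).linearCode = List.zipWith xor z.toList f.linearCode := by
  have h : ∀ a b : ZMod 2, decide (a + b = 1) = xor (decide (b = 1)) (decide (a = 1)) := by decide
  refine List.ext_getElem ?_ fun i h1 h2 => ?_
  · simp [linearCode, Bits.toList]
  · simp [linearCode, Bits.toList, shift, h]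

theorem encode_circuit_shift (f : Poly3 n) (z : Bits n) :
    (f.shift z).circuit.encode = List.replicate n true ++ false ::
      (List.zipWith xor z.toList f.linearCode ++ f.restCode) := by
  rw [← linearCode_shift]
  simp [IQPCircuit.encode, encodeTable, linearCode, restCode, circuit, shift]
  rfl

theorem length_restCode (f : Poly3 n) :
    f.restCode.length = (pairList n).length + (tripleList n).length := by simp [restCode]

end Poly3

open Estimator in
-- The Toeplitz bits consist of the `n` bits `a` from the unary pass and one bit of `a'` per coin.
-- This suffices, as the seed has at most `n` bits.
theorem tagged_baseItems {n : ℕ} (e : ℕ) (t : Tag) {α rest z a r a' : List Bool} (hα : α.length = n)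
    (hz : z.length = n) (ha : a.length = n) (hr : r.length = a'.length) :
    tagged t (addCoins r a' (baseItems e α rest z a)) = match t with
      | .inp => List.replicate n true ++ false :: (List.zipWith xor z α ++ rest)
      | .z => z
      | .s => List.replicate (n - e) true
      | .r => r
      | .a => a ++ a'
      | .fl => [] := by
  rw [tagged_addCoins _ _ _ hr, baseItems, tagged_addAll,
    tagged_addShifted _ _ _ (hz.trans hα.symm)]
  cases t <;> simp [tagged, tagged_addOnes, ha]

/-! ### Answer probabilities and squared gaps -/

section reduction

variable {M : Machine} {T n e : ℕ}

open Estimator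

/-- The length of the coins in the queries about the shift of `f` by `z`. -/
noncomputable def shiftClock (M : Machine) {n : ℕ} (f : Poly3 n) (z : List Bool) : ℕ :=
  M.clock (List.replicate n true ++ false :: (List.zipWith xor z f.linearCode ++ f.restCode))

theorem shiftClock_toList (f : Poly3 n) (z : Bits n) :
    shiftClock M f z.toList = M.clock (f.shift z).circuit.encode := by
  rw [shiftClock, Poly3.encode_circuit_shift]

/-- For a fixed shift, the coins and both portions of the Toeplitz bits are uniform, so the final
query performs exactly the experiment of `hitProb`. -/
theorem answerProb_eq (f : Poly3 n) :
    answerProb (verifierLanguage M) e n f.linearCode f.restCode (shiftClock M f) =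
      (∑ z : Bits n, hitProb (fun r => (M.run (f.shift z).circuit.encode r).l = none ∧
        (M.run (f.shift z).circuit.encode r).stk M.out = z.toList) (n - e) n
          (2 ^ M.clock (f.shift z).circuit.encode - 1)) / 2 ^ n := by
  classical
  rw [answerProb, avg_eq_sum_bits]
  congr 1
  refine Finset.sum_congr rfl fun z _ => ?_
  rw [shiftClock_toList]
  set l := 2 ^ M.clock (f.shift z).circuit.encode - 1
  rw [avg_comm n l, hitProb]
  refine avg_congr fun r hr => ?_
  rw [avg_append]
  refine avg_congr fun a ha => avg_congr fun a' ha' => ?_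
  have htag := fun t => tagged_baseItems (rest := f.restCode) e t f.length_linearCode
    z.length_toList ha (hr.trans ha'.symm)
  have htag' : ∀ t, t ≠ .fl → tagged t ((.fl, true) :: addCoins r a'
      (baseItems e f.linearCode f.restCode z.toList a)) =
      tagged t (addCoins r a' (baseItems e f.linearCode f.restCode z.toList a)) := fun t ht => by
    rw [tagged, if_neg (Ne.symm ht)]
  congr 1
  rw [Verifier.final_mem_iff]
  · rw [htag' .inp (by simp), htag' .r (by simp), htag' .a (by simp), htag' .s (by simp),
      htag' .z (by simp), htag .inp, htag .r, htag .a, htag .s, htag .z]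
    simp only [List.length_replicate, Poly3.encode_circuit_shift]
  · simp [tagged]
  · rw [htag' .r (by simp), htag' .a (by simp), htag' .s (by simp), htag .r, htag .a, htag .s]
    simp only [List.length_replicate, List.length_append]
    omega

variable (hM : ∀ (C : IQPCircuit n) (r : List Bool), r.length = T → (M.run C.encode r).l = none)
include hM

theorem two_pow_shiftClock_le (f : Poly3 n) (z : List Bool) (hz : z.length = n) :
    2 ^ shiftClock M f z ≤ 2 * T + 1 := by
  obtain ⟨z, rfl⟩ := Bits.exists_toList hz
  rw [shiftClock_toList]
  exact Machine.two_pow_clock_le (hM _)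

/-- Below the clock some run is unfinished, by minimality; at the clock all runs have halted. -/
theorem probe_iff (f : Poly3 n) (z a : List Bool) (hz : z.length = n) (ha : a.length = n) (i : ℕ)
    (hi : i ≤ shiftClock M f z) (r a' : List Bool) (hr : r.length = 2 ^ i - 1)
    (ha' : a'.length = 2 ^ i - 1) :
    encodeItems (addCoins r a' (baseItems e f.linearCode f.restCode z a)) ∈ verifierLanguage M ↔
      i < shiftClock M f z := by
  have hra : r.length = a'.length := by omega
  have htag := fun t => tagged_baseItems (rest := f.restCode) e t f.length_linearCode hz ha hra
  rw [Verifier.probe_mem_iff]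
  · rw [htag .inp, htag .r]
    simp only
    constructor
    · rintro ⟨r', hr', hne⟩
      refine lt_of_le_of_ne hi fun h => hne ?_
      obtain ⟨z, rfl⟩ := Bits.exists_toList hz
      rw [← Poly3.encode_circuit_shift] at hne ⊢
      rw [shiftClock_toList] at h
      exact Machine.clock_spec (hM _) r' (by rw [hr', hr, h])
    · intro h
      obtain ⟨r', hr', hne⟩ := Machine.exists_not_halted_of_lt_clock h
      exact ⟨r', hr'.trans hr.symm, hne⟩
  · rw [htag .fl]
  · simp only [htag, List.length_replicate, List.length_append]
    omega

/-- The probability of a positive answer is close to the scaled squared gap. -/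
theorem abs_answerProb_sub_le (f : Poly3 n) {μ d : ℝ}
    (hμ : μ = 2 ^ (n - e) * ((f.gap : ℝ) ^ 2 / 4 ^ n))
    (hd : d = 2 ^ (n - e) / 2 ^ n * ∑ z : Bits n,
      |(f.shift z).circuit.outputProb z - M.outputProb T (f.shift z).circuit z|) :
    |answerProb (verifierLanguage M) e n f.linearCode f.restCode (shiftClock M f) - μ| ≤
      μ ^ 2 + d := by
  classical
  -- The queries provide `2 ^ clock - 1` coins instead of `T`; both are valid time bounds.
  have hq : ∀ z : Bits n, (avg (2 ^ M.clock (f.shift z).circuit.encode - 1) fun r =>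
      if (M.run (f.shift z).circuit.encode r).l = none ∧
        (M.run (f.shift z).circuit.encode r).stk M.out = z.toList then 1 else 0) =
      M.outputProb T (f.shift z).circuit z := fun z => by
    rw [Machine.outputProb, ← coinProb_eq_avg]
    exact Machine.coinProb_congr (Machine.clock_spec (hM _)) (hM _)
      (fun c => c.l = none ∧ c.stk M.out = z.toList)
  -- Shifting twice by `z` returns `f`, so the relevant probability is the same for all shifts.
  have hp : ∀ z : Bits n, (f.shift z).circuit.outputProb z = (f.gap : ℝ) ^ 2 / 4 ^ n := fun z => by
    rw [Poly3.outputProb_circuit, Poly3.shift_shift]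
  have hμ0 : 0 ≤ μ := by rw [hμ]; positivity
  set s : ℝ := 2 ^ (n - e)
  have hs : 0 < s := by positivity
  set q : Bits n → ℝ := fun z => M.outputProb T (f.shift z).circuit z with hqdef
  have hq0 : ∀ z, 0 ≤ q z := fun z => by
    simp only [hqdef, Machine.outputProb, coinProb]
    positivity
  have hb := fun z : Bits n => hitProb_bounds
      (fun r => (M.run (f.shift z).circuit.encode r).l = none ∧
        (M.run (f.shift z).circuit.encode r).stk M.out = z.toList) (Nat.sub_le n e)
          (2 ^ M.clock (f.shift z).circuit.encode - 1) (μ := s * q z) (by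
      rw [show q z = _ from (hq z).symm]; congr!)
  have hsum : ∑ z : Bits n, |μ - s * q z| = 2 ^ n * d := by
    rw [hd, ← mul_assoc, mul_div_cancel₀ _ (by positivity), Finset.mul_sum]
    refine Finset.sum_congr rfl fun z _ => ?_
    rw [hp, hμ, ← mul_sub, abs_mul, abs_of_pos hs]
  have hcard : ∀ c : ℝ, ∑ z : Bits n, c = 2 ^ n * c := fun c => by simp [ZMod.card]
  rw [answerProb_eq, abs_le]
  constructor
  · have : 2 ^ n * (μ - μ ^ 2 - d) ≤ ∑ z : Bits n, hitProb (fun r =>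
        (M.run (f.shift z).circuit.encode r).l = none ∧
        (M.run (f.shift z).circuit.encode r).stk M.out = z.toList) (n - e) n
          (2 ^ M.clock (f.shift z).circuit.encode - 1) := by
      rw [mul_sub, ← hsum, ← hcard, ← Finset.sum_sub_distrib]
      refine Finset.sum_le_sum fun z _ => le_trans ?_ (hb z).2
      -- With `x = s * q z` the claim is `μ - μ² - |μ - x| ≤ x / (1 + x)`. For `x ≤ μ` it follows
      -- from `x - x² ≤ x / (1 + x)`, and for `x ≥ μ` from monotonicity.
      have hx : 0 ≤ s * q z := mul_nonneg hs.le (hq0 z)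
      rw [le_div_iff₀ (by linarith)]
      rcases abs_cases (μ - s * q z) with ⟨h, h'⟩ | ⟨h, h'⟩ <;> rw [h]
      · nlinarith [mul_nonneg hx hμ0, mul_nonneg hμ0 hμ0, mul_nonneg hx (mul_nonneg hμ0 hμ0)]
      · nlinarith [mul_nonneg hx hμ0, mul_nonneg hμ0 hμ0, mul_nonneg hx (mul_nonneg hμ0 hμ0)]
    have h2 : μ - μ ^ 2 - d ≤ (∑ z : Bits n, hitProb (fun r =>
        (M.run (f.shift z).circuit.encode r).l = none ∧
        (M.run (f.shift z).circuit.encode r).stk M.out = z.toList) (n - e) n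
          (2 ^ M.clock (f.shift z).circuit.encode - 1)) / 2 ^ n := by
      rw [le_div_iff₀ (by positivity)]
      linarith
    linarith
  · have : ∑ z : Bits n, hitProb (fun r =>
        (M.run (f.shift z).circuit.encode r).l = none ∧
        (M.run (f.shift z).circuit.encode r).stk M.out = z.toList) (n - e) n
          (2 ^ M.clock (f.shift z).circuit.encode - 1) ≤ 2 ^ n * (μ + d) := by
      rw [mul_add, ← hsum, ← hcard, ← Finset.sum_add_distrib]
      refine Finset.sum_le_sum fun z _ => (hb z).1.trans ?_
      linarith [neg_abs_le (μ - s * q z)]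
    have h2 : (∑ z : Bits n, hitProb (fun r =>
        (M.run (f.shift z).circuit.encode r).l = none ∧
        (M.run (f.shift z).circuit.encode r).stk M.out = z.toList) (n - e) n
          (2 ^ M.clock (f.shift z).circuit.encode - 1)) / 2 ^ n ≤ μ + d := by
      rw [div_le_iff₀ (by positivity)]
      linarith
    nlinarith [mul_nonneg hμ0 hμ0]

end reduction

/-! ### The reduction -/

/-- A fraction of more than `v < 1/3` of the polynomials has a squared gap of the typical order
and a small error. -/
theorem Poly3.card_typical {n : ℕ} {v τ ε : ℝ} (hv : 0 < v) (hτ : 0 < τ) (hτv : 8 * τ ≤ 1 - 3 * v)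
    (hε : 0 < ε) (D : Poly3 n → ℝ) (hD : ∀ f, 0 ≤ D f) (hsum : ∑ f, D f ≤ ε * Nat.card (Poly3 n)) :
    v * Nat.card (Poly3 n) ≤ Nat.card {f : Poly3 n // τ ≤ (f.gap : ℝ) ^ 2 / 2 ^ n ∧
      (f.gap : ℝ) ^ 2 / 2 ^ n * τ ≤ 1 ∧ D f * τ ≤ ε} := by
  classical
  set S : Poly3 n → Prop := fun f => τ ≤ (f.gap : ℝ) ^ 2 / 2 ^ n ∧
      (f.gap : ℝ) ^ 2 / 2 ^ n * τ ≤ 1 ∧ D f * τ ≤ ε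
  set N : ℝ := ((Fintype.card (Poly3 n) : ℕ) : ℝ) with hN
  have hN0 : 0 ≤ N := by positivity
  -- The maximiser of `2 l (1 - τ) - 3 l²`; the maximum is `(1 - τ)² / 3`.
  set l : ℝ := (1 - τ) / 3 with hl
  rw [Nat.card_eq_fintype_card, Nat.card_eq_fintype_card] at *
  change v * N ≤ (Fintype.card {f // S f} : ℝ)
  -- A Paley–Zygmund minorant of the indicator. With `G` the scaled squared gap, `2 l G - l² G²` is
  -- at most `1`; the term `2 l τ` disposes of small `G`, and the last two terms exceed `1` for
  -- large `G` and for a large error respectively.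
  have hpt : ∀ f : Poly3 n, 2 * l * (f.gap : ℝ) ^ 2 / 2 ^ n - 2 * l * τ -
      l ^ 2 * (f.gap : ℝ) ^ 4 / 4 ^ n - τ * (f.gap : ℝ) ^ 2 / 2 ^ n - τ * D f / ε ≤
      if S f then 1 else 0 := fun f => by
    have h4 : (f.gap : ℝ) ^ 4 / 4 ^ n = ((f.gap : ℝ) ^ 2 / 2 ^ n) ^ 2 := by
      rw [div_pow, ← pow_mul, ← pow_mul, mul_comm n 2, pow_mul 2 2 n]
      norm_num
    rw [mul_div_assoc, mul_div_assoc _ _ ((4 : ℝ) ^ n), mul_div_assoc τ _ ((2 : ℝ) ^ n), h4]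
    have hG : 0 ≤ (f.gap : ℝ) ^ 2 / 2 ^ n := by positivity
    have hd : 0 ≤ τ * D f / ε := div_nonneg (mul_nonneg hτ.le (hD f)) hε.le
    have hd' : ¬ D f * τ ≤ ε → 1 ≤ τ * D f / ε := fun h => by
      rw [le_div_iff₀ hε]; linarith
    have hS : S f ↔ τ ≤ (f.gap : ℝ) ^ 2 / 2 ^ n ∧ (f.gap : ℝ) ^ 2 / 2 ^ n * τ ≤ 1 ∧
      D f * τ ≤ ε := Iff.rfl
    have hl0 : 0 ≤ l := by rw [hl]; linarith
    split_ifs with h <;> generalize (f.gap : ℝ) ^ 2 / 2 ^ n = G at *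
    · nlinarith [sq_nonneg (l * G - 1), mul_nonneg hl0 hτ.le]
    · rw [hS, not_and_or, not_and_or] at h
      rcases h with h | h | h
      · nlinarith [mul_nonneg hl0 (sub_nonneg.2 (not_le.1 h).le), sq_nonneg (l * G)]
      · nlinarith [sq_nonneg (l * G - 1), mul_nonneg hl0 hτ.le]
      · nlinarith [sq_nonneg (l * G - 1), mul_nonneg hl0 hτ.le, hd' h]
  have hle := Finset.sum_le_sum fun f (_ : f ∈ Finset.univ) => hpt f
  rw [Fintype.card_subtype, Finset.card_filter]
  push_cast
  refine le_trans ?_ hle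
  simp only [Finset.sum_sub_distrib, ← Finset.sum_div, ← Finset.mul_sum, sum_gap_sq]
  have h4 := div_le_div_of_nonneg_right (mul_le_mul_of_nonneg_left
    (sum_gap_pow_four_le (n := n)) (sq_nonneg l)) (by positivity : (0 : ℝ) ≤ 4 ^ n)
  have h5 := div_le_div_of_nonneg_right (mul_le_mul_of_nonneg_left hsum hτ.le) hε.le
  rw [← hN] at *
  rw [show l ^ 2 * (3 * 4 ^ n * N) / 4 ^ n = 3 * l ^ 2 * N by field_simp] at h4
  rw [show τ * (ε * N) / ε = τ * N by field_simp] at h5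
  rw [show 2 * l * (2 ^ n * N) / 2 ^ n = 2 * l * N by field_simp,
    show τ * (2 ^ n * N) / 2 ^ n = τ * N by field_simp]
  simp only [Finset.sum_const, Finset.card_univ, nsmul_eq_mul]
  rw [← hN]
  -- The moments leave `(1 - τ)² / 3 - 2 τ`, which is at least `v` because `8 τ ≤ 1 - 3 v`.
  have : 0 ≤ N * (2 * l - 2 * l * τ - 3 * l ^ 2 - τ - τ - v) := by
    refine mul_nonneg hN0 ?_
    rw [hl]; nlinarith [sq_nonneg τ]
  nlinarith

/-- For fixed `z` the shift is an involution of the polynomials. Reindexing therefore turns the sum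
into the total errors of the unshifted circuits, each at most `ε`. -/
theorem Poly3.sum_shift_error_le {n : ℕ} {M : Machine} {T : ℕ} {ε : ℝ}
    (h : ∀ C : IQPCircuit n, M.Samples T C ε) :
    ∑ f : Poly3 n, ∑ z : Bits n, |(f.shift z).circuit.outputProb z -
      M.outputProb T (f.shift z).circuit z| ≤ ε * Nat.card (Poly3 n) := by
  rw [Finset.sum_comm]
  have : ∀ z : Bits n, ∑ f : Poly3 n, |(f.shift z).circuit.outputProb z -
      M.outputProb T (f.shift z).circuit z| =
      ∑ f : Poly3 n, |f.circuit.outputProb z - M.outputProb T f.circuit z| := fun z =>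
    Function.Bijective.sum_comp (Function.Involutive.bijective (f := fun f : Poly3 n => f.shift z)
      fun f => f.shift_shift z)
      fun f : Poly3 n => |f.circuit.outputProb z - M.outputProb T f.circuit z|
  simp only [this]
  rw [Finset.sum_comm]
  refine (Finset.sum_le_sum fun f _ => h f.circuit).trans ?_
  simp [mul_comm]

theorem answerProb_mem_Icc (O : Set (List Bool)) (e n : ℕ) (α rest : List Bool)
    (k : List Bool → ℕ) : Estimator.answerProb O e n α rest k ∈ Set.Icc (0 : ℝ) 1 := by
  have h0 : ∀ (n : ℕ) (F : List Bool → ℝ), (∀ l, F l ∈ Set.Icc (0 : ℝ) 1) →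
      avg n F ∈ Set.Icc (0 : ℝ) 1 := fun n F h => by
    constructor
    · rw [← avg_const n 0]; exact avg_mono fun l _ => (h l).1
    · rw [← avg_const n 1]; exact avg_mono fun l _ => (h l).2
  refine h0 _ _ fun z => h0 _ _ fun a => h0 _ _ fun r => h0 _ _ fun a' => ?_
  split_ifs <;> simp

section reduction

variable {M : Machine} {T n e : ℕ}

/-- The length of the table of a polynomial. -/
def tableLength (n : ℕ) : ℕ := 2 * n + 1 + ((pairList n).length + (tripleList n).length)

variable (hM : ∀ (C : IQPCircuit n) (r : List Bool), r.length = T → (M.run C.encode r).l = none)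
include hM

-- The bound `2 * T + 1` replaces the clock, which varies with the shift. Time and query length
-- remain linear in `T` and the length of the table, as `e` is constant.
open Classical in
theorem estimator_run_encode (f : Poly3 n) :
    (∀ r, r.length = 2 ^ (2 * e) * (20 * (tableLength n + (2 * T + 1)) + 1) + (n + 1) →
      ((estimator e).run (verifierLanguage M) f.encode r).l = none) ∧
    (∀ r, ((estimator e).run (verifierLanguage M) f.encode r).l = some (estimator e).ask →
      (((estimator e).run (verifierLanguage M) f.encode r).stk (estimator e).query).length ≤
        12 * tableLength n + 8 * (2 * T + 1)) ∧
    ∀ u, (estimator e).gapSuccessProb (verifierLanguage M)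
        (2 ^ (2 * e) * (20 * (tableLength n + (2 * T + 1)) + 1) + (n + 1)) u f =
      tally (Estimator.answerProb (verifierLanguage M) e n f.linearCode f.restCode
        (shiftClock M f)) (fun y => if |((y * 2 ^ (n - e) : ℕ) : ℝ) - (f.gap : ℝ) ^ 2| ≤
          u * (f.gap : ℝ) ^ 2 then 1 else 0) (2 ^ (2 * e)) 0 := by
  obtain ⟨h1, h2, h3⟩ := estimator_run (e := e) (O := verifierLanguage M) f.length_linearCode
    (two_pow_shiftClock_le hM f) (probe_iff hM f) (E := tableLength n)
    (by rw [Poly3.length_restCode]; rfl) rfl rfl f.encode_eq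
  exact ⟨h1, h2, fun u => h3 fun y => |(y : ℝ) - (f.gap : ℝ) ^ 2| ≤ u * (f.gap : ℝ) ^ 2⟩

/-- On a typical polynomial the estimator succeeds. -/
theorem le_gapSuccessProb (he : e ≤ n) {u τ ε w : ℝ} (hu : 0 < u) (hτ : 0 < τ)
    (hε : ε = u * τ * τ / 4) (h1 : 1 / 2 ^ e ≤ u * τ / 4)
    (h2 : (1 / 2 ^ e) * (4 * (1 + u / 2) / (τ * u ^ 2 * τ ^ 2)) ≤ 1 - w)
    (f : Poly3 n) (hf : τ ≤ (f.gap : ℝ) ^ 2 / 2 ^ n ∧ (f.gap : ℝ) ^ 2 / 2 ^ n * τ ≤ 1 ∧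
      (∑ z : Bits n, |(f.shift z).circuit.outputProb z -
        M.outputProb T (f.shift z).circuit z|) * τ ≤ ε) :
    w ≤ (estimator e).gapSuccessProb (verifierLanguage M)
        (2 ^ (2 * e) * (20 * (tableLength n + (2 * T + 1)) + 1) + (n + 1)) u f := by
  classical
  rw [(estimator_run_encode hM f).2.2]
  have hp := abs_answerProb_sub_le (e := e) hM f rfl rfl
  obtain ⟨hp0, hp1⟩ := answerProb_mem_Icc (verifierLanguage M) e n f.linearCode f.restCode
    (shiftClock M f)
  generalize Estimator.answerProb (verifierLanguage M) e n f.linearCode f.restCode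
        (shiftClock M f) = p at *
  obtain ⟨hG1, hG2, hD⟩ := hf
  generalize ∑ z : Bits n, |(f.shift z).circuit.outputProb z -
        M.outputProb T (f.shift z).circuit z| = D at *
  set G : ℝ := (f.gap : ℝ) ^ 2 / 2 ^ n with hG
  have hgap : (f.gap : ℝ) ^ 2 = 2 ^ n * G := by rw [hG]; field_simp
  set η : ℝ := 1 / 2 ^ e with hη
  have hη0 : 0 < η := by positivity
  have hηe : (2 : ℝ) ^ (n - e) = 2 ^ n * η := by
    rw [hη, pow_sub₀ _ (by norm_num) he, one_div]
  have hm : ((2 ^ (2 * e) : ℕ) : ℝ) = 1 / η ^ 2 := by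
    rw [hη]; push_cast; field_simp; rw [← pow_mul, mul_comm]
  have h4 : (4 : ℝ) ^ n = 2 ^ n * 2 ^ n := by rw [← mul_pow]; norm_num
  rw [hgap, hηe, h4, show 2 ^ n * η * (2 ^ n * G / (2 ^ n * 2 ^ n)) = η * G by field_simp,
    show 2 ^ n * η / 2 ^ n * D = η * D by field_simp] at hp
  have hGpos : 0 < G := hτ.trans_le hG1
  have hpη : |p - η * G| ≤ u / 2 * (η * G) := by
    refine hp.trans ?_
    -- The choice of `e` and the upper bound on `G` make the hashing error `(η G)²` at most `u / 4`
    -- times `η G`.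
    have hGG : G * η ≤ u / 4 := by
      calc G * η ≤ G * (u * τ / 4) := by gcongr
        _ = u / 4 * (G * τ) := by ring
        _ ≤ u / 4 * 1 := by gcongr
        _ = u / 4 := by ring
    -- The choice of `ε` and the lower bound on `G` bound the error of the sampler by another
    -- quarter.
    have hDD : D ≤ u / 4 * G := by
      have : D * τ ≤ (u / 4 * τ) * τ := by rw [hε] at hD; linarith
      have := le_of_mul_le_mul_right this hτ
      nlinarith
    have : 0 < η * G := by positivity
    nlinarith
  have hpl : p ≤ (1 + u / 2) * (η * G) := by linarith [le_abs_self (p - η * G)]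
  -- The target count is `G / η ≥ τ / η`. Half of the relative error `u` is used up by the bias
  -- `hpη`; the other half leaves room for a deviation of `u / 2 * τ / η` from the mean.
  refine le_trans ?_ (le_tally hp0 hp1 (τ := u / 2 * τ / η) (by positivity) fun y hy => ?_)
  · rw [hm]
    have hpl' : p ≤ (1 + u / 2) * (η / τ) := by
      refine hpl.trans ?_
      have : G ≤ 1 / τ := by rwa [le_div_iff₀ hτ]
      calc (1 + u / 2) * (η * G) ≤ (1 + u / 2) * (η * (1 / τ)) := by gcongr
        _ = _ := by ring
    calc w ≤ 1 - η * (4 * (1 + u / 2) / (τ * u ^ 2 * τ ^ 2)) := by linarith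
      _ = 1 - 1 / η ^ 2 * ((1 + u / 2) * (η / τ)) / (u / 2 * τ / η) ^ 2 := by
        field_simp
        ring
      _ ≤ _ := by gcongr
  · rw [hm]
    push_cast at hy
    rw [hgap, hηe, show (y : ℝ) * (2 ^ n * η) - 2 ^ n * G = (2 ^ n * η) * (y - G / η) by
      rw [mul_sub, mul_assoc _ η (G / η), mul_div_cancel₀ _ hη0.ne', mul_comm],
      abs_mul, abs_of_pos (by positivity), not_le] at hy
    have hy' : u * (G / η) < |(y : ℝ) - G / η| := by
      have : 2 ^ n * η * (u * (G / η)) < 2 ^ n * η * |(y : ℝ) - G / η| := by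
        rw [show 2 ^ n * η * (u * (G / η)) = u * (2 ^ n * G) by field_simp]
        exact hy
      exact lt_of_mul_lt_mul_left this (by positivity)
    have hmp : |1 / η ^ 2 * p - G / η| ≤ u / 2 * (G / η) := by
      rw [show 1 / η ^ 2 * p - G / η = 1 / η ^ 2 * (p - η * G) by field_simp, abs_mul,
        abs_of_pos (by positivity)]
      calc _ ≤ 1 / η ^ 2 * (u / 2 * (η * G)) := by gcongr
        _ = _ := by field_simp
    have htri := abs_sub_abs_le_abs_sub ((y : ℝ) - G / η) (1 / η ^ 2 * p - G / η)
    rw [sub_sub_sub_cancel_right] at htri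
    have : u / 2 * τ / η ≤ u / 2 * (G / η) := by
      rw [mul_div_assoc]; gcongr
    linarith

end reduction

/-! ### Growth rates -/

theorem IsBigOTwoPow.of_pow {a : ℝ} (ha : 0 < a) (d : ℕ) : IsBigOTwoPow a fun n => n ^ d := by
  have h := (isLittleO_pow_const_const_pow_of_one_lt (R := ℝ) d
    (Real.one_lt_rpow (by norm_num : (1 : ℝ) < 2) ha)).isBigO
  refine IsBigO.congr h (fun n => by simp) fun n => ?_
  rw [← Real.rpow_mul_natCast (by norm_num)]

theorem IsBigOTwoPow.mono {a : ℝ} {S T : ℕ → ℕ} (hT : IsBigOTwoPow a T) (h : ∀ n, S n ≤ T n) :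
    IsBigOTwoPow a S :=
  IsBigO.trans (IsBigO.of_bound 1 (Eventually.of_forall fun n => by
    simpa using h n)) hT

theorem IsBigOTwoPow.add {a : ℝ} {S T : ℕ → ℕ} (hS : IsBigOTwoPow a S) (hT : IsBigOTwoPow a T) :
    IsBigOTwoPow a fun n => S n + T n := by
  simpa [IsBigOTwoPow] using IsBigO.add hS hT

theorem IsBigOTwoPow.const_mul {a : ℝ} {T : ℕ → ℕ} (c : ℕ) (hT : IsBigOTwoPow a T) :
    IsBigOTwoPow a fun n => c * T n := by
  simpa [IsBigOTwoPow] using IsBigO.const_mul_left hT (c : ℝ)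

theorem IsBigOTwoPow.tableLength {a : ℝ} (ha : 0 < a) : IsBigOTwoPow a tableLength := by
  refine IsBigOTwoPow.mono (((((IsBigOTwoPow.of_pow ha 1).const_mul 2).add
    (IsBigOTwoPow.of_pow ha 0)).add (IsBigOTwoPow.of_pow ha 2)).add (IsBigOTwoPow.of_pow ha 3))
    fun n => ?_
  have h2 := length_pairList_le n
  have h3 := length_tripleList_le n
  simp only [_root_.tableLength]
  nlinarith

/-- No algorithm samples the output distributions of all circuits. -/
theorem exists_not_samples {u v τ ε w a : ℝ} (hu : 0 < u) (hv : 0 < v) (hτ : 0 < τ)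
    (hτv : 8 * τ ≤ 1 - 3 * v) (hε : ε = u * τ * τ / 4) (hw : w < 1) (ha : 0 < a)
    (hard : SqGapHardness u v w a) {M : Machine} {T : ℕ → ℕ} (hM : M.RunsIn T)
    (hT : IsBigOTwoPow a T) : ∃ N₀ : ℕ, ∀ N > N₀, ∃ C : IQPCircuit N, ¬ M.Samples (T N) C ε := by
  -- The first condition controls the bias of hashing, the second the failure probability in
  -- Chebyshev's inequality. Neither involves `n`, so a single machine `estimator e` serves all `n`.
  obtain ⟨e, he1, he2⟩ : ∃ e : ℕ, 1 / 2 ^ e ≤ u * τ / 4 ∧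
      (1 / 2 ^ e) * (4 * (1 + u / 2) / (τ * u ^ 2 * τ ^ 2)) ≤ 1 - w := by
    have h1 : Tendsto (fun e : ℕ => (1 : ℝ) / 2 ^ e) atTop (nhds 0) := by
      simpa using tendsto_pow_atTop_nhds_zero_of_lt_one (r := (1 / 2 : ℝ)) (by norm_num)
        (by norm_num)
    have h2 := h1.mul_const (4 * (1 + u / 2) / (τ * u ^ 2 * τ ^ 2))
    rw [zero_mul] at h2
    exact ((h1.eventually_le_const (by positivity)).and
      (h2.eventually_le_const (sub_pos.2 hw))).exists
  have hK : IsBigOTwoPow a fun n => 2 * T n + 1 :=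
    (hT.const_mul 2).add (by simpa using IsBigOTwoPow.of_pow ha 0)
  have hE := IsBigOTwoPow.tableLength ha
  have h1 : IsBigOTwoPow a fun _ => 1 := by simpa using IsBigOTwoPow.of_pow ha 0
  have hn : IsBigOTwoPow a fun n => n := by simpa using IsBigOTwoPow.of_pow ha 1
  obtain ⟨n₀, h⟩ := hard (estimator e) (verifierLanguage M)
    (fun n => 2 ^ (2 * e) * (20 * (tableLength n + (2 * T n + 1)) + 1) + (n + 1))
    (fun n => 12 * tableLength n + 8 * (2 * T n + 1)) (inNTIMESq_verifierLanguage M)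
    -- No polynomial factor is needed: as `a > 0`, the table length is itself `O(2 ^ (a n))`.
    ⟨0, by simpa [IsBigOTwoPow] using
      (((((hE.add hK).const_mul 20).add h1).const_mul (2 ^ (2 * e))).add (hn.add h1))⟩
    (fun n f => (estimator_run_encode (hM n) f).1)
    ((hE.const_mul 12).add (hK.const_mul 8))
    (fun n f => (estimator_run_encode (hM n) f).2.1)
  refine ⟨max n₀ e, fun N hN => ?_⟩
  by_contra! hS
  refine h N ((le_max_left _ _).trans_lt hN) ?_
  have hε0 : 0 < ε := by rw [hε]; positivity
  refine (Poly3.card_typical hv hτ hτv hε0 _ (fun f => ?_) (Poly3.sum_shift_error_le hS)).trans ?_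
  · exact Finset.sum_nonneg fun z _ => abs_nonneg _
  · rw [Nat.cast_le]
    exact Nat.card_mono (Set.toFinite _) fun f hf => le_gapSuccessProb (hM N)
      ((le_max_right _ _).trans hN.le) hu hτ hε he1 he2 f hf

/-! ### Enumeration of the machines -/

/-- All functions occurring in a statement act between finite types, so statements have Gödel
numbers, with a tag for the constructor. -/
theorem Turing.TM2.countable_stmt (K Λ σ : Type) [Finite K] [Finite Λ] [Finite σ] :
    Countable (Turing.TM2.Stmt (fun _ : K => Bool) Λ σ) := by
  obtain ⟨a, ha⟩ := exists_injective_nat (K × (σ → Bool))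
  obtain ⟨b, hb⟩ := exists_injective_nat (K × (σ → Option Bool → σ))
  obtain ⟨c, hc⟩ := exists_injective_nat (σ → σ)
  obtain ⟨d, hd⟩ := exists_injective_nat (σ → Bool)
  obtain ⟨g, hg⟩ := exists_injective_nat (σ → Λ)
  let F : Turing.TM2.Stmt (fun _ : K => Bool) Λ σ → ℕ := fun q =>
    Turing.TM2.Stmt.rec (motive := fun _ => ℕ)
      (fun k f _ n => Nat.pair 0 (Nat.pair (a (k, f)) n))
      (fun k f _ n => Nat.pair 1 (Nat.pair (b (k, f)) n))
      (fun k f _ n => Nat.pair 2 (Nat.pair (b (k, f)) n))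
      (fun f _ n => Nat.pair 3 (Nat.pair (c f) n))
      (fun f _ _ m n => Nat.pair 4 (Nat.pair (d f) (Nat.pair m n)))
      (fun f => Nat.pair 5 (g f)) (Nat.pair 6 0) q
  refine Function.Injective.countable (f := F) fun q => ?_
  induction q with
  | push k f q ih =>
    intro q' h
    cases q' <;> simp only [F, Nat.pair_eq_pair, ha.eq_iff, Prod.mk.injEq] at h <;> try omega
    obtain ⟨-, ⟨rfl, rfl⟩, h⟩ := h
    rw [ih h]
  | peek k f q ih =>
    intro q' h
    cases q' <;> simp only [F, Nat.pair_eq_pair, hb.eq_iff, Prod.mk.injEq] at h <;> try omega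
    obtain ⟨-, ⟨rfl, rfl⟩, h⟩ := h
    rw [ih h]
  | pop k f q ih =>
    intro q' h
    cases q' <;> simp only [F, Nat.pair_eq_pair, hb.eq_iff, Prod.mk.injEq] at h <;> try omega
    obtain ⟨-, ⟨rfl, rfl⟩, h⟩ := h
    rw [ih h]
  | load f q ih =>
    intro q' h
    cases q' <;> simp only [F, Nat.pair_eq_pair, hc.eq_iff] at h <;> try omega
    obtain ⟨-, rfl, h⟩ := h
    rw [ih h]
  | branch f q₁ q₂ ih₁ ih₂ =>
    intro q' h
    cases q' <;> simp only [F, Nat.pair_eq_pair, hd.eq_iff] at h <;> try omega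
    obtain ⟨-, rfl, h₁, h₂⟩ := h
    rw [ih₁ h₁, ih₂ h₂]
  | goto f =>
    intro q' h
    cases q' <;> simp only [F, Nat.pair_eq_pair, hg.eq_iff] at h <;> try omega
    rw [h.2]
  | halt =>
    intro q' h
    cases q' <;> simp only [F, Nat.pair_eq_pair] at h <;> first | rfl | omega

/-! ### Renaming the parts of a machine -/

namespace Turing.TM2

variable {K K' Λ Λ' σ σ' : Type} [DecidableEq K] [DecidableEq K'] (eK : K ≃ K') (eΛ : Λ ≃ Λ')
  (eσ : σ ≃ σ')

/-- A statement with renamed stores, labels and internal memory. -/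
def relabel : Stmt (fun _ : K => Bool) Λ σ → Stmt (fun _ : K' => Bool) Λ' σ'
  | .push k f q => .push (eK k) (fun v => f (eσ.symm v)) (relabel q)
  | .peek k f q => .peek (eK k) (fun v x => eσ (f (eσ.symm v) x)) (relabel q)
  | .pop k f q => .pop (eK k) (fun v x => eσ (f (eσ.symm v) x)) (relabel q)
  | .load f q => .load (fun v => eσ (f (eσ.symm v))) (relabel q)
  | .branch f q₁ q₂ => .branch (fun v => f (eσ.symm v)) (relabel q₁) (relabel q₂)
  | .goto f => .goto fun v => eΛ (f (eσ.symm v))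
  | .halt => .halt

/-- A configuration with renamed stores, labels and internal memory. -/
def relabelCfg (c : Cfg (fun _ : K => Bool) Λ σ) : Cfg (fun _ : K' => Bool) Λ' σ' :=
  ⟨c.l.map eΛ, eσ c.var, fun k => c.stk (eK.symm k)⟩

theorem update_comp_symm (S : K → List Bool) (k : K) (l : List Bool) :
    Function.update (fun j => S (eK.symm j)) (eK k) l =
      fun j => Function.update S k l (eK.symm j) := by
  ext1 j
  by_cases h : j = eK k
  · subst h; simp
  · rw [Function.update_of_ne h, Function.update_of_ne fun h' => h (by simp [← h'])]

theorem stepAux_relabel (q : Stmt (fun _ : K => Bool) Λ σ) (v : σ) (S : K → List Bool) :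
    stepAux (relabel eK eΛ eσ q) (eσ v) (fun k => S (eK.symm k)) =
      relabelCfg eK eΛ eσ (stepAux q v S) := by
  induction q generalizing v S with
  | push k f q ih => simp only [relabel, stepAux, Equiv.symm_apply_apply, ← ih, update_comp_symm]
  | peek k f q ih => simp only [relabel, stepAux, Equiv.symm_apply_apply, ← ih]
  | pop k f q ih => simp only [relabel, stepAux, Equiv.symm_apply_apply, ← ih, update_comp_symm]
  | load f q ih => simp only [relabel, stepAux, Equiv.symm_apply_apply, ← ih]
  | branch f q₁ q₂ ih₁ ih₂ =>
    simp only [relabel, stepAux, Equiv.symm_apply_apply]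
    cases f v
    · exact ih₂ v S
    · exact ih₁ v S
  | goto f => simp [relabel, stepAux, relabelCfg]
  | halt => rfl

end Turing.TM2

/-- Machines whose stores, labels and memory states are the numbers below `k`, `l` and `s`. -/
abbrev MachineCode : Type :=
  Σ k l s : ℕ, Fin l × Fin s × Fin k × Fin k ×
    (Bool → Fin l → Turing.TM2.Stmt (fun _ : Fin k => Bool) (Fin l) (Fin s))

namespace MachineCode

/-- The machine with a given code. -/
def toMachine (c : MachineCode) : Machine where
  K := Fin c.1
  Λ := Fin c.2.1
  σ := Fin c.2.2.1
  main := c.2.2.2.1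
  init := c.2.2.2.2.1
  inp := c.2.2.2.2.2.1
  out := c.2.2.2.2.2.2.1
  m := c.2.2.2.2.2.2.2

instance : Countable MachineCode :=
  have := fun k l s => Turing.TM2.countable_stmt (Fin k) (Fin l) (Fin s)
  inferInstance

instance : Nonempty MachineCode := ⟨⟨1, 1, 1, 0, 0, 0, 0, fun _ _ => .halt⟩⟩

end MachineCode

open Turing.TM2 in
/-- Every machine behaves like one that has a code. -/
theorem Machine.exists_code (M : Machine) : ∃ c : MachineCode, ∀ x r : List Bool,
    ((c.toMachine.run x r).l = none ↔ (M.run x r).l = none) ∧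
      (c.toMachine.run x r).stk c.toMachine.out = (M.run x r).stk M.out := by
  obtain ⟨k, ⟨eK⟩⟩ := Finite.exists_equiv_fin M.K
  obtain ⟨l, ⟨eΛ⟩⟩ := Finite.exists_equiv_fin M.Λ
  obtain ⟨s, ⟨eσ⟩⟩ := Finite.exists_equiv_fin M.σ
  let c : MachineCode := ⟨k, l, s, eΛ M.main, eσ M.init, eK M.inp, eK M.out,
    fun b i => relabel eK eΛ eσ (M.m b (eΛ.symm i))⟩
  have hstart : ∀ x, c.toMachine.start x = relabelCfg eK eΛ eσ (M.start x) := fun x => by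
    simp only [Machine.start, relabelCfg, Option.map_some]
    rw [← update_comp_symm]
    rfl
  have hstep : ∀ b C, c.toMachine.step (relabelCfg eK eΛ eσ C) b =
      relabelCfg eK eΛ eσ (M.step C b) := fun b C => by
    obtain ⟨_ | i, v, S⟩ := C
    · rfl
    · rw [M.step_some, ← stepAux_relabel]
      have : c.toMachine.m b (eΛ i) = relabel eK eΛ eσ (M.m b i) := by
        simp [c, MachineCode.toMachine]
      rw [← this]
      rfl
  have hrun : ∀ x r, c.toMachine.run x r = relabelCfg eK eΛ eσ (M.run x r) := fun x r => by
    rw [Machine.run, Machine.run, hstart]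
    generalize M.start x = C
    induction r generalizing C with
    | nil => rfl
    | cons b r ih =>
      exact (congrArg (fun C => List.foldl c.toMachine.step C r) (hstep b C)).trans (ih _)
  refine ⟨c, fun x r => ?_⟩
  rw [hrun]
  constructor
  · exact Option.map_eq_none_iff
  · change (M.run x r).stk (eK.symm (eK M.out)) = _
    rw [Equiv.symm_apply_apply]

/-- If every algorithm fails on some circuit for all large `N`, then a single family of circuits
defeats all algorithms infinitely often. -/
theorem exists_family_not_samples {ε : ℝ} {S : (ℕ → ℕ) → Prop}
    (h : ∀ (M : Machine) (T : ℕ → ℕ), M.RunsIn T → S T →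
      ∃ N₀ : ℕ, ∀ N > N₀, ∃ C : IQPCircuit N, ¬ M.Samples (T N) C ε) :
    ∃ C : ∀ N : ℕ, IQPCircuit N, ∀ (M : Machine) (T : ℕ → ℕ), M.RunsIn T → S T →
      ∀ N₀ : ℕ, ∃ N > N₀, ¬ M.Samples (T N) (C N) ε := by
  obtain ⟨g, hg⟩ := exists_surjective_nat MachineCode
  -- The circuit has to be fixed before the time bound is known, so it must be bad for every valid
  -- `t` at once. This is possible because the output probabilities agree for all valid `t`.
  have hC : ∀ N : ℕ, ∃ C : IQPCircuit N, ∀ t : ℕ,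
      (∀ (C : IQPCircuit N) (r : List Bool), r.length = t →
        ((g N.unpair.1).toMachine.run C.encode r).l = none) →
      (∃ C : IQPCircuit N, ¬ (g N.unpair.1).toMachine.Samples t C ε) →
      ¬ (g N.unpair.1).toMachine.Samples t C ε := fun N => by
    by_cases hN : ∃ t : ℕ, (∀ (C : IQPCircuit N) (r : List Bool), r.length = t →
        ((g N.unpair.1).toMachine.run C.encode r).l = none) ∧
      ∃ C : IQPCircuit N, ¬ (g N.unpair.1).toMachine.Samples t C ε
    · obtain ⟨t, ht, C, hC⟩ := hN
      refine ⟨C, fun t' ht' _ hC' => hC ?_⟩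
      have : ∀ z, (g N.unpair.1).toMachine.outputProb t C z =
          (g N.unpair.1).toMachine.outputProb t' C z := fun z =>
        Machine.coinProb_congr (ht C) (ht' C) fun c =>
          c.l = none ∧ c.stk (g N.unpair.1).toMachine.out = z.toList
      simpa only [Machine.Samples, this] using hC'
    · exact ⟨⟨fun _ => false, fun _ => false, fun _ => false⟩,
        fun t ht hS => (hN ⟨t, ht, hS⟩).elim⟩
  choose C hC using hC
  refine ⟨C, fun M T hM hT N₀ => ?_⟩
  obtain ⟨c, hc⟩ := M.exists_code
  obtain ⟨i, rfl⟩ := hg c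
  have hM' : (g i).toMachine.RunsIn T := fun N C r hr => (hc _ r).1.2 (hM N C r hr)
  obtain ⟨N₁, h₁⟩ := h _ T hM' hT
  -- The numbers `Nat.pair i m` are at least `m`, so the machine with number `i` is treated at
  -- arbitrarily large `N`.
  obtain ⟨N, hN, hi⟩ : ∃ N, max N₀ N₁ < N ∧ N.unpair.1 = i :=
    ⟨Nat.pair i (max N₀ N₁ + 1), Nat.right_le_pair i (max N₀ N₁ + 1), by rw [Nat.unpair_pair]⟩
  have hbad := hC N (T N)
  rw [hi] at hbad
  refine ⟨N, by omega, fun hS => hbad (hM' N) (h₁ N (by omega)) ?_⟩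
  simpa only [Machine.Samples, Machine.outputProb, hc] using hS

theorem theorem1 (u v : ℝ) (hu : 0 < u) (hv : 0 < v) (hv' : v < 1 / 3) :
    ∃ ε : ℝ, 0 < ε ∧ ∀ w : ℝ, 0 < w → w < 1 → ∀ a : ℝ, 0 < a → SqGapHardness u v w a →
      -- every algorithm fails, for all large `N`, on some `N`-qubit circuit
      (∀ (M : Machine) (T : ℕ → ℕ), M.RunsIn T → IsBigOTwoPow a T →
        ∃ N₀ : ℕ, ∀ N > N₀, ∃ C : IQPCircuit N, ¬ M.Samples (T N) C ε) ∧
      -- one family of circuits is sampled by no algorithm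
      (∃ C : ∀ N : ℕ, IQPCircuit N, ∀ (M : Machine) (T : ℕ → ℕ), M.RunsIn T → IsBigOTwoPow a T →
        ∀ N₀ : ℕ, ∃ N > N₀, ¬ M.Samples (T N) (C N) ε) := by
  -- The largest `τ` admitted by `8 τ ≤ 1 - 3 v`. The resulting `ε = u τ² / 4` involves neither `w`
  -- nor `a`: the value of `w` only affects the number of rounds.
  have hτ : 0 < (1 - 3 * v) / 8 := by linarith
  refine ⟨u * ((1 - 3 * v) / 8) * ((1 - 3 * v) / 8) / 4, by positivity, fun w _ hw a ha hard => ?_⟩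
  have h1 : ∀ (M : Machine) (T : ℕ → ℕ), M.RunsIn T → IsBigOTwoPow a T →
      ∃ N₀ : ℕ, ∀ N > N₀, ∃ C : IQPCircuit N,
        ¬ M.Samples (T N) C (u * ((1 - 3 * v) / 8) * ((1 - 3 * v) / 8) / 4) :=
    fun M T hM hT => exists_not_samples hu hv hτ (by linarith) rfl hw ha hard hM hT
  exact ⟨h1, exists_family_not_samples h1⟩
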